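/- Let $\lambda\in\mathbb R$, $\lambda\ne0$. Let $SU_2^\star\subset SL_2(\mathbb C)$ be the group of matrices $\begin{pmatrix}w&0\\ z&w^{-1}\end{pmatrix}$, $w>0$, $z\in\mathbb C$. Enveloping algebras of real Lie algebras are taken over $\mathbb C$ (after complexification), and $sl_2$ is $sl_2(\mathbb C)$ regarded as a real Lie algebra. Let $X_1=\lambda e_{21}$, $X_2=\imath\lambda e_{21}$, $X_3=\frac\lambda2\sigma_3$ be the basis of $su_2^\star={\rm Lie}(SU_2^\star)$, let $x_a=\imath X_a\in U(su_2^\star)$, and let $J_a=\imath\cdot(-\frac\imath2\sigma_a)\in U(su_2)$, where the outer $\imath$ is the scalar of the complexification. Let $\mathbb C[SU_2^\star]$ be the algebra of functions on $SU_2^\star$ generated by $w,w^{-1},z,\bar z,\log w$, with the Hopf algebra structure induced by the group, and define $P_a\in\mathbb C[SU_2^\star]$ by $zw^{-1}=\lambda(P_1+\imath P_2)$, $w=e^{\lambda P_3/2}$. Then: (1) (Iwasawa) Every element of $SL_2(\mathbb C)$ factorises uniquely as $$\begin{pmatrix}a&b\\ c&d\end{pmatrix}=\begin{pmatrix}w&0\\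 z&w^{-1}\end{pmatrix}\begin{pmatrix}x&y\\ -\bar y&\bar x\end{pmatrix},\qquad w>0,\ |x|^2+|y|^2=1,$$ namely with $w=\sqrt{|a|^2+|b|^2}$, $x=w^{-1}a$, $y=w^{-1}b$, $z=w^{-1}(\bar ac+\bar bd)$. Correspondingly $U(sl_2)=U(su_2^\star)\bowtie U(su_2)$ as Hopf algebras: with $H_1=U(su_2^\star)$, $H_2=U(su_2)$, multiplication $H_1\otimes H_2\to U(sl_2)$ is a linear isomorphism, and $a\,h=\sum(a_{(1)}\triangleright h_{(1)})(a_{(2)}\triangleleft h_{(2)})$ for $a\in H_2$, $h\in H_1$, with a left action $\triangleright$ of $H_2$ on $H_1$ and a right action $\triangleleft$ of $H_1$ on $H_2$, obtained by applying the counit of $H_2$, respectively of $H_1$, to the product $ah$ viewed in $H_1\otimes H_2$. (2) (Semidual) There is a non-degenerate Hopf algebra pairing $\langle\ ,\ \rangle$ of $\mathbb C[SU_2^\star]$ with $U(su_2^\star)$ in which $\langle\phi,X\rangle$, $X\in su_2^\star$, is the derivative of $\phi$ at the identity along $X$. There are an action and a coaction on the dual side, $\phi\triangleleft a\in\mathbb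 C[SU_2^\star]$ with $\langle\phi\triangleleft a,h\rangle=\langle\phi,a\triangleright h\rangle$ and $a\mapsto a_{(0)}\otimes a_{(1)}\in\mathbb C[SU_2^\star]\otimes U(su_2)$ with $a\triangleleft h=\langle a_{(0)},h\rangle a_{(1)}$; the first is by the vector fields of the nonlinear action of $SU_2$ on the manifold $SU_2^\star$, in which $u$ sends $g$ to the $SU_2^\star$-factor of $ug$. The vector space $U(su_2)\otimes\mathbb C[SU_2^\star]$ is a Hopf algebra $U(su_2)\,{\triangleright\!\blacktriangleleft}\,\mathbb C[SU_2^\star]$ with unit $1\otimes1$, counit $\epsilon\otimes\epsilon$ and $$(a\otimes\phi)(b\otimes\psi)=\sum ab_{(1)}\otimes(\phi\triangleleft b_{(2)})\psi,\qquad \Delta(a\otimes\phi)=\sum(a_{(1)}\otimes a_{(2)(0)}\phi_{(1)})\otimes(a_{(2)(1)}\otimes\phi_{(2)}).$$ It is generated as an algebra by $J_a$, $P_a$ and $e^{\pm\lambda P_3/2}$. The $P_a$ and $e^{-\lambda P_3}$ commute with each other, $[e^{-\lambda P_3},J_a]=-\lambda e^{-\lambda P_3}[P_3,J_a]$, and (summing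 over repeated $c$, and over $b$ in the third relation) $$[J_a,J_b]=\imath\epsilon_{abc}J_c,\quad [P_a,J_3]=\imath\epsilon_{a3c}P_c,\quad [P_3,J_a]=\imath\epsilon_{3ab}P_b,$$ $$[P_a,J_b]=\tfrac\imath2\epsilon_{ab3}\Big(\frac{1-e^{-2\lambda P_3}}\lambda+\lambda(P_1^2+P_2^2)\Big)-\imath\lambda\epsilon_{ac3}P_bP_c\qquad(a,b\in\{1,2\}),$$ $$\Delta J_i=J_i\otimes1+e^{-\lambda P_3}\otimes J_i+\lambda P_i\otimes J_3,\qquad\Delta P_i=P_i\otimes1+e^{-\lambda P_3}\otimes P_i\qquad(i=1,2),$$ while $P_3$, $J_3$ are primitive: $\Delta P_3=P_3\otimes1+1\otimes P_3$, $\Delta J_3=J_3\otimes1+1\otimes J_3$. (3) (Action on spacetime) In $U(su_2^\star)$ one has $[x_i,x_3]=\imath\lambda x_i$ for $i=1,2$ and $[x_1,x_2]=0$, and normal ordering $f\mapsto{:}f(x){:}$ (the linear map sending the monomial $x_1^lx_2^mx_3^n$ to the product in this order, $x_3$ to the right) is a linear bijection $\mathbb C[x_1,x_2,x_3]\to U(su_2^\star)$.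 The formula $(a\otimes\phi)\triangleright h=\sum(a\triangleright h_{(1)})\langle\phi,h_{(2)}\rangle$ makes $U(su_2^\star)$ a left module algebra over $U(su_2)\,{\triangleright\!\blacktriangleleft}\,\mathbb C[SU_2^\star]$, and $$J_a\triangleright x_b=\imath\epsilon_{abc}x_c,\qquad P_a\triangleright{:}f(x){:}=\imath\,{:}\frac{\partial f}{\partial x_a}(x){:}$$ for every polynomial $f$. -/

import Mathlib

open scoped TensorProduct

attribute [local instance 100] LieRing.ofAssociativeRing

noncomputable section

/-! ### Universal enveloping algebras as Hopf algebras -/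

namespace UEA

open UniversalEnvelopingAlgebra (ι)

variable {k : Type*} [CommRing k] {L : Type*} [LieRing L] [LieAlgebra k L]
  {L' : Type*} [LieRing L'] [LieAlgebra k L']

/-- The coproduct of an enveloping algebra, `ι x ↦ ι x ⊗ 1 + 1 ⊗ ι x` for `x` in the Lie algebra. -/
def comulHom (k L : Type*) [CommRing k] [LieRing L] [LieAlgebra k L] :
    UniversalEnvelopingAlgebra k L →ₐ[k]
      UniversalEnvelopingAlgebra k L ⊗[k] UniversalEnvelopingAlgebra k L :=
  UniversalEnvelopingAlgebra.lift k
    { toFun := fun x => ι k x ⊗ₜ 1 + 1 ⊗ₜ ι k x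
      map_add' := fun x y => by
        simp only [map_add, TensorProduct.add_tmul, TensorProduct.tmul_add]; abel
      map_smul' := fun c x => by
        simp only [map_smul, TensorProduct.smul_tmul', TensorProduct.tmul_smul, smul_add,
          RingHom.id_apply]
      map_lie' := fun {x y} => by
        simp only [LieHom.map_lie, LieRing.of_associative_ring_bracket, TensorProduct.sub_tmul,
          TensorProduct.tmul_sub, mul_add, add_mul, Algebra.TensorProduct.tmul_mul_tmul, one_mul,
          mul_one]
        abel }

/-- The counit of an enveloping algebra, `ι x ↦ 0`. -/
def counitHom (k L : Type*) [CommRing k] [LieRing L] [LieAlgebra k L] :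
    UniversalEnvelopingAlgebra k L →ₐ[k] k :=
  UniversalEnvelopingAlgebra.lift k 0

/-- The antipode of an enveloping algebra, the antihomomorphism with `ι x ↦ - ι x`. -/
def antipodeHom (k L : Type*) [CommRing k] [LieRing L] [LieAlgebra k L] :
    UniversalEnvelopingAlgebra k L →ₐ[k] (UniversalEnvelopingAlgebra k L)ᵐᵒᵖ :=
  UniversalEnvelopingAlgebra.lift k
    { toFun := fun x => MulOpposite.op (-ι k x)
      map_add' := fun x y => by
        simp only [map_add, neg_add, MulOpposite.op_add]
      map_smul' := fun c x => by
        simp only [map_smul, ← smul_neg, MulOpposite.op_smul, RingHom.id_apply]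
      map_lie' := fun {x y} => by
        simp only [LieHom.map_lie, LieRing.of_associative_ring_bracket, ← MulOpposite.op_mul,
          ← MulOpposite.op_sub, neg_mul_neg, neg_sub] }

@[simp] theorem comulHom_ι (x : L) : comulHom k L (ι k x) =
    ι k x ⊗ₜ 1 + 1 ⊗ₜ ι k x := by
  rw [comulHom, UniversalEnvelopingAlgebra.lift_ι_apply]; rfl

@[simp] theorem counitHom_ι (x : L) : counitHom k L (ι k x) = 0 := by
  rw [counitHom, UniversalEnvelopingAlgebra.lift_ι_apply]; rfl

@[simp] theorem antipodeHom_ι (x : L) : antipodeHom k L (ι k x) =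
    MulOpposite.op (-ι k x) := by
  rw [antipodeHom, UniversalEnvelopingAlgebra.lift_ι_apply]; rfl

theorem hom_ext' {A : Type*} [Ring A] [Algebra k A] 
    {f g : UniversalEnvelopingAlgebra k L →ₐ[k] A}
    (h : ∀ x : L, f (ι k x) = g (ι k x)) :
    f = g :=
  UniversalEnvelopingAlgebra.hom_ext k (LieHom.ext h)

theorem adjoin_ι :
    Algebra.adjoin k (Set.range (ι k : L → UniversalEnvelopingAlgebra k L)) = ⊤ := by
  set S := Algebra.adjoin k (Set.range (ι k : L → UniversalEnvelopingAlgebra k L))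
  let f : L →ₗ⁅k⁆ S :=
    { toFun := fun x => ⟨ι k x, Algebra.subset_adjoin ⟨x, rfl⟩⟩
      map_add' := fun x y => Subtype.ext (map_add _ x y)
      map_smul' := fun c x => Subtype.ext (map_smul _ c x)
      map_lie' := fun {x y} => Subtype.ext (by
        simp only [LieHom.map_lie, LieRing.of_associative_ring_bracket]; rfl) }
  have h : S.val.comp (UniversalEnvelopingAlgebra.lift k f) =
      AlgHom.id k (UniversalEnvelopingAlgebra k L) := by
    apply hom_ext'
    intro x
    simp only [AlgHom.comp_apply, UniversalEnvelopingAlgebra.lift_ι_apply]; rfl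
  rw [eq_top_iff]
  intro u _
  have := DFunLike.congr_fun h u
  simp only [AlgHom.comp_apply, AlgHom.id_apply] at this
  rw [← this]
  exact Subtype.prop _

instance instBialgebra : Bialgebra k (UniversalEnvelopingAlgebra k L) :=
  Bialgebra.ofAlgHom (comulHom k L) (counitHom k L)
    (by
      apply hom_ext'
      intro x
      simp [-UniversalEnvelopingAlgebra.ι_apply, TensorProduct.add_tmul,
        TensorProduct.tmul_add, Algebra.TensorProduct.one_def, add_assoc])
    (by
      apply hom_ext'
      intro x
      simp [-UniversalEnvelopingAlgebra.ι_apply])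
    (by
      apply hom_ext'
      intro x
      simp [-UniversalEnvelopingAlgebra.ι_apply])

theorem comul_eq (u : UniversalEnvelopingAlgebra k L) : Coalgebra.comul (R := k) u = comulHom k L u := rfl

theorem counit_eq (u : UniversalEnvelopingAlgebra k L) : Coalgebra.counit (R := k) u = counitHom k L u := rfl

/-- The antipode as a linear map. -/
def antipodeLin (k L : Type*) [CommRing k] [LieRing L] [LieAlgebra k L] :
    UniversalEnvelopingAlgebra k L →ₗ[k] UniversalEnvelopingAlgebra k L :=
  (MulOpposite.opLinearEquiv k).symm.toLinearMap ∘ₗ (antipodeHom k L).toLinearMap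

theorem antipodeLin_mul (u v : UniversalEnvelopingAlgebra k L) :
    antipodeLin k L (u * v) = antipodeLin k L v * antipodeLin k L u := by
  simp [antipodeLin]

theorem antipodeLin_one : antipodeLin k L 1 = 1 := by
  simp [antipodeLin]

theorem antipodeLin_ι (x : L) : antipodeLin k L (ι k x) =
    -ι k x := by
  simp only [antipodeLin, LinearMap.comp_apply, AlgHom.toLinearMap_apply, antipodeHom_ι]
  rfl

instance instHopfAlgebra : HopfAlgebra k (UniversalEnvelopingAlgebra k L) where
  antipode := antipodeLin k L
  mul_antipode_rTensor_comul := by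
    have key : ∀ (c : k) (T : UniversalEnvelopingAlgebra k L ⊗[k] UniversalEnvelopingAlgebra k L),
        LinearMap.mul' k _ ((antipodeLin k L).rTensor _ T) = algebraMap k _ c →
        ∀ W : UniversalEnvelopingAlgebra k L ⊗[k] UniversalEnvelopingAlgebra k L,
          LinearMap.mul' k _ ((antipodeLin k L).rTensor _ (T * W)) =
          c • LinearMap.mul' k _ ((antipodeLin k L).rTensor _ W) := by
      intro c T hT W
      induction W with
      | zero => simp
      | add W₁ W₂ h₁ h₂ => simp only [mul_add, map_add, h₁, h₂, smul_add]
      | tmul a b =>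
        have : LinearMap.mul' k _ ((antipodeLin k L).rTensor _ (T * a ⊗ₜ[k] b)) =
            antipodeLin k L a * LinearMap.mul' k _ ((antipodeLin k L).rTensor _ T) * b := by
          clear hT
          induction T with
          | zero => simp
          | add W₁ W₂ h₁ h₂ => simp only [add_mul, mul_add, map_add, h₁, h₂]
          | tmul s t => simp [antipodeLin_mul, mul_assoc]
        rw [this, hT]
        simp [Algebra.algebraMap_eq_smul_one]
    ext u
    have hu : u ∈ Algebra.adjoin k
        (Set.range (ι k : L → UniversalEnvelopingAlgebra k L)) := by
      rw [adjoin_ι]; trivial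
    simp only [LinearMap.comp_apply, comul_eq, counit_eq, Algebra.linearMap_apply]
    induction hu using Algebra.adjoin_induction with
    | mem x hx =>
      obtain ⟨x, rfl⟩ := hx
      simp [-UniversalEnvelopingAlgebra.ι_apply, antipodeLin_ι, antipodeLin_one]
    | algebraMap r => simp [Algebra.algebraMap_eq_smul_one, antipodeLin_one,
        Algebra.TensorProduct.one_def]
    | add x y _ _ hx hy => simp only [map_add, hx, hy]
    | mul x y _ _ hx hy =>
      have h₁ : comulHom k L (x * y) = comulHom k L x * comulHom k L y := map_mul _ _ _
      have h₂ : counitHom k L (x * y) = counitHom k L x * counitHom k L y := map_mul _ _ _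
      rw [h₁, h₂, key _ _ hx, hy, Algebra.smul_def, ← (algebraMap k _).map_mul]
  mul_antipode_lTensor_comul := by
    have key : ∀ (c : k) (W : UniversalEnvelopingAlgebra k L ⊗[k] UniversalEnvelopingAlgebra k L),
        LinearMap.mul' k _ ((antipodeLin k L).lTensor _ W) = algebraMap k _ c →
        ∀ T : UniversalEnvelopingAlgebra k L ⊗[k] UniversalEnvelopingAlgebra k L,
          LinearMap.mul' k _ ((antipodeLin k L).lTensor _ (T * W)) =
          c • LinearMap.mul' k _ ((antipodeLin k L).lTensor _ T) := by
      intro c W hW T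
      induction T with
      | zero => simp
      | add W₁ W₂ h₁ h₂ => simp only [add_mul, map_add, h₁, h₂, smul_add]
      | tmul a b =>
        have : LinearMap.mul' k _ ((antipodeLin k L).lTensor _ (a ⊗ₜ[k] b * W)) =
            a * LinearMap.mul' k _ ((antipodeLin k L).lTensor _ W) * antipodeLin k L b := by
          clear hW
          induction W with
          | zero => simp
          | add W₁ W₂ h₁ h₂ => simp only [add_mul, mul_add, map_add, h₁, h₂]
          | tmul s t => simp [antipodeLin_mul, mul_assoc]
        rw [this, hW]
        simp [Algebra.algebraMap_eq_smul_one]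
    ext u
    have hu : u ∈ Algebra.adjoin k
        (Set.range (ι k : L → UniversalEnvelopingAlgebra k L)) := by
      rw [adjoin_ι]; trivial
    simp only [LinearMap.comp_apply, comul_eq, counit_eq, Algebra.linearMap_apply]
    induction hu using Algebra.adjoin_induction with
    | mem x hx =>
      obtain ⟨x, rfl⟩ := hx
      simp [-UniversalEnvelopingAlgebra.ι_apply, antipodeLin_ι, antipodeLin_one]
    | algebraMap r => simp [Algebra.algebraMap_eq_smul_one, antipodeLin_one,
        Algebra.TensorProduct.one_def]
    | add x y _ _ hx hy => simp only [map_add, hx, hy]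
    | mul x y _ _ hx hy =>
      have h₁ : comulHom k L (x * y) = comulHom k L x * comulHom k L y := map_mul _ _ _
      have h₂ : counitHom k L (x * y) = counitHom k L x * counitHom k L y := map_mul _ _ _
      rw [h₁, h₂, key _ _ hy, hx, Algebra.smul_def, ← (algebraMap k _).map_mul, mul_comm]

/-- The Hopf algebra map `U(L) → U(L')` induced by a Lie algebra map. -/
def map (f : L →ₗ⁅k⁆ L') : UniversalEnvelopingAlgebra k L →ₐc[k] UniversalEnvelopingAlgebra k L' :=
  BialgHom.ofAlgHom (UniversalEnvelopingAlgebra.lift k ((ι k).comp f))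
    (by
      apply hom_ext'
      intro x
      simp only [AlgHom.comp_apply, UniversalEnvelopingAlgebra.lift_ι_apply]
      exact (counitHom_ι _).trans (counitHom_ι _).symm)
    (by
      apply hom_ext'
      intro x
      simp only [AlgHom.comp_apply, UniversalEnvelopingAlgebra.lift_ι_apply, LieHom.comp_apply]
      have h₁ : Bialgebra.comulAlgHom k (UniversalEnvelopingAlgebra k L) = comulHom k L := rfl
      have h₂ : Bialgebra.comulAlgHom k (UniversalEnvelopingAlgebra k L') = comulHom k L' := rfl
      rw [h₁, h₂, comulHom_ι, comulHom_ι]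
      simp only [map_add, Algebra.TensorProduct.map_tmul, map_one,
        UniversalEnvelopingAlgebra.lift_ι_apply, LieHom.comp_apply])

end UEA

/-! ### Double cross products and their semiduals -/

namespace Semidual

variable {k : Type*} [CommRing k] {H₁ H₂ H A B : Type*}
  [Ring H₁] [HopfAlgebra k H₁] [Ring H₂] [HopfAlgebra k H₂] [Ring H] [HopfAlgebra k H]
  [Ring A] [HopfAlgebra k A] [Ring B] [HopfAlgebra k B]

/-- The map `H₁ ⊗ H₂ → H`, `h ⊗ a ↦ i₁ h * i₂ a`. -/
def mulMap (i₁ : H₁ →ₐc[k] H) (i₂ : H₂ →ₐc[k] H) : H₁ ⊗[k] H₂ →ₗ[k] H :=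
  LinearMap.mul' k H ∘ₗ TensorProduct.map (i₁ : H₁ →ₗ[k] H) (i₂ : H₂ →ₗ[k] H)

/-- `H` factorises as `H₁ ⋈ H₂` through the Hopf algebra maps `i₁`, `i₂`: multiplication in `H` is
a linear isomorphism `H₁ ⊗ H₂ → H` (in particular `i₁` and `i₂` are injective). -/
def IsFactorisation (i₁ : H₁ →ₐc[k] H) (i₂ : H₂ →ₐc[k] H) : Prop :=
  Function.Injective i₁ ∧ Function.Injective i₂ ∧ Function.Bijective (mulMap i₁ i₂)

variable {i₁ : H₁ →ₐc[k] H} {i₂ : H₂ →ₐc[k] H}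

/-- The linear isomorphism `H₁ ⊗ H₂ ≃ H` of a factorisation. -/
def factorEquiv (hF : IsFactorisation i₁ i₂) : H₁ ⊗[k] H₂ ≃ₗ[k] H :=
  LinearEquiv.ofBijective (mulMap i₁ i₂) hF.2.2

/-- `a ⊗ h ↦ (1 ⊗ a) (h ⊗ 1)`, the product of `H` viewed on `H₁ ⊗ H₂`. -/
def reorder (hF : IsFactorisation i₁ i₂) : H₂ →ₗ[k] H₁ →ₗ[k] H₁ ⊗[k] H₂ :=
  ((LinearMap.mul k H).compl₁₂ (i₂ : H₂ →ₗ[k] H) (i₁ : H₁ →ₗ[k] H)).compr₂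
    (factorEquiv hF).symm.toLinearMap

/-- The left action `a ▷ h` of `H₂` on `H₁`: the `H₁`-component of `(1 ⊗ a) (h ⊗ 1)`. -/
def lact (hF : IsFactorisation i₁ i₂) : H₂ →ₗ[k] H₁ →ₗ[k] H₁ :=
  (reorder hF).compr₂
    ((TensorProduct.rid k H₁).toLinearMap ∘ₗ LinearMap.lTensor H₁ (Coalgebra.counit (R := k)))

/-- The right action `a ◁ h` of `H₁` on `H₂`: the `H₂`-component of `(1 ⊗ a) (h ⊗ 1)`. -/
def ract (hF : IsFactorisation i₁ i₂) : H₂ →ₗ[k] H₁ →ₗ[k] H₂ :=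
  (reorder hF).compr₂
    ((TensorProduct.lid k H₂).toLinearMap ∘ₗ LinearMap.rTensor H₂ (Coalgebra.counit (R := k)))

/-- The actions satisfy `(1 ⊗ a) (h ⊗ 1) = ∑ (a₍₁₎ ▷ h₍₁₎) ⊗ (a₍₂₎ ◁ h₍₂₎)`, `▷` is a left action
of the algebra `H₂`, and `◁` is a right action of the algebra `H₁`. -/
structure IsMatched (hF : IsFactorisation i₁ i₂) : Prop where
  reorder_eq : ∀ (a : H₂) (h : H₁), reorder hF a h =
    TensorProduct.map (TensorProduct.lift (lact hF)) (TensorProduct.lift (ract hF))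
      (Coalgebra.comul (R := k) (a ⊗ₜ[k] h))
  one_lact : ∀ h : H₁, lact hF 1 h = h
  mul_lact : ∀ (a b : H₂) (h : H₁), lact hF (a * b) h = lact hF a (lact hF b h)
  ract_one : ∀ a : H₂, ract hF a 1 = a
  ract_mul : ∀ (a : H₂) (h g : H₁), ract hF a (h * g) = ract hF (ract hF a h) g

/-- A non-degenerate dual pairing `⟨φ, h⟩` of Hopf algebras. -/
structure IsHopfPairing (p : A →ₗ[k] H₁ →ₗ[k] k) : Prop where
  mul_left : ∀ (φ ψ : A) (h : H₁), p (φ * ψ) h =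
    LinearMap.mul' k k (TensorProduct.map (p φ) (p ψ) (Coalgebra.comul (R := k) h))
  one_left : ∀ h : H₁, p 1 h = Coalgebra.counit (R := k) h
  mul_right : ∀ (φ : A) (h g : H₁), p φ (h * g) =
    LinearMap.mul' k k (TensorProduct.map (p.flip h) (p.flip g) (Coalgebra.comul (R := k) φ))
  one_right : ∀ φ : A, p φ 1 = Coalgebra.counit (R := k) φ
  antipode : ∀ (φ : A) (h : H₁), p (HopfAlgebra.antipode k φ) h = p φ (HopfAlgebra.antipode k h)
  separatingLeft : p.SeparatingLeft
  separatingRight : p.SeparatingRight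

/-- `r` is the right action `φ ◁ a` of `H₂` on the dual `A` of `H₁` with
`⟨φ ◁ a, h⟩ = ⟨φ, a ▷ h⟩`. -/
def IsDualAction (hF : IsFactorisation i₁ i₂) (p : A →ₗ[k] H₁ →ₗ[k] k)
    (r : A →ₗ[k] H₂ →ₗ[k] A) : Prop :=
  ∀ (φ : A) (a : H₂) (h : H₁), p (r φ a) h = p φ (lact hF a h)

/-- `δ` is the left coaction `a ↦ a₍₀₎ ⊗ a₍₁₎` of the dual `A` of `H₁` on `H₂` with
`a ◁ h = ⟨a₍₀₎, h⟩ a₍₁₎`. -/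
def IsDualCoaction (hF : IsFactorisation i₁ i₂) (p : A →ₗ[k] H₁ →ₗ[k] k)
    (δ : H₂ →ₗ[k] A ⊗[k] H₂) : Prop :=
  ∀ (a : H₂) (h : H₁),
    ract hF a h = TensorProduct.lid k H₂ (LinearMap.rTensor H₂ (p.flip h) (δ a))

/-- The Hopf algebra `B` is, through `e : H₂ ⊗ A ≃ B`, the bicrossproduct on the vector space
`H₂ ⊗ A` given by the right action `r` of `H₂` on `A` and the left coaction `δ` of `A` on `H₂`:
`(a ⊗ φ) (b ⊗ ψ) = ∑ a b₍₁₎ ⊗ (φ ◁ b₍₂₎) ψ` and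
`Δ (a ⊗ φ) = ∑ (a₍₁₎ ⊗ a₍₂₎₍₀₎ φ₍₁₎) ⊗ (a₍₂₎₍₁₎ ⊗ φ₍₂₎)`,
with unit `1 ⊗ 1` and counit `ε ⊗ ε`. -/
structure IsBicrossproduct (r : A →ₗ[k] H₂ →ₗ[k] A) (δ : H₂ →ₗ[k] A ⊗[k] H₂)
    (e : H₂ ⊗[k] A ≃ₗ[k] B) : Prop where
  one : e (1 ⊗ₜ 1) = 1
  mul : ∀ (a b : H₂) (φ ψ : A), e (a ⊗ₜ φ) * e (b ⊗ₜ ψ) =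
    e (TensorProduct.map (LinearMap.mulLeft k a) (LinearMap.mulRight k ψ ∘ₗ r φ)
      (Coalgebra.comul (R := k) b))
  counit : ∀ (a : H₂) (φ : A), Coalgebra.counit (R := k) (e (a ⊗ₜ φ)) =
    Coalgebra.counit (R := k) a * Coalgebra.counit (R := k) φ
  comul : ∀ (a : H₂) (φ : A) (ι κ : Type) (R : Coalgebra.Repr k a ι) (S : Coalgebra.Repr k φ κ),
    Coalgebra.comul (R := k) (e (a ⊗ₜ φ)) =
      TensorProduct.map e.toLinearMap e.toLinearMap
        (∑ m ∈ R.index, ∑ n ∈ S.index,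
          TensorProduct.map (TensorProduct.mk k H₂ A (R.left m) ∘ₗ LinearMap.mulRight k (S.left n))
            ((TensorProduct.mk k H₂ A).flip (S.right n)) (δ (R.right m)))

/-- The canonical left action of the semidual on `H₁`:
`(a ⊗ φ) ▷ h = ∑ (a ▷ h₍₁₎) ⟨φ, h₍₂₎⟩`. -/
def IsCanonicalAction (hF : IsFactorisation i₁ i₂) (p : A →ₗ[k] H₁ →ₗ[k] k)
    (e : H₂ ⊗[k] A ≃ₗ[k] B) (act : B →ₗ[k] H₁ →ₗ[k] H₁) : Prop :=
  ∀ (a : H₂) (φ : A) (h : H₁), act (e (a ⊗ₜ φ)) h =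
    TensorProduct.rid k H₁ (TensorProduct.map (lact hF a) (p φ) (Coalgebra.comul (R := k) h))

/-- `act` is a covariant left action of the Hopf algebra `B` on the algebra `H₁`, that is, `H₁` is
a left `B`-module algebra: `b ▷ 1 = ε(b) 1` and `b ▷ (h g) = ∑ (b₍₁₎ ▷ h) (b₍₂₎ ▷ g)`. -/
structure IsModuleAlgebra (act : B →ₗ[k] H₁ →ₗ[k] H₁) : Prop where
  one_act : ∀ h : H₁, act 1 h = h
  mul_act : ∀ (b c : B) (h : H₁), act (b * c) h = act b (act c h)
  act_one : ∀ b : B, act b 1 = algebraMap k H₁ (Coalgebra.counit (R := k) b)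
  act_mul : ∀ (b : B) (h g : H₁), act b (h * g) =
    LinearMap.mul' k H₁ (TensorProduct.map (act.flip h) (act.flip g) (Coalgebra.comul (R := k) b))

end Semidual

/-! ### The groups `SU₂`, `SU₂⋆` and the commutative Hopf algebra `ℂ[SU₂⋆]` -/

namespace Iwasawa

open Matrix ComplexConjugate

/-- The solvable group `SU₂⋆` of the matrices `!![w, 0; z, w⁻¹]`, `w > 0`, `z ∈ ℂ`. -/
def SU2Star : Subgroup (SpecialLinearGroup (Fin 2) ℂ) where
  carrier := {g | g 0 1 = 0 ∧ (g 0 0).im = 0 ∧ 0 < (g 0 0).re}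
  one_mem' := by simp
  mul_mem' := by
    rintro g h ⟨hg₁, hg₂, hg₃⟩ ⟨hh₁, hh₂, hh₃⟩
    have h₀₀ : (g * h) 0 0 = g 0 0 * h 0 0 + g 0 1 * h 1 0 := by
      simp [Matrix.mul_apply, Fin.sum_univ_two]
    have h₀₁ : (g * h) 0 1 = g 0 0 * h 0 1 + g 0 1 * h 1 1 := by
      simp [Matrix.mul_apply, Fin.sum_univ_two]
    refine ⟨?_, ?_, ?_⟩
    · rw [h₀₁, hg₁, hh₁]; ring
    · rw [h₀₀, hg₁]; simp [hg₂, hh₂]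
    · rw [h₀₀, hg₁]; simp only [zero_mul, add_zero, Complex.mul_re, hg₂, sub_zero]; positivity
  inv_mem' := by
    rintro g ⟨hg₁, hg₂, hg₃⟩
    have hdet : g 0 0 * g 1 1 = 1 := by
      have := g.det_coe
      rw [Matrix.det_fin_two, hg₁] at this
      simpa using this
    have h₀₀ : g⁻¹ 0 0 = g 1 1 := by simp [Matrix.SpecialLinearGroup.coe_inv, Matrix.adjugate_fin_two]
    have h₀₁ : g⁻¹ 0 1 = -g 0 1 := by simp [Matrix.SpecialLinearGroup.coe_inv, Matrix.adjugate_fin_two]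
    have hre : g 0 0 = ((g 0 0).re : ℂ) := Complex.ext rfl (by simp [hg₂])
    have h₁₁ : g 1 1 = (((g 0 0).re)⁻¹ : ℝ) := by
      rw [Complex.ofReal_inv, ← hre]
      exact eq_inv_of_mul_eq_one_right hdet
    refine ⟨?_, ?_, ?_⟩
    · rw [h₀₁, hg₁, neg_zero]
    · rw [h₀₀, h₁₁]; exact Complex.ofReal_im _
    · rw [h₀₀, h₁₁, Complex.ofReal_re]; positivity

/-- The subgroup `SU₂` of `SL₂(ℂ)`. -/
def SU2 : Subgroup (SpecialLinearGroup (Fin 2) ℂ) where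
  carrier := {g | (g : Matrix (Fin 2) (Fin 2) ℂ) ∈ Matrix.unitaryGroup (Fin 2) ℂ}
  one_mem' := by simp
  mul_mem' := by
    intro g h hg hh
    simpa using mul_mem hg hh
  inv_mem' := by
    intro g hg
    have h₁ : (g : Matrix (Fin 2) (Fin 2) ℂ) * star (g : Matrix (Fin 2) (Fin 2) ℂ) = 1 :=
      Matrix.mem_unitaryGroup_iff.1 hg
    have h₂ : (g⁻¹).1 * g.1 = 1 := congrArg Subtype.val (inv_mul_cancel g)
    have h₃ : (g⁻¹).1 = star g.1 := left_inv_eq_right_inv h₂ h₁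
    change (g⁻¹).1 ∈ Matrix.unitaryGroup (Fin 2) ℂ
    rw [h₃]
    exact Unitary.star_mem hg

/-- The element `!![w, 0; z, w⁻¹]` of `SU₂⋆`. -/
def SU2Star.mk (w : ℝ) (hw : 0 < w) (z : ℂ) : SU2Star :=
  ⟨⟨!![(w : ℂ), 0; z, (w : ℂ)⁻¹], by
    have : (w : ℂ) ≠ 0 := Complex.ofReal_ne_zero.2 hw.ne'
    simp [Matrix.det_fin_two, this]⟩, by
    refine ⟨?_, ?_, ?_⟩ <;> simp [hw]⟩

theorem firstRow_pos (g : SpecialLinearGroup (Fin 2) ℂ) :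
    0 < √(‖g 0 0‖ ^ 2 + ‖g 0 1‖ ^ 2) := by
  apply Real.sqrt_pos.2
  by_contra hcon
  have h₀ : ‖g 0 0‖ ^ 2 = 0 := by nlinarith [sq_nonneg ‖g 0 0‖, sq_nonneg ‖g 0 1‖]
  have h₁ : ‖g 0 1‖ ^ 2 = 0 := by nlinarith [sq_nonneg ‖g 0 0‖, sq_nonneg ‖g 0 1‖]
  have hdet := g.det_coe
  rw [Matrix.det_fin_two, norm_eq_zero.1 (pow_eq_zero_iff two_ne_zero |>.1 h₀),
    norm_eq_zero.1 (pow_eq_zero_iff two_ne_zero |>.1 h₁)] at hdet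
  simp at hdet

/-- The `SU₂⋆`-factor of `!![a, b; c, d] ∈ SL₂(ℂ)`: `w = √(|a|² + |b|²)` and
`z = w⁻¹ (ā c + b̄ d)`. -/
def solvablePart (g : SpecialLinearGroup (Fin 2) ℂ) : SU2Star :=
  SU2Star.mk (√(‖g 0 0‖ ^ 2 + ‖g 0 1‖ ^ 2)) (firstRow_pos g)
    ((√(‖g 0 0‖ ^ 2 + ‖g 0 1‖ ^ 2) : ℂ)⁻¹ * (conj (g 0 0) * g 1 0 + conj (g 0 1) * g 1 1))

/-- The coordinates `w`, `w⁻¹`, `z`, `z̄`, `log w` of `!![w, 0; z, w⁻¹] ∈ SU₂⋆`. -/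
def coord : Fin 5 → SU2Star → ℂ :=
  ![fun g => g.1 0 0, fun g => g.1 1 1, fun g => g.1 1 0, fun g => conj (g.1 1 0),
    fun g => (Real.log (g.1 0 0).re : ℂ)]

/-- The commutative algebra `ℂ[SU₂⋆]` of complex functions on the group `SU₂⋆` generated by the
matrix entries `w`, `w⁻¹`, `z`, their conjugates, and the logarithmic coordinate `log w`. -/
def coordRing : Subalgebra ℂ (SU2Star → ℂ) := Algebra.adjoin ℂ (Set.range coord)

theorem coord_mem (i : Fin 5) : coord i ∈ coordRing := Algebra.subset_adjoin ⟨i, rfl⟩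

/-- The algebra `ℂ[SU₂⋆]` as a type. -/
def FunSU2Star : Type := coordRing

instance : CommRing FunSU2Star := inferInstanceAs (CommRing coordRing)

instance : Algebra ℂ FunSU2Star := inferInstanceAs (Algebra ℂ coordRing)

/-- An element of `ℂ[SU₂⋆]` as a function on `SU₂⋆`. -/
def toFun : FunSU2Star →ₐ[ℂ] (SU2Star → ℂ) := coordRing.val

theorem toFun_injective : Function.Injective toFun := Subtype.val_injective

/-- The coordinates as elements of `ℂ[SU₂⋆]`. -/
def gen (i : Fin 5) : FunSU2Star := ⟨coord i, coord_mem i⟩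

@[simp] theorem toFun_gen (i : Fin 5) : toFun (gen i) = coord i := rfl

theorem entry_zero_one (g : SU2Star) : g.1 0 1 = 0 := g.2.1

theorem entry_zero_zero (g : SU2Star) : g.1 0 0 = ((g.1 0 0).re : ℂ) :=
  Complex.ext rfl (by simpa using g.2.2.1)

theorem entry_mul (g : SU2Star) : g.1 0 0 * g.1 1 1 = 1 := by
  have := g.1.det_coe
  rw [Matrix.det_fin_two, entry_zero_one] at this
  simpa using this

theorem mul_entry (g h : SU2Star) (i j : Fin 2) :
    (g * h).1 i j = g.1 i 0 * h.1 0 j + g.1 i 1 * h.1 1 j := by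
  change (g.1 * h.1) i j = _
  simp [Matrix.mul_apply, Fin.sum_univ_two]

theorem inv_entry (g : SU2Star) :
    (g⁻¹).1 0 0 = g.1 1 1 ∧ (g⁻¹).1 1 1 = g.1 0 0 ∧ (g⁻¹).1 1 0 = -g.1 1 0 := by
  have h : (g⁻¹).1 = (g.1)⁻¹ := rfl
  rw [h]
  simp [Matrix.SpecialLinearGroup.coe_inv, Matrix.adjugate_fin_two]

section Tensor

variable {X Y V W : Type*} [AddCommGroup V] [Module ℂ V] [AddCommGroup W] [Module ℂ W]

/-- For a space `V` of functions on `X` and a space `W` of functions on `Y`, elements of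
`V ⊗ W` seen as functions on `X × Y`. -/
def evalTensor (φ : V →ₗ[ℂ] (X → ℂ)) (ψ : W →ₗ[ℂ] (Y → ℂ)) :
    V ⊗[ℂ] W →ₗ[ℂ] (X × Y → ℂ) :=
  LinearMap.pi fun q => LinearMap.mul' ℂ ℂ ∘ₗ TensorProduct.map
    (LinearMap.proj q.1 ∘ₗ φ) (LinearMap.proj q.2 ∘ₗ ψ)

@[simp] theorem evalTensor_tmul (φ : V →ₗ[ℂ] (X → ℂ)) (ψ : W →ₗ[ℂ] (Y → ℂ)) (f : V) (u : W)
    (q : X × Y) : evalTensor φ ψ (f ⊗ₜ u) q = φ f q.1 * ψ u q.2 := rfl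

theorem evalTensor_injective (φ : V →ₗ[ℂ] (X → ℂ)) (ψ : W →ₗ[ℂ] (Y → ℂ))
    (hφ : Function.Injective φ) (hψ : Function.Injective ψ) :
    Function.Injective (evalTensor φ ψ) := by
  rw [injective_iff_map_eq_zero]
  intro t ht
  classical
  let b := Module.Basis.ofVectorSpace ℂ W
  let E := TensorProduct.equivFinsuppOfBasisRight (M := V) b
  have ht' : t = (E t).sum fun i m => m ⊗ₜ[ℂ] b i := by
    rw [← TensorProduct.equivFinsuppOfBasisRight_symm_apply]
    exact (E.symm_apply_apply t).symm
  have hz : ∀ x : X, ((E t).sum fun i m => φ m x • b i) = 0 := by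
    intro x
    apply hψ
    rw [map_zero]
    funext y
    have h := congrFun ht (x, y)
    rw [ht', Finsupp.sum, map_sum, Finset.sum_apply] at h
    simp only [evalTensor_tmul] at h
    simp only [Finsupp.sum, map_sum, map_smul, Finset.sum_apply, Pi.smul_apply, smul_eq_mul]
    exact h
  have hE : E t = 0 := by
    ext i
    by_cases hi : i ∈ (E t).support
    · apply hφ
      funext x
      have := linearIndependent_iff'.1 b.linearIndependent (E t).support (fun i => φ (E t i) x)
        (hz x) i hi
      simpa using this
    · simp [Finsupp.notMem_support_iff.1 hi]
  exact (LinearEquiv.map_eq_zero_iff E).1 hE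

end Tensor

/-- Elements of `ℂ[SU₂⋆] ⊗ ℂ[SU₂⋆]` as functions on `SU₂⋆ × SU₂⋆`. -/
def eval₂ : FunSU2Star ⊗[ℂ] FunSU2Star →ₐ[ℂ] (SU2Star × SU2Star → ℂ) :=
  Algebra.TensorProduct.lift
    (AlgHom.pi fun q : SU2Star × SU2Star =>
      (Pi.evalAlgHom ℂ (fun _ : SU2Star => ℂ) q.1).comp toFun)
    (AlgHom.pi fun q : SU2Star × SU2Star =>
      (Pi.evalAlgHom ℂ (fun _ : SU2Star => ℂ) q.2).comp toFun)
    fun _ _ => Commute.all _ _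

@[simp] theorem eval₂_tmul (f u : FunSU2Star) (q : SU2Star × SU2Star) :
    eval₂ (f ⊗ₜ u) q = toFun f q.1 * toFun u q.2 := by
  simp [eval₂]

theorem eval₂_injective : Function.Injective eval₂ := by
  have h : eval₂.toLinearMap = evalTensor toFun.toLinearMap toFun.toLinearMap := by
    apply TensorProduct.ext'
    intro f u
    funext q
    exact eval₂_tmul f u q
  have := evalTensor_injective toFun.toLinearMap toFun.toLinearMap toFun_injective toFun_injective
  rw [← h] at this
  exact this

/-- Elements of `ℂ[SU₂⋆] ⊗ ℂ[SU₂⋆] ⊗ ℂ[SU₂⋆]` as functions on `SU₂⋆ × SU₂⋆ × SU₂⋆`. -/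
def eval₃ : FunSU2Star ⊗[ℂ] (FunSU2Star ⊗[ℂ] FunSU2Star) →ₗ[ℂ]
    (SU2Star × SU2Star × SU2Star → ℂ) :=
  evalTensor toFun.toLinearMap eval₂.toLinearMap

@[simp] theorem eval₃_tmul (f : FunSU2Star) (u : FunSU2Star ⊗[ℂ] FunSU2Star)
    (q : SU2Star × SU2Star × SU2Star) : eval₃ (f ⊗ₜ u) q = toFun f q.1 * eval₂ u q.2 := rfl

theorem eval₃_injective : Function.Injective eval₃ :=
  evalTensor_injective _ _ toFun_injective eval₂_injective

/-- `f ↦ ((g, h) ↦ f (g h))`. -/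
def mulPullback : FunSU2Star →ₐ[ℂ] (SU2Star × SU2Star → ℂ) :=
  (AlgHom.pi fun q : SU2Star × SU2Star =>
    Pi.evalAlgHom ℂ (fun _ : SU2Star => ℂ) (q.1 * q.2)).comp toFun

/-- `f ↦ (g ↦ f g⁻¹)`. -/
def invPullback : FunSU2Star →ₐ[ℂ] (SU2Star → ℂ) :=
  (AlgHom.pi fun g : SU2Star => Pi.evalAlgHom ℂ (fun _ : SU2Star => ℂ) g⁻¹).comp toFun

theorem coordRing_induction {p : FunSU2Star → Prop} (hgen : ∀ i, p (gen i))
    (halg : ∀ c : ℂ, p (algebraMap ℂ FunSU2Star c)) (hadd : ∀ f g, p f → p g → p (f + g))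
    (hmul : ∀ f g, p f → p g → p (f * g)) (f : FunSU2Star) : p f := by
  obtain ⟨f, hf⟩ := f
  induction hf using Algebra.adjoin_induction with
  | mem x hx => obtain ⟨i, rfl⟩ := hx; exact hgen i
  | algebraMap c => exact halg c
  | add x y hx hy h₁ h₂ => exact hadd ⟨x, hx⟩ ⟨y, hy⟩ h₁ h₂
  | mul x y hx hy h₁ h₂ => exact hmul ⟨x, hx⟩ ⟨y, hy⟩ h₁ h₂

theorem mulPullback_mem (f : FunSU2Star) : mulPullback f ∈ eval₂.range := by
  induction f using coordRing_induction with
  | hgen i =>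
    fin_cases i
    · refine ⟨gen 0 ⊗ₜ gen 0, ?_⟩
      funext q
      simp [mulPullback, coord, Matrix.mul_apply, Fin.sum_univ_two, entry_zero_one]
    · refine ⟨gen 1 ⊗ₜ gen 1, ?_⟩
      funext q
      simp [mulPullback, coord, Matrix.mul_apply, Fin.sum_univ_two, entry_zero_one]
    · refine ⟨gen 2 ⊗ₜ gen 0 + gen 1 ⊗ₜ gen 2, ?_⟩
      funext q
      simp [mulPullback, coord, Matrix.mul_apply, Fin.sum_univ_two]
    · refine ⟨gen 3 ⊗ₜ gen 0 + gen 1 ⊗ₜ gen 3, ?_⟩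
      funext q
      have h₀ : conj (q.2.1 0 0) = q.2.1 0 0 := by
        rw [entry_zero_zero, Complex.conj_ofReal]
      have h₁ : conj (q.1.1 1 1) = q.1.1 1 1 := by
        rw [← inv_eq_of_mul_eq_one_right (entry_mul q.1), map_inv₀, entry_zero_zero,
          Complex.conj_ofReal]
      simp [mulPullback, coord, Matrix.mul_apply, Fin.sum_univ_two, h₀, h₁]
    · refine ⟨gen 4 ⊗ₜ 1 + 1 ⊗ₜ gen 4, ?_⟩
      funext q
      have h : ((q.1 * q.2).1 0 0).re = (q.1.1 0 0).re * (q.2.1 0 0).re := by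
        rw [mul_entry, entry_zero_one, zero_mul, add_zero, Complex.mul_re, q.1.2.2.1]
        ring
      have := Real.log_mul q.1.2.2.2.ne' q.2.2.2.2.ne'
      have h₂ : mulPullback (gen 4) q = (Real.log ((q.1 * q.2).1 0 0).re : ℂ) := rfl
      change _ = mulPullback (gen 4) q
      rw [h₂, h, this]
      simp [coord]
  | halg c => rw [AlgHom.commutes]; exact Subalgebra.algebraMap_mem _ c
  | hadd f g hf hg => rw [map_add]; exact add_mem hf hg
  | hmul f g hf hg => rw [map_mul]; exact mul_mem hf hg

theorem invPullback_mem (f : FunSU2Star) : invPullback f ∈ coordRing := by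
  induction f using coordRing_induction with
  | hgen i =>
    fin_cases i
    · convert coord_mem 1 using 1
      funext g
      simp [invPullback, coord, Matrix.adjugate_fin_two]
    · convert coord_mem 0 using 1
      funext g
      simp [invPullback, coord, Matrix.adjugate_fin_two]
    · convert neg_mem (coord_mem 2) using 1
      funext g
      simp [invPullback, coord, Matrix.adjugate_fin_two]
    · convert neg_mem (coord_mem 3) using 1
      funext g
      simp [invPullback, coord, Matrix.adjugate_fin_two]
    · convert neg_mem (coord_mem 4) using 1
      funext g
      have h : ((g⁻¹).1 0 0).re = ((g.1 0 0).re)⁻¹ := by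
        rw [(inv_entry g).1, ← inv_eq_of_mul_eq_one_right (entry_mul g), entry_zero_zero,
          ← Complex.ofReal_inv, Complex.ofReal_re, Complex.ofReal_re]
      have h₂ : invPullback (gen 4) g = (Real.log ((g⁻¹).1 0 0).re : ℂ) := rfl
      change invPullback (gen 4) g = -(Real.log (g.1 0 0).re : ℂ)
      rw [h₂, h, Real.log_inv, Complex.ofReal_neg]
  | halg c => rw [AlgHom.commutes]; exact Subalgebra.algebraMap_mem _ c
  | hadd f g hf hg => rw [map_add]; exact add_mem hf hg
  | hmul f g hf hg => rw [map_mul]; exact mul_mem hf hg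

/-- The coproduct of `ℂ[SU₂⋆]`: `Δ f` is the function `(g, h) ↦ f (g h)`. -/
def comulHom : FunSU2Star →ₐ[ℂ] FunSU2Star ⊗[ℂ] FunSU2Star :=
  (AlgEquiv.ofInjective eval₂ eval₂_injective).symm.toAlgHom.comp
    (mulPullback.codRestrict eval₂.range mulPullback_mem)

/-- The counit of `ℂ[SU₂⋆]`: evaluation at the identity. -/
def counitHom : FunSU2Star →ₐ[ℂ] ℂ :=
  (Pi.evalAlgHom ℂ (fun _ : SU2Star => ℂ) 1).comp toFun

/-- The antipode of `ℂ[SU₂⋆]`: `S f` is the function `g ↦ f g⁻¹`. -/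
def antipodeHom : FunSU2Star →ₐ[ℂ] FunSU2Star := invPullback.codRestrict coordRing invPullback_mem

theorem toFun_antipodeHom (f : FunSU2Star) (g : SU2Star) :
    toFun (antipodeHom f) g = toFun f g⁻¹ := rfl

theorem eval₂_comulHom (f : FunSU2Star) (g h : SU2Star) :
    eval₂ (comulHom f) (g, h) = toFun f (g * h) := by
  have : eval₂ (comulHom f) = mulPullback f :=
    congrArg Subtype.val ((AlgEquiv.ofInjective eval₂ eval₂_injective).apply_symm_apply
      ⟨mulPullback f, mulPullback_mem f⟩)
  rw [this]; rfl

instance instBialgebra : Bialgebra ℂ FunSU2Star :=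
  Bialgebra.ofAlgHom comulHom counitHom
    (by
      apply AlgHom.ext
      intro f
      apply eval₃_injective
      funext q
      obtain ⟨x, y, z⟩ := q
      have h₁ : ∀ T : FunSU2Star ⊗[ℂ] FunSU2Star,
          eval₃ (Algebra.TensorProduct.assoc ℂ ℂ ℂ FunSU2Star FunSU2Star FunSU2Star
            (Algebra.TensorProduct.map comulHom (.id ℂ FunSU2Star) T)) (x, y, z) =
          eval₂ T (x * y, z) := by
        intro T
        induction T with
        | zero => simp
        | add S T hS hT => simp only [map_add, Pi.add_apply, hS, hT]
        | tmul u v =>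
          have : ∀ W : FunSU2Star ⊗[ℂ] FunSU2Star,
              eval₃ (Algebra.TensorProduct.assoc ℂ ℂ ℂ FunSU2Star FunSU2Star FunSU2Star
                (W ⊗ₜ v)) (x, y, z) = eval₂ W (x, y) * toFun v z := by
            intro W
            induction W with
            | zero => simp
            | add S T hS hT => simp only [TensorProduct.add_tmul, map_add, Pi.add_apply, hS, hT,
                add_mul]
            | tmul a b => simp [mul_assoc]
          simp only [Algebra.TensorProduct.map_tmul, this, eval₂_comulHom, AlgHom.id_apply,
            eval₂_tmul]
      have h₂ : ∀ T : FunSU2Star ⊗[ℂ] FunSU2Star,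
          eval₃ (Algebra.TensorProduct.map (.id ℂ FunSU2Star) comulHom T) (x, y, z) =
          eval₂ T (x, y * z) := by
        intro T
        induction T with
        | zero => simp
        | add S T hS hT => simp only [map_add, Pi.add_apply, hS, hT]
        | tmul u v => simp only [Algebra.TensorProduct.map_tmul, eval₂_tmul, eval₃_tmul,
            eval₂_comulHom, AlgHom.id_apply]
      exact (h₁ _).trans (((eval₂_comulHom f _ _).trans (by rw [mul_assoc])).trans
        ((h₂ (comulHom f)).trans (eval₂_comulHom f _ _)).symm))
    (by
      apply AlgHom.ext
      intro f
      apply (Algebra.TensorProduct.lid ℂ FunSU2Star).injective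
      apply toFun_injective
      funext x
      have h : ∀ T : FunSU2Star ⊗[ℂ] FunSU2Star,
          toFun (Algebra.TensorProduct.lid ℂ FunSU2Star
            (Algebra.TensorProduct.map counitHom (.id ℂ FunSU2Star) T)) x = eval₂ T (1, x) := by
        intro T
        induction T with
        | zero => simp
        | add S T hS hT =>
          simp only [map_add, Pi.add_apply, hS, hT]
        | tmul u v => simp [counitHom]
      refine (h _).trans ((eval₂_comulHom f _ _).trans ?_)
      simp)
    (by
      apply AlgHom.ext
      intro f
      apply (Algebra.TensorProduct.rid ℂ ℂ FunSU2Star).injective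
      apply toFun_injective
      funext x
      have h : ∀ T : FunSU2Star ⊗[ℂ] FunSU2Star,
          toFun (Algebra.TensorProduct.rid ℂ ℂ FunSU2Star
            (Algebra.TensorProduct.map (.id ℂ FunSU2Star) counitHom T)) x = eval₂ T (x, 1) := by
        intro T
        induction T with
        | zero => simp
        | add S T hS hT =>
          simp only [map_add, Pi.add_apply, hS, hT]
        | tmul u v => simp [counitHom, mul_comm]
      refine (h _).trans ((eval₂_comulHom f _ _).trans ?_)
      simp)

instance instHopfAlgebra : HopfAlgebra ℂ FunSU2Star :=
  HopfAlgebra.ofAlgHom antipodeHom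
    (by
      apply AlgHom.ext
      intro f
      apply toFun_injective
      funext x
      have h : ∀ T : FunSU2Star ⊗[ℂ] FunSU2Star,
          toFun (Algebra.TensorProduct.lift antipodeHom (.id ℂ FunSU2Star)
            (fun _ _ => Commute.all _ _) T) x = eval₂ T (x⁻¹, x) := by
        intro T
        induction T with
        | zero => simp
        | add S T hS hT => simp only [map_add, Pi.add_apply, hS, hT]
        | tmul u v =>
          rw [Algebra.TensorProduct.lift_tmul, map_mul, Pi.mul_apply, eval₂_tmul]; rfl
      refine (h _).trans ((eval₂_comulHom f _ _).trans ?_)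
      rw [inv_mul_cancel]; rfl)
    (by
      apply AlgHom.ext
      intro f
      apply toFun_injective
      funext x
      have h : ∀ T : FunSU2Star ⊗[ℂ] FunSU2Star,
          toFun (Algebra.TensorProduct.lift (.id ℂ FunSU2Star) antipodeHom
            (fun _ _ => Commute.all _ _) T) x = eval₂ T (x, x⁻¹) := by
        intro T
        induction T with
        | zero => simp
        | add S T hS hT => simp only [map_add, Pi.add_apply, hS, hT]
        | tmul u v =>
          rw [Algebra.TensorProduct.lift_tmul, map_mul, Pi.mul_apply, eval₂_tmul]; rfl
      refine (h _).trans ((eval₂_comulHom f _ _).trans ?_)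
      rw [mul_inv_cancel]; rfl)

/-! ### The Lie algebras `sl₂`, `su₂`, `su₂⋆` and their complexified enveloping algebras -/

/-- `sl₂(ℂ)` as a real Lie algebra. -/
def sl2 : LieSubalgebra ℝ (Matrix (Fin 2) (Fin 2) ℂ) where
  carrier := {M | M.trace = 0}
  add_mem' := by
    intro M N hM hN
    simp only [Set.mem_ofPred_eq] at *
    rw [Matrix.trace_add, hM, hN, add_zero]
  zero_mem' := Matrix.trace_zero _ _
  smul_mem' := by
    intro c M hM
    simp only [Set.mem_ofPred_eq] at *
    rw [Matrix.trace_smul, hM, smul_zero]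
  lie_mem' := by
    intro M N _ _
    simp [LieRing.of_associative_ring_bracket, Matrix.trace_mul_comm M N]

/-- The Lie algebra `su₂` of the traceless anti-Hermitian matrices. -/
def su2 : LieSubalgebra ℝ (Matrix (Fin 2) (Fin 2) ℂ) where
  carrier := {M | M.trace = 0 ∧ Mᴴ = -M}
  add_mem' := by
    rintro M N ⟨hM, hM'⟩ ⟨hN, hN'⟩
    refine ⟨by rw [Matrix.trace_add, hM, hN, add_zero], ?_⟩
    rw [Matrix.conjTranspose_add, hM', hN', neg_add]
  zero_mem' := ⟨Matrix.trace_zero _ _, by simp⟩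
  smul_mem' := by
    rintro c M ⟨hM, hM'⟩
    refine ⟨by rw [Matrix.trace_smul, hM, smul_zero], ?_⟩
    rw [Matrix.conjTranspose_smul, hM', smul_neg, star_trivial]
  lie_mem' := by
    rintro M N ⟨hM, hM'⟩ ⟨hN, hN'⟩
    refine ⟨by simp [LieRing.of_associative_ring_bracket, Matrix.trace_mul_comm M N], ?_⟩
    simp [LieRing.of_associative_ring_bracket, Matrix.conjTranspose_sub, hM', hN']

/-- The Lie algebra `su₂⋆` of the group `SU₂⋆`: the matrices `!![s, 0; n, -s]`, `s ∈ ℝ`,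
`n ∈ ℂ`. -/
def su2Star : LieSubalgebra ℝ (Matrix (Fin 2) (Fin 2) ℂ) where
  carrier := {M | M.trace = 0 ∧ M 0 1 = 0 ∧ (M 0 0).im = 0}
  add_mem' := by
    rintro M N ⟨hM, hM₁, hM₂⟩ ⟨hN, hN₁, hN₂⟩
    exact ⟨by rw [Matrix.trace_add, hM, hN, add_zero], by simp [hM₁, hN₁], by simp [hM₂, hN₂]⟩
  zero_mem' := ⟨Matrix.trace_zero _ _, by simp, by simp⟩
  smul_mem' := by
    rintro c M ⟨hM, hM₁, hM₂⟩
    exact ⟨by rw [Matrix.trace_smul, hM, smul_zero], by simp [hM₁], by simp [hM₂]⟩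
  lie_mem' := by
    rintro M N ⟨hM, hM₁, hM₂⟩ ⟨hN, hN₁, hN₂⟩
    refine ⟨by simp [LieRing.of_associative_ring_bracket, Matrix.trace_mul_comm M N], ?_, ?_⟩ <;>
      simp [LieRing.of_associative_ring_bracket, Matrix.mul_apply, Fin.sum_univ_two, hM₁, hN₁,
        hM₂, hN₂]

theorem su2_le : su2 ≤ sl2 := fun _ h => h.1

theorem su2Star_le : su2Star ≤ sl2 := fun _ h => h.1

/-- The complexification of a map of real Lie algebras. -/
def complexify {L L' : Type*} [LieRing L] [LieAlgebra ℝ L] [LieRing L'] [LieAlgebra ℝ L']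
    (f : L →ₗ⁅ℝ⁆ L') : ℂ ⊗[ℝ] L →ₗ⁅ℂ⁆ ℂ ⊗[ℝ] L' :=
  { (f : L →ₗ[ℝ] L').baseChange ℂ with
    map_lie' := fun {x y} => by
      change (f : L →ₗ[ℝ] L').baseChange ℂ ⁅x, y⁆ =
        ⁅(f : L →ₗ[ℝ] L').baseChange ℂ x, (f : L →ₗ[ℝ] L').baseChange ℂ y⁆
      induction x with
      | zero => simp
      | add x₁ x₂ h₁ h₂ => simp only [add_lie, map_add, h₁, h₂]
      | tmul c l =>
        induction y with
        | zero =>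
          refine (congrArg _ (lie_zero (c ⊗ₜ[ℝ] l))).trans ?_
          rw [LinearMap.map_zero]
          exact (lie_zero _).symm
        | add y₁ y₂ h₁ h₂ =>
          refine (congrArg _ (lie_add (c ⊗ₜ[ℝ] l) y₁ y₂)).trans ?_
          rw [LinearMap.map_add, LinearMap.map_add]
          exact (congrArg₂ (· + ·) h₁ h₂).trans (lie_add _ _ _).symm
        | tmul d m => simp }

/-- The enveloping algebra over `ℂ` of (the complexification of) a real Lie algebra. -/
abbrev Env (L : Type*) [LieRing L] [LieAlgebra ℝ L] : Type _ :=
  UniversalEnvelopingAlgebra ℂ (ℂ ⊗[ℝ] L)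

/-- The element `c X` of the enveloping algebra, for `c ∈ ℂ` and `X` in the real Lie algebra. -/
def toEnv {L : Type*} [LieRing L] [LieAlgebra ℝ L] (c : ℂ) (X : L) : Env L :=
  UniversalEnvelopingAlgebra.ι ℂ (c ⊗ₜ[ℝ] X)

/-- The inclusion `U(su₂⋆) → U(sl₂)`. -/
def inclSU2Star : Env su2Star →ₐc[ℂ] Env sl2 :=
  UEA.map (complexify (LieSubalgebra.inclusion su2Star_le))

/-- The inclusion `U(su₂) → U(sl₂)`. -/
def inclSU2 : Env su2 →ₐc[ℂ] Env sl2 :=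
  UEA.map (complexify (LieSubalgebra.inclusion su2_le))

/-! ### The generators `J_a`, `x_a`, `P_a` (the index `a = 1, 2, 3` is `0, 1, 2 : Fin 3`) -/

/-- The totally antisymmetric symbol `ε_{abc}`. -/
def eps (a b c : Fin 3) : ℂ :=
  (((a : ℕ) : ℂ) - (b : ℕ)) * (((b : ℕ) : ℂ) - (c : ℕ)) * (((c : ℕ) : ℂ) - (a : ℕ)) / 2

/-- The anti-Hermitian basis `-(i/2) σ_a` of `su₂`. -/
def rotBasis : Fin 3 → su2 :=
  ![⟨!![0, -(Complex.I / 2); -(Complex.I / 2), 0], by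
      refine ⟨by simp [Matrix.trace_fin_two], ?_⟩
      ext i j; fin_cases i <;> fin_cases j <;> simp [neg_div]⟩,
    ⟨!![0, -(1 / 2); 1 / 2, 0], by
      refine ⟨by simp [Matrix.trace_fin_two], ?_⟩
      ext i j; fin_cases i <;> fin_cases j <;> simp⟩,
    ⟨!![-(Complex.I / 2), 0; 0, Complex.I / 2], by
      refine ⟨by simp [Matrix.trace_fin_two], ?_⟩
      ext i j; fin_cases i <;> fin_cases j <;> simp [neg_div]⟩]

/-- The basis `λ e₂₁`, `i λ e₂₁`, `(λ/2) σ₃` of `su₂⋆`. -/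
def transBasis (lam : ℝ) : Fin 3 → su2Star :=
  ![⟨!![0, 0; (lam : ℂ), 0], by
      refine ⟨by simp [Matrix.trace_fin_two], by simp, by simp⟩⟩,
    ⟨!![0, 0; Complex.I * lam, 0], by
      refine ⟨by simp [Matrix.trace_fin_two], by simp, by simp⟩⟩,
    ⟨!![((lam / 2 : ℝ) : ℂ), 0; 0, -((lam / 2 : ℝ) : ℂ)], by
      refine ⟨by simp [Matrix.trace_fin_two], by simp, ?_⟩
      exact Complex.ofReal_im _⟩]

/-- The rotation generators `J_a ∈ U(su₂)`, Hermitian: `J_a = i` times the basis of `su₂`. -/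
def J (a : Fin 3) : Env su2 := toEnv Complex.I (rotBasis a)

/-- The noncommutative position coordinates `x_a ∈ U(su₂⋆)`, `i` times the basis of `su₂⋆`. -/
def x (lam : ℝ) (a : Fin 3) : Env su2Star := toEnv Complex.I (transBasis lam a)

/-- The momentum coordinates on `SU₂⋆`: `z w⁻¹ = λ (P₁ + i P₂)` and `w = exp (λ P₃ / 2)`. -/
def momentum (lam : ℝ) : Fin 3 → SU2Star → ℝ :=
  ![fun g => ((g.1 1 0) * (g.1 1 1)).re / lam, fun g => ((g.1 1 0) * (g.1 1 1)).im / lam,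
    fun g => 2 / lam * Real.log (g.1 0 0).re]

theorem entry_one_one (g : SU2Star) : conj (g.1 1 1) = g.1 1 1 := by
  rw [← inv_eq_of_mul_eq_one_right (entry_mul g), map_inv₀, entry_zero_zero, Complex.conj_ofReal]

theorem momentum_mem (lam : ℝ) (a : Fin 3) :
    (fun g => (momentum lam a g : ℂ)) ∈ coordRing := by
  fin_cases a
  · have h : ((lam : ℂ)⁻¹ * 2⁻¹) • ((coord 2 + coord 3) * coord 1) ∈ coordRing :=
      coordRing.smul_mem (mul_mem (add_mem (coord_mem 2) (coord_mem 3)) (coord_mem 1)) _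
    convert h using 1
    funext g
    have : ((g.1 1 0 * g.1 1 1).re : ℂ) = (g.1 1 0 + conj (g.1 1 0)) * g.1 1 1 / 2 := by
      rw [Complex.re_eq_add_conj, map_mul, entry_one_one]; ring
    simp only [momentum, coord, Pi.smul_apply, Pi.mul_apply, Pi.add_apply, smul_eq_mul]
    change (((g.1 1 0 * g.1 1 1).re / lam : ℝ) : ℂ) =
      (lam : ℂ)⁻¹ * 2⁻¹ * ((g.1 1 0 + conj (g.1 1 0)) * g.1 1 1)
    rw [Complex.ofReal_div, this]; ring
  · have h : ((lam : ℂ)⁻¹ * (2 * Complex.I)⁻¹) • ((coord 2 - coord 3) * coord 1) ∈ coordRing :=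
      coordRing.smul_mem (mul_mem (sub_mem (coord_mem 2) (coord_mem 3)) (coord_mem 1)) _
    convert h using 1
    funext g
    have : ((g.1 1 0 * g.1 1 1).im : ℂ) =
        (g.1 1 0 - conj (g.1 1 0)) * g.1 1 1 / (2 * Complex.I) := by
      rw [Complex.im_eq_sub_conj, map_mul, entry_one_one]; ring
    simp only [momentum, coord, Pi.smul_apply, Pi.mul_apply, Pi.sub_apply, smul_eq_mul]
    change (((g.1 1 0 * g.1 1 1).im / lam : ℝ) : ℂ) =
      (lam : ℂ)⁻¹ * (2 * Complex.I)⁻¹ * ((g.1 1 0 - conj (g.1 1 0)) * g.1 1 1)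
    rw [Complex.ofReal_div, this]; ring
  · have h : ((2 / lam : ℝ) : ℂ) • coord 4 ∈ coordRing := coordRing.smul_mem (coord_mem 4) _
    convert h using 1
    funext g
    exact Complex.ofReal_mul _ _

/-- The momentum generators `P_a ∈ ℂ[SU₂⋆]`. -/
def P (lam : ℝ) (a : Fin 3) : FunSU2Star := ⟨fun g => (momentum lam a g : ℂ), momentum_mem lam a⟩

theorem expMomentum_mem (lam : ℝ) (hl : lam ≠ 0) :
    (fun g => (Real.exp (-lam * momentum lam 2 g) : ℂ)) ∈ coordRing := by
  convert mul_mem (coord_mem 1) (coord_mem 1) using 1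
  funext g
  have h₁ : -lam * momentum lam 2 g =
      Real.log ((g.1 0 0).re)⁻¹ + Real.log ((g.1 0 0).re)⁻¹ := by
    have : momentum lam 2 g = 2 / lam * Real.log (g.1 0 0).re := rfl
    rw [this, Real.log_inv]; field_simp; ring
  have h₂ : g.1 1 1 = (((g.1 0 0).re)⁻¹ : ℝ) := by
    rw [Complex.ofReal_inv, ← entry_zero_zero]
    exact (inv_eq_of_mul_eq_one_right (entry_mul g)).symm
  rw [h₁, Real.exp_add, Real.exp_log (inv_pos.2 g.2.2.2)]
  change _ = g.1 1 1 * g.1 1 1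
  rw [h₂, Complex.ofReal_mul]

/-- The element `exp (-λ P₃) ∈ ℂ[SU₂⋆]`. -/
def expP (lam : ℝ) (hl : lam ≠ 0) : FunSU2Star :=
  ⟨fun g => (Real.exp (-lam * momentum lam 2 g) : ℂ), expMomentum_mem lam hl⟩

/-- Normal ordering `f ↦ :f(x):` of an ordinary polynomial, with `x₃` to the right:
the monomial `x₁^l x₂^m x₃^n` goes to the product `x₁^l x₂^m x₃^n` in `U(su₂⋆)`. -/
def normalOrder (lam : ℝ) : MvPolynomial (Fin 3) ℂ →ₗ[ℂ] Env su2Star :=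
  (MvPolynomial.basisMonomials (Fin 3) ℂ).constr ℂ
    fun n => x lam 0 ^ n 0 * x lam 1 ^ n 1 * x lam 2 ^ n 2

/-! ### Smooth curves -/

/-- The curve `γ` of matrices is differentiable at time `0`, entry by entry, with derivative `M`. -/
def HasVelocity (γ : ℝ → SpecialLinearGroup (Fin 2) ℂ) (M : Matrix (Fin 2) (Fin 2) ℂ) : Prop :=
  ∀ i j, HasDerivAt (fun t => γ t i j) (M i j) 0

/-- The pairing of `ℂ[SU₂⋆]` with `U(su₂⋆)` is the canonical one: `⟨φ, X⟩` is the derivative of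
`φ` at the identity in the direction of `X ∈ su₂⋆`. -/
def IsDerivativePairing (p : FunSU2Star →ₗ[ℂ] Env su2Star →ₗ[ℂ] ℂ) : Prop :=
  ∀ (φ : FunSU2Star) (X : su2Star) (γ : ℝ → SU2Star), γ 0 = 1 →
    HasVelocity (fun t => (γ t).1) X.1 →
    HasDerivAt (fun t => toFun φ (γ t)) (p φ (toEnv 1 X)) 0

/-- The right action `r` of `U(su₂)` on `ℂ[SU₂⋆]` is by the vector fields of the nonlinear action
of the group `SU₂` on the manifold `SU₂⋆`, in which `u ∈ SU₂` takes `g ∈ SU₂⋆` to the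
`SU₂⋆`-factor of `u g`. -/
def IsDressingAction (r : FunSU2Star →ₗ[ℂ] Env su2 →ₗ[ℂ] FunSU2Star) : Prop :=
  ∀ (φ : FunSU2Star) (Y : su2) (g : SU2Star) (u : ℝ → SU2), u 0 = 1 →
    HasVelocity (fun t => (u t).1) Y.1 →
    HasDerivAt (fun t => toFun φ (solvablePart ((u t).1 * g.1))) (toFun (r φ (toEnv 1 Y)) g) 0

end Iwasawa
end

/-! The Iwasawa factorisation identifies `SU₂⋆` with the quotient `SL₂(ℂ)/SU₂`, so `SL₂(ℂ)` acts on
the manifold `SU₂⋆`, and everything is extracted from this one action. Differentiating it gives a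
vector field `dressing M` for each `M` in `sl₂`: left translation when `M` lies in `su₂⋆`, the
nonlinear dressing field when `M` lies in `su₂`. The fields have coefficients in the coordinate ring
and `dressing_lie` makes `ℂ[SU₂⋆]` a right module over `U(sl₂)`. The second datum is `rotElt M`, the
`su₂`-part of `g⁻¹ M g` as a function of `g`; its cocycle identity `rotElt_lie` says how it fits
with the fields.

The pairing is `⟨φ, h⟩ = ε(φ · h)`. It separates functions because every group element lies on a
one-parameter subgroup along which functions are real analytic (`pairing_separatingLeft`). It
separates `U(su₂⋆)` because the dual action of `P_a` on normally ordered polynomials is `i ∂_a`,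
which recovers every coefficient (`eq_zero_of_pairing_normalOrder`); the same argument shows that
normal ordering is injective, without appeal to the Poincaré–Birkhoff–Witt theorem.

For the factorisation of `U(sl₂)`, the operators `v ↦ dressing M v + v * rotElt M` on `ℂ[SU₂⋆] ⊗
U(su₂)` form a module induced from `SU₂`. Acting on `φ ⊗ 1` by `h a` and evaluating at the identity
gives `⟨φ, h⟩ a` (`evalOne_twisted_tmul`), so non-degeneracy of the pairing makes multiplication
`U(su₂⋆) ⊗ U(su₂) → U(sl₂)` injective; surjectivity is a straightening argument. The matched pair is
then formal, and the same evaluation identifies the dual action with the dressing fields and the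
coaction with `a ↦ 1 · a`.

The bicrossproduct is built as a smash product, whose universal property reduces its coproduct,
counit and antipode to generators: `Y` in `su₂` has coproduct `Y ⊗ 1` plus `rotElt Y`, and functions
keep theirs. What has to be checked is the interaction of the fields and of `rotCoeff` with the
group law and the inverse: `comulHom_dressing`, `comulHom_rotCoeff`, `antipodeHom_dressing`. The
explicit relations and coproducts are the values of the fields on `P_a` and of `rotCoeff` on the
basis of `su₂`. -/

noncomputable section

namespace Iwasawa

/-! ### Maps out of complexified enveloping algebras -/

section Env

variable {L : Type*} [LieRing L] [LieAlgebra ℝ L]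

theorem toEnv_eq_smul (c : ℂ) (X : L) : toEnv c X = c • toEnv 1 X := by
  rw [toEnv, toEnv, ← map_smul, TensorProduct.smul_tmul', smul_eq_mul, mul_one]

theorem toEnv_add (c : ℂ) (X Y : L) : toEnv c (X + Y) = toEnv c X + toEnv c Y := by
  rw [toEnv, TensorProduct.tmul_add, map_add]; rfl

theorem toEnv_smul (r : ℝ) (c : ℂ) (X : L) : toEnv c (r • X) = (r : ℂ) • toEnv c X := by
  rw [toEnv, toEnv, ← map_smul, TensorProduct.smul_tmul', ← TensorProduct.smul_tmul]; rfl

theorem toEnv_lie (X Y : L) :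
    toEnv 1 ⁅X, Y⁆ = toEnv 1 X * toEnv 1 Y - toEnv 1 Y * toEnv 1 X := by
  have h : ((1 : ℂ) ⊗ₜ[ℝ] ⁅X, Y⁆ : ℂ ⊗[ℝ] L) = ⁅(1 : ℂ) ⊗ₜ[ℝ] X, (1 : ℂ) ⊗ₜ[ℝ] Y⁆ := by
    rw [LieAlgebra.ExtendScalars.bracket_tmul, mul_one]
  simp only [toEnv]
  rw [h, LieHom.map_lie, LieRing.of_associative_ring_bracket]

/-- A real-linear map `f` from a real Lie algebra to a complex algebra which takes brackets to
commutators extends to the complexified enveloping algebra. -/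
def envLift {C : Type*} [Ring C] [Algebra ℂ C] (f : L → C) (hadd : ∀ X Y, f (X + Y) = f X + f Y)
    (hsmul : ∀ (r : ℝ) X, f (r • X) = (r : ℂ) • f X)
    (hlie : ∀ X Y, f ⁅X, Y⁆ = f X * f Y - f Y * f X) : Env L →ₐ[ℂ] C :=
  UniversalEnvelopingAlgebra.lift ℂ
    { LinearMap.liftBaseChange ℂ
        ({ toFun := f, map_add' := hadd, map_smul' := hsmul } : L →ₗ[ℝ] C) with
      map_lie' := fun {s t} => by
        simp only [AddHom.toFun_eq_coe, LinearMap.coe_toAddHom,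
          LieRing.of_associative_ring_bracket]
        induction s with
        | zero => simp
        | add s₁ s₂ h₁ h₂ => simp only [add_lie, map_add, h₁, h₂, add_mul, mul_add]; abel
        | tmul c X =>
          induction t with
          | zero => simp
          | add t₁ t₂ h₁ h₂ => simp only [lie_add, map_add, h₁, h₂, add_mul, mul_add]; abel
          | tmul d Y =>
            rw [LieAlgebra.ExtendScalars.bracket_tmul]
            simp only [LinearMap.liftBaseChange_tmul, LinearMap.coe_mk, AddHom.coe_mk, hlie]
            simp only [smul_sub, smul_mul_smul_comm, mul_comm d c] }

theorem envLift_toEnv {C : Type*} [Ring C] [Algebra ℂ C] (f : L → C) (hadd hsmul hlie)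
    (c : ℂ) (X : L) : envLift f hadd hsmul hlie (toEnv c X) = c • f X := by
  rw [envLift, toEnv, UniversalEnvelopingAlgebra.lift_ι_apply]
  exact LinearMap.liftBaseChange_tmul _ _ _ _

@[simp] theorem envLift_toEnv_one {C : Type*} [Ring C] [Algebra ℂ C] (f : L → C)
    (hadd hsmul hlie) (X : L) : envLift f hadd hsmul hlie (toEnv 1 X) = f X := by
  rw [envLift_toEnv, one_smul]

/-- A subspace containing every `ι t` contains it as soon as it contains the `toEnv 1 X`. -/
theorem iota_mem_of_toEnv_mem {N : Submodule ℂ (Env L)} (h : ∀ X : L, toEnv 1 X ∈ N)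
    (t : ℂ ⊗[ℝ] L) : UniversalEnvelopingAlgebra.ι ℂ t ∈ N := by
  induction t with
  | zero => rw [map_zero]; exact N.zero_mem
  | add s t hs ht => rw [map_add]; exact N.add_mem hs ht
  | tmul c X =>
    change toEnv c X ∈ N
    rw [toEnv_eq_smul]
    exact N.smul_mem c (h X)

theorem adjoin_toEnv : Algebra.adjoin ℂ (Set.range (toEnv 1 : L → Env L)) = ⊤ := by
  rw [eq_top_iff, ← UEA.adjoin_ι, Algebra.adjoin_le_iff]
  rintro _ ⟨t, rfl⟩
  exact iota_mem_of_toEnv_mem (N := Subalgebra.toSubmodule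
    (Algebra.adjoin ℂ (Set.range (toEnv 1 : L → Env L))))
    (fun X => Algebra.subset_adjoin ⟨X, rfl⟩) t

/-- Suited to right modules, where a product acts by its leftmost factor first and the last Lie
algebra element can be split off. The left version below serves when factors must be peeled off in
the other order. -/
theorem env_induction_right {p : Env L → Prop} (one : p 1)
    (add : ∀ u v, p u → p v → p (u + v)) (smul : ∀ (c : ℂ) u, p u → p (c • u))
    (mul : ∀ u (X : L), p u → p (u * toEnv 1 X)) (u : Env L) : p u := by
  -- The arbitrary prefix `n` is what makes the product case of the adjoin induction go through.
  have key : ∀ u : Env L, u ∈ Algebra.adjoin ℂ (Set.range (toEnv 1 : L → Env L)) →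
      ∀ n, p n → p (n * u) := by
    intro u hu
    induction hu using Algebra.adjoin_induction with
    | mem x hx => obtain ⟨X, rfl⟩ := hx; exact fun n hn => mul n X hn
    | algebraMap c =>
      intro n hn
      rw [← Algebra.commutes, ← Algebra.smul_def]
      exact smul c n hn
    | add x y _ _ hx hy => intro n hn; rw [mul_add]; exact add _ _ (hx n hn) (hy n hn)
    | mul x y _ _ hx hy => intro n hn; rw [← mul_assoc]; exact hy _ (hx n hn)
  rw [← one_mul u]
  exact key u (by rw [adjoin_toEnv]; trivial) 1 one

theorem env_induction_left {p : Env L → Prop} (one : p 1)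
    (add : ∀ u v, p u → p v → p (u + v)) (smul : ∀ (c : ℂ) u, p u → p (c • u))
    (mul : ∀ u (X : L), p u → p (toEnv 1 X * u)) (u : Env L) : p u := by
  have key : ∀ u : Env L, u ∈ Algebra.adjoin ℂ (Set.range (toEnv 1 : L → Env L)) →
      ∀ n, p n → p (u * n) := by
    intro u hu
    induction hu using Algebra.adjoin_induction with
    | mem x hx => obtain ⟨X, rfl⟩ := hx; exact fun n hn => mul n X hn
    | algebraMap c => intro n hn; rw [← Algebra.smul_def]; exact smul c n hn
    | add x y _ _ hx hy => intro n hn; rw [add_mul]; exact add _ _ (hx n hn) (hy n hn)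
    | mul x y _ _ hx hy => intro n hn; rw [mul_assoc]; exact hx _ (hy n hn)
  rw [← mul_one u]
  exact key u (by rw [adjoin_toEnv]; trivial) 1 one

theorem env_hom_ext {C : Type*} [Ring C] [Algebra ℂ C] {f g : Env L →ₐ[ℂ] C}
    (h : ∀ X : L, f (toEnv 1 X) = g (toEnv 1 X)) : f = g := by
  apply AlgHom.ext
  intro u
  induction u using env_induction_right with
  | one => rw [map_one, map_one]
  | add u v hu hv => rw [map_add, map_add, hu, hv]
  | smul c u hu => rw [map_smul, map_smul, hu]
  | mul u X hu => rw [map_mul, map_mul, hu, h]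

theorem comul_toEnv (c : ℂ) (X : L) : Coalgebra.comul (R := ℂ) (toEnv c X) =
    toEnv c X ⊗ₜ[ℂ] 1 + 1 ⊗ₜ[ℂ] toEnv c X := UEA.comulHom_ι _

@[simp] theorem counit_toEnv (c : ℂ) (X : L) : Coalgebra.counit (R := ℂ) (toEnv c X) = 0 :=
  UEA.counitHom_ι _

theorem map_complexify_toEnv {L' : Type*} [LieRing L'] [LieAlgebra ℝ L'] (f : L →ₗ⁅ℝ⁆ L')
    (c : ℂ) (X : L) : UEA.map (complexify f) (toEnv c X) = toEnv c (f X) := by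
  exact (UniversalEnvelopingAlgebra.lift_ι_apply ℂ
    ((UniversalEnvelopingAlgebra.ι ℂ).comp (complexify f)) (c ⊗ₜ X)).trans rfl

/-- Operators `f X` with `f [X, Y] = f Y ∘ f X - f X ∘ f Y` make `V` a right module over the
enveloping algebra. -/
def envRightModule {V : Type*} [AddCommGroup V] [Module ℂ V] (f : L → Module.End ℂ V)
    (hadd : ∀ X Y, f (X + Y) = f X + f Y) (hsmul : ∀ (r : ℝ) X, f (r • X) = (r : ℂ) • f X)
    (hlie : ∀ X Y, f ⁅X, Y⁆ = f Y * f X - f X * f Y) : V →ₗ[ℂ] Env L →ₗ[ℂ] V :=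
  LinearMap.flip ((MulOpposite.opLinearEquiv ℂ).symm.toLinearMap ∘ₗ
    (envLift (C := (Module.End ℂ V)ᵐᵒᵖ) (fun X => MulOpposite.op (f X))
      (fun X Y => by rw [hadd, MulOpposite.op_add])
      (fun r X => by rw [hsmul, MulOpposite.op_smul])
      (fun X Y => by rw [hlie, MulOpposite.op_sub, MulOpposite.op_mul, MulOpposite.op_mul])).toLinearMap)

section

variable {V : Type*} [AddCommGroup V] [Module ℂ V] (f : L → Module.End ℂ V) (hadd hsmul hlie)

@[simp] theorem envRightModule_one (v : V) : envRightModule f hadd hsmul hlie v 1 = v := by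
  simp [envRightModule]

theorem envRightModule_mul (v : V) (a b : Env L) :
    envRightModule f hadd hsmul hlie v (a * b) =
      envRightModule f hadd hsmul hlie (envRightModule f hadd hsmul hlie v a) b := by
  simp [envRightModule]

@[simp] theorem envRightModule_toEnv (v : V) (X : L) :
    envRightModule f hadd hsmul hlie v (toEnv 1 X) = f X v := by
  simp [envRightModule]

end

end Env

end Iwasawa


/-! ### Matched pairs from factorisations of Hopf algebras. -/

namespace Semidual

variable {k : Type*} [CommRing k] {H₁ H₂ H : Type*}
  [Ring H₁] [HopfAlgebra k H₁] [Ring H₂] [HopfAlgebra k H₂] [Ring H] [HopfAlgebra k H]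
  {i₁ : H₁ →ₐc[k] H} {i₂ : H₂ →ₐc[k] H}

@[simp] theorem mulMap_tmul (h : H₁) (a : H₂) : mulMap i₁ i₂ (h ⊗ₜ a) = i₁ h * i₂ a := rfl

/-- The projection `h a ↦ ε(a) h` of a factorisation on its first factor. -/
def proj₁ (hF : IsFactorisation i₁ i₂) : H →ₗ[k] H₁ :=
  (TensorProduct.rid k H₁).toLinearMap ∘ₗ LinearMap.lTensor H₁ (Coalgebra.counit (R := k)) ∘ₗ
    (factorEquiv hF).symm.toLinearMap

/-- The projection `h a ↦ ε(h) a` of a factorisation on its second factor. -/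
def proj₂ (hF : IsFactorisation i₁ i₂) : H →ₗ[k] H₂ :=
  (TensorProduct.lid k H₂).toLinearMap ∘ₗ LinearMap.rTensor H₂ (Coalgebra.counit (R := k)) ∘ₗ
    (factorEquiv hF).symm.toLinearMap

variable (hF : IsFactorisation i₁ i₂)

theorem factorEquiv_symm_mul (h : H₁) (a : H₂) :
    (factorEquiv hF).symm (i₁ h * i₂ a) = h ⊗ₜ a := by
  rw [LinearEquiv.symm_apply_eq]; rfl

@[simp] theorem proj₁_mul (h : H₁) (a : H₂) :
    proj₁ hF (i₁ h * i₂ a) = Coalgebra.counit (R := k) a • h := by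
  simp [proj₁, factorEquiv_symm_mul]

@[simp] theorem proj₂_mul (h : H₁) (a : H₂) :
    proj₂ hF (i₁ h * i₂ a) = Coalgebra.counit (R := k) h • a := by
  simp [proj₂, factorEquiv_symm_mul]

theorem lact_eq (a : H₂) (h : H₁) : lact hF a h = proj₁ hF (i₂ a * i₁ h) := rfl

theorem ract_eq (a : H₂) (h : H₁) : ract hF a h = proj₂ hF (i₂ a * i₁ h) := rfl

theorem factor_induction {p : H → Prop} (hF : IsFactorisation i₁ i₂)
    (mul : ∀ h a, p (i₁ h * i₂ a)) (add : ∀ x y, p x → p y → p (x + y)) (x : H) : p x := by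
  obtain ⟨T, rfl⟩ := hF.2.2.2 x
  induction T with
  | zero => simpa using mul 0 0
  | add S T hS hT => rw [map_add]; exact add _ _ hS hT
  | tmul h a => exact mul h a

/-- Since `i₁` and `i₂` preserve coproducts, multiplication is a coalgebra map from `H₁ ⊗ H₂`. There
a tensor is recovered from its coproduct by killing the `H₂`-factor of the first leg and the
`H₁`-factor of the second with counits. Applied to `i₂ a * i₁ h` this is the matched pair formula.
-/
theorem factorEquiv_symm_eq (x : H) : (factorEquiv hF).symm x =
    TensorProduct.map (proj₁ hF) (proj₂ hF) (Coalgebra.comul (R := k) x) := by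
  induction x using factor_induction hF with
  | add x y hx hy => rw [map_add, map_add, map_add, hx, hy]
  | mul h a =>
    have h₁ : Coalgebra.comul (R := k) (i₁ h) =
        TensorProduct.map (i₁ : H₁ →ₗ[k] H) (i₁ : H₁ →ₗ[k] H) (Coalgebra.comul (R := k) h) :=
      (CoalgHomClass.map_comp_comul_apply i₁ h).symm
    have h₂ : Coalgebra.comul (R := k) (i₂ a) =
        TensorProduct.map (i₂ : H₂ →ₗ[k] H) (i₂ : H₂ →ₗ[k] H) (Coalgebra.comul (R := k) a) :=
      (CoalgHomClass.map_comp_comul_apply i₂ a).symm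
    have key : ∀ (T : H₁ ⊗[k] H₁) (S : H₂ ⊗[k] H₂),
        TensorProduct.map (proj₁ hF) (proj₂ hF)
          (TensorProduct.map (i₁ : H₁ →ₗ[k] H) (i₁ : H₁ →ₗ[k] H) T *
            TensorProduct.map (i₂ : H₂ →ₗ[k] H) (i₂ : H₂ →ₗ[k] H) S) =
          (TensorProduct.rid k H₁ (LinearMap.lTensor H₁ (Coalgebra.counit (R := k)) T)) ⊗ₜ
          (TensorProduct.lid k H₂ (LinearMap.rTensor H₂ (Coalgebra.counit (R := k)) S)) := by
      intro T S
      induction T with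
      | zero => simp
      | add T₁ T₂ h₁ h₂ => simp only [map_add, add_mul, h₁, h₂, TensorProduct.add_tmul]
      | tmul h h' =>
        induction S with
        | zero => simp
        | add S₁ S₂ h₁ h₂ => simp only [map_add, mul_add, h₁, h₂, TensorProduct.tmul_add]
        | tmul a a' =>
          have e₁ := proj₁_mul hF h a
          have e₂ := proj₂_mul hF h' a'
          simp only [TensorProduct.map_tmul, Algebra.TensorProduct.tmul_mul_tmul,
            LinearMap.lTensor_tmul, LinearMap.rTensor_tmul, TensorProduct.rid_tmul,
            TensorProduct.lid_tmul]
          rw [TensorProduct.smul_tmul_smul, mul_comm, ← TensorProduct.smul_tmul_smul]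
          exact (congrArg₂ (· ⊗ₜ ·) e₁ e₂).trans (by
            rw [TensorProduct.smul_tmul_smul])
    rw [Bialgebra.comul_mul, h₁, h₂, key, factorEquiv_symm_mul]
    rw [Coalgebra.lTensor_counit_comul, Coalgebra.rTensor_counit_comul]
    simp

theorem proj₁_mul_right (x : H) (b : H₂) :
    proj₁ hF (x * i₂ b) = Coalgebra.counit (R := k) b • proj₁ hF x := by
  induction x using factor_induction hF with
  | add x y hx hy => rw [add_mul, map_add, map_add, smul_add, hx, hy]
  | mul h a => rw [mul_assoc, ← map_mul, proj₁_mul, proj₁_mul, Bialgebra.counit_mul, smul_smul,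
      mul_comm]

theorem proj₁_mul_left (g : H₁) (x : H) : proj₁ hF (i₁ g * x) = g * proj₁ hF x := by
  induction x using factor_induction hF with
  | add x y hx hy => rw [mul_add, map_add, map_add, mul_add, hx, hy]
  | mul h a => rw [← mul_assoc, ← map_mul, proj₁_mul, proj₁_mul, mul_smul_comm]

theorem proj₂_mul_left (g : H₁) (x : H) :
    proj₂ hF (i₁ g * x) = Coalgebra.counit (R := k) g • proj₂ hF x := by
  induction x using factor_induction hF with
  | add x y hx hy => rw [mul_add, map_add, map_add, smul_add, hx, hy]
  | mul h a => rw [← mul_assoc, ← map_mul, proj₂_mul, proj₂_mul, Bialgebra.counit_mul, smul_smul]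

/-- A right factor from `H₂` enters `proj₁` only through its counit, so multiplying by `a` descends
to the projection. Associativity in `H` then yields the action law of `lact`. -/
theorem proj₁_mul_eq_lact (a : H₂) (x : H) : proj₁ hF (i₂ a * x) = lact hF a (proj₁ hF x) := by
  induction x using factor_induction hF with
  | add x y hx hy => rw [mul_add, map_add, map_add, map_add, hx, hy]
  | mul h b => rw [← mul_assoc, proj₁_mul_right, proj₁_mul, map_smul, lact_eq]

theorem proj₂_mul_eq_ract (x : H) (h : H₁) : proj₂ hF (x * i₁ h) = ract hF (proj₂ hF x) h := by
  induction x using factor_induction hF with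
  | add x y hx hy =>
    rw [add_mul, map_add, map_add, map_add, LinearMap.add_apply, hx, hy]
  | mul g b => rw [mul_assoc, proj₂_mul_left, proj₂_mul, map_smul, LinearMap.smul_apply, ract_eq]

/-- A factorisation of Hopf algebras makes the factors a matched pair. -/
theorem isMatched : IsMatched hF where
  reorder_eq a h := by
    have h₀ : reorder hF a h = (factorEquiv hF).symm (i₂ a * i₁ h) := rfl
    have h₁ : Coalgebra.comul (R := k) (i₁ h) =
        TensorProduct.map (i₁ : H₁ →ₗ[k] H) (i₁ : H₁ →ₗ[k] H) (Coalgebra.comul (R := k) h) :=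
      (CoalgHomClass.map_comp_comul_apply i₁ h).symm
    have h₂ : Coalgebra.comul (R := k) (i₂ a) =
        TensorProduct.map (i₂ : H₂ →ₗ[k] H) (i₂ : H₂ →ₗ[k] H) (Coalgebra.comul (R := k) a) :=
      (CoalgHomClass.map_comp_comul_apply i₂ a).symm
    rw [h₀, factorEquiv_symm_eq, Bialgebra.comul_mul, h₁, h₂, TensorProduct.comul_tmul]
    generalize Coalgebra.comul (R := k) a = S
    generalize Coalgebra.comul (R := k) h = T
    induction T with
    | zero => simp
    | add T₁ T₂ h₁ h₂ => simp only [map_add, mul_add, h₁, h₂, TensorProduct.tmul_add]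
    | tmul h h' =>
      induction S with
      | zero => simp
      | add S₁ S₂ h₁ h₂ => simp only [map_add, add_mul, h₁, h₂, TensorProduct.add_tmul]
      | tmul a a' =>
        rw [TensorProduct.AlgebraTensorModule.tensorTensorTensorComm_tmul]
        simp only [TensorProduct.map_tmul, Algebra.TensorProduct.tmul_mul_tmul]
        rfl
  one_lact h := by
    rw [lact_eq, map_one, one_mul]
    simpa using proj₁_mul hF h 1
  mul_lact a b h := by rw [lact_eq, map_mul i₂, mul_assoc, proj₁_mul_eq_lact, ← lact_eq]
  ract_one a := by
    rw [ract_eq, map_one, mul_one]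
    simpa using proj₂_mul hF 1 a
  ract_mul a h g := by rw [ract_eq, map_mul i₁, ← mul_assoc, proj₂_mul_eq_ract, ← ract_eq]

end Semidual


namespace Iwasawa

/-! ### Smash products of enveloping algebras with algebras on which they act by derivations -/

/-- A right action of a real Lie algebra on a commutative complex algebra by derivations. -/
structure DerAction (L A : Type*) [LieRing L] [LieAlgebra ℝ L] [CommRing A] [Algebra ℂ A] where
  D : L → Derivation ℂ A A
  D_add : ∀ X Y φ, D (X + Y) φ = D X φ + D Y φ
  D_smul : ∀ (r : ℝ) X φ, D (r • X) φ = (r : ℂ) • D X φ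
  D_lie : ∀ X Y φ, D ⁅X, Y⁆ φ = D Y (D X φ) - D X (D Y φ)

namespace DerAction

variable {L A : Type*} [LieRing L] [LieAlgebra ℝ L] [CommRing A] [Algebra ℂ A]

/-- The right action of the enveloping algebra. -/
def act (S : DerAction L A) : A →ₗ[ℂ] Env L →ₗ[ℂ] A :=
  envRightModule (fun X => (S.D X : A →ₗ[ℂ] A)) (fun X Y => LinearMap.ext (S.D_add X Y))
    (fun r X => LinearMap.ext (S.D_smul r X)) (fun X Y => LinearMap.ext (S.D_lie X Y))

variable (S : DerAction L A)

@[simp] theorem act_one (φ : A) : S.act φ 1 = φ := envRightModule_one _ _ _ _ _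

theorem act_mul (φ : A) (a b : Env L) : S.act φ (a * b) = S.act (S.act φ a) b :=
  envRightModule_mul _ _ _ _ _ _ _

@[simp] theorem act_toEnv (φ : A) (X : L) : S.act φ (toEnv 1 X) = S.D X φ :=
  envRightModule_toEnv _ _ _ _ _ _

theorem act_toEnv' (φ : A) (c : ℂ) (X : L) : S.act φ (toEnv c X) = c • S.D X φ := by
  rw [toEnv_eq_smul, map_smul, act_toEnv]

theorem one_act (a : Env L) : S.act 1 a = Coalgebra.counit (R := ℂ) a • 1 := by
  induction a using env_induction_right with
  | one => simp
  | add u v hu hv => rw [map_add, map_add, hu, hv, add_smul]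
  | smul c u hu => rw [map_smul, map_smul, hu, smul_assoc]
  | mul u X hu => rw [act_mul, hu, Bialgebra.counit_mul, map_smul]; simp

/-- The Leibniz rule is this identity for a primitive element, and both sides are compatible with
appending one more Lie algebra element on the right. -/
theorem mul_act (φ ψ : A) (a : Env L) : S.act (φ * ψ) a =
    LinearMap.mul' ℂ A (TensorProduct.map (S.act φ) (S.act ψ) (Coalgebra.comul (R := ℂ) a)) := by
  induction a using env_induction_right with
  | one => simp [Algebra.TensorProduct.one_def]
  | add u v hu hv => simp only [map_add, hu, hv]
  | smul c u hu => simp only [map_smul, hu]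
  | mul u X hu =>
    rw [act_mul, hu, Bialgebra.comul_mul, comul_toEnv]
    generalize Coalgebra.comul (R := ℂ) u = T
    induction T with
    | zero => simp
    | add T₁ T₂ h₁ h₂ => simp only [map_add, add_mul, LinearMap.add_apply, h₁, h₂]
    | tmul u v =>
      simp only [mul_add, Algebra.TensorProduct.tmul_mul_tmul, map_add, TensorProduct.map_tmul,
        LinearMap.mul'_apply, mul_one, act_mul, act_toEnv, Derivation.leibniz, smul_eq_mul]
      ring

/-- The smash product algebra, on the vector space `Env L ⊗ A`. -/
@[nolint unusedArguments]
def Smash (_ : DerAction L A) : Type _ := Env L ⊗[ℂ] A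

instance : AddCommGroup S.Smash := inferInstanceAs (AddCommGroup (Env L ⊗[ℂ] A))

instance : Module ℂ S.Smash := inferInstanceAs (Module ℂ (Env L ⊗[ℂ] A))

/-- The identification of `Env L ⊗ A` with the smash product. -/
def smashEquiv : Env L ⊗[ℂ] A ≃ₗ[ℂ] S.Smash := LinearEquiv.refl ℂ _

theorem smash_induction {p : S.Smash → Prop} (tmul : ∀ a φ, p (S.smashEquiv (a ⊗ₜ φ)))
    (add : ∀ u v, p u → p v → p (u + v)) (u : S.Smash) : p u := by
  obtain ⟨T, rfl⟩ := S.smashEquiv.surjective u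
  induction T with
  | zero => simpa using tmul 0 0
  | add T₁ T₂ h₁ h₂ => rw [map_add]; exact add _ _ h₁ h₂
  | tmul a φ => exact tmul a φ

/-- Right multiplication of the smash product by an element of the Lie algebra. -/
def smashD (X : L) : Module.End ℂ S.Smash :=
  S.smashEquiv.toLinearMap ∘ₗ
    (LinearMap.rTensor A (LinearMap.mulRight ℂ (toEnv 1 X)) +
      LinearMap.lTensor (Env L) (S.D X : A →ₗ[ℂ] A)) ∘ₗ S.smashEquiv.symm.toLinearMap

@[simp] theorem smashD_tmul (X : L) (a : Env L) (φ : A) :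
    S.smashD X (S.smashEquiv (a ⊗ₜ φ)) =
      S.smashEquiv ((a * toEnv 1 X) ⊗ₜ φ) + S.smashEquiv (a ⊗ₜ S.D X φ) := by
  simp [smashD]

/-- Right multiplication of the smash product by the enveloping algebra. -/
def smashU : S.Smash →ₗ[ℂ] Env L →ₗ[ℂ] S.Smash :=
  envRightModule S.smashD
    (fun X Y => by
      apply LinearMap.ext
      intro u
      induction u using S.smash_induction with
      | add u v hu hv => rw [map_add, map_add, hu, hv]
      | tmul a φ =>
        simp only [smashD_tmul, LinearMap.add_apply, toEnv_add, mul_add, TensorProduct.add_tmul,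
          S.D_add, TensorProduct.tmul_add, map_add]
        abel)
    (fun r X => by
      apply LinearMap.ext
      intro u
      induction u using S.smash_induction with
      | add u v hu hv => rw [map_add, map_add, hu, hv]
      | tmul a φ =>
        simp only [smashD_tmul, LinearMap.smul_apply, toEnv_smul, mul_smul_comm,
          ← TensorProduct.smul_tmul', S.D_smul, TensorProduct.tmul_smul, map_smul, smul_add])
    (fun X Y => by
      apply LinearMap.ext
      intro u
      induction u using S.smash_induction with
      | add u v hu hv => rw [map_add, map_add, hu, hv]
      | tmul a φ =>
        simp only [smashD_tmul, LinearMap.sub_apply, Module.End.mul_apply, map_add, toEnv_lie,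
          mul_sub, TensorProduct.sub_tmul, S.D_lie, TensorProduct.tmul_sub, map_sub, mul_assoc]
        abel)

@[simp] theorem smashU_one (u : S.Smash) : S.smashU u 1 = u := envRightModule_one _ _ _ _ _

theorem smashU_mul (u : S.Smash) (a b : Env L) :
    S.smashU u (a * b) = S.smashU (S.smashU u a) b := envRightModule_mul _ _ _ _ _ _ _

@[simp] theorem smashU_toEnv (u : S.Smash) (X : L) : S.smashU u (toEnv 1 X) = S.smashD X u :=
  envRightModule_toEnv _ _ _ _ _ _

/-- Links the recursive definition of right multiplication, one Lie algebra element at a time, to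
the closed formula `∑ a b₍₁₎ ⊗ φ ◁ b₍₂₎` required of a bicrossproduct. -/
theorem smashU_tmul (a b : Env L) (φ : A) : S.smashU (S.smashEquiv (a ⊗ₜ φ)) b =
    S.smashEquiv (TensorProduct.map (LinearMap.mulLeft ℂ a) (S.act φ)
      (Coalgebra.comul (R := ℂ) b)) := by
  induction b using env_induction_right with
  | one => simp [Algebra.TensorProduct.one_def]
  | add u v hu hv => simp only [map_add, hu, hv]
  | smul c u hu => simp only [map_smul, hu]
  | mul u X hu =>
    rw [smashU_mul, hu, Bialgebra.comul_mul, comul_toEnv, smashU_toEnv]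
    generalize Coalgebra.comul (R := ℂ) u = T
    induction T with
    | zero => simp
    | add T₁ T₂ h₁ h₂ => simp only [map_add, add_mul, h₁, h₂]
    | tmul u v =>
      simp only [mul_add, Algebra.TensorProduct.tmul_mul_tmul, map_add, TensorProduct.map_tmul,
        LinearMap.mulLeft_apply, mul_one, act_mul, act_toEnv, smashD_tmul, mul_assoc]

/-- Right multiplication of the smash product by an element of `A`. -/
def smashA : S.Smash →ₗ[ℂ] A →ₗ[ℂ] S.Smash :=
  (((LinearMap.lTensorHom (Env L)).comp (LinearMap.mul ℂ A).flip).flip.comp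
    S.smashEquiv.symm.toLinearMap).compr₂ S.smashEquiv.toLinearMap

@[simp] theorem smashA_tmul (a : Env L) (φ ψ : A) :
    S.smashA (S.smashEquiv (a ⊗ₜ φ)) ψ = S.smashEquiv (a ⊗ₜ (φ * ψ)) := by
  simp [smashA, mul_comm]

/-- The multiplication of the smash product. -/
def smashMul : S.Smash →ₗ[ℂ] S.Smash →ₗ[ℂ] S.Smash :=
  LinearMap.flip ((TensorProduct.lift
    (LinearMap.mk₂ ℂ (fun b ψ => S.smashA.flip ψ ∘ₗ S.smashU.flip b)
      (fun b c ψ => by rw [map_add, LinearMap.comp_add])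
      (fun c b ψ => by rw [map_smul, LinearMap.comp_smul])
      (fun b φ ψ => by rw [map_add, LinearMap.add_comp])
      (fun c b ψ => by rw [map_smul, LinearMap.smul_comp]))).comp S.smashEquiv.symm.toLinearMap)

theorem smashMul_tmul (u : S.Smash) (b : Env L) (ψ : A) :
    S.smashMul u (S.smashEquiv (b ⊗ₜ ψ)) = S.smashA (S.smashU u b) ψ := by
  simp [smashMul]

theorem smashD_smashA (u : S.Smash) (φ : A) (X : L) : S.smashD X (S.smashA u φ) =
    S.smashA (S.smashD X u) φ + S.smashA u (S.D X φ) := by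
  induction u using S.smash_induction with
  | add u v hu hv => simp only [map_add, LinearMap.add_apply, hu, hv]; abel
  | tmul a ψ =>
    simp only [smashA_tmul, smashD_tmul, Derivation.leibniz, smul_eq_mul, TensorProduct.tmul_add,
      map_add, LinearMap.add_apply, mul_comm φ]
    abel

theorem smashA_mul (u : S.Smash) (φ ψ : A) :
    S.smashA (S.smashA u φ) ψ = S.smashA u (φ * ψ) := by
  induction u using S.smash_induction with
  | add u v hu hv => simp only [map_add, LinearMap.add_apply, hu, hv]
  | tmul a χ => simp only [smashA_tmul, mul_assoc]

theorem smashMul_smashA (u v : S.Smash) (φ : A) :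
    S.smashMul u (S.smashA v φ) = S.smashA (S.smashMul u v) φ := by
  induction v using S.smash_induction with
  | add v w hv hw => simp only [map_add, LinearMap.add_apply, hv, hw]
  | tmul a χ => simp only [smashA_tmul, smashMul_tmul, smashA_mul]

theorem smashMul_smashD (u v : S.Smash) (X : L) :
    S.smashMul u (S.smashD X v) = S.smashD X (S.smashMul u v) := by
  induction v using S.smash_induction with
  | add v w hv hw => simp only [map_add, hv, hw]
  | tmul a χ =>
    simp only [smashD_tmul, map_add, smashMul_tmul, smashD_smashA, smashU_mul, smashU_toEnv]

theorem smashMul_smashU (u v : S.Smash) (b : Env L) :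
    S.smashMul u (S.smashU v b) = S.smashU (S.smashMul u v) b := by
  induction b using env_induction_right with
  | one => simp
  | add b c hb hc => simp only [map_add, hb, hc]
  | smul c b hb => simp only [map_smul, hb]
  | mul b X hb => simp only [smashU_mul, smashU_toEnv, smashMul_smashD, hb]

/-- The product with `b ⊗ ψ` is `smashU` by `b` followed by `smashA` by `ψ`. Left multiplication
commutes with both of these right operations, and that is associativity. -/
theorem smashMul_assoc (u v w : S.Smash) :
    S.smashMul (S.smashMul u v) w = S.smashMul u (S.smashMul v w) := by
  induction w using S.smash_induction with
  | add w x hw hx => simp only [map_add, hw, hx]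
  | tmul b ψ => simp only [smashMul_tmul, smashMul_smashA, smashMul_smashU]

theorem smashA_one (u : S.Smash) : S.smashA u 1 = u := by
  induction u using S.smash_induction with
  | add u v hu hv => simp only [map_add, LinearMap.add_apply, hu, hv]
  | tmul a χ => simp only [smashA_tmul, mul_one]

theorem one_smashMul (u : S.Smash) : S.smashMul (S.smashEquiv (1 ⊗ₜ 1)) u = u := by
  have h : ∀ b : Env L, S.smashU (S.smashEquiv (1 ⊗ₜ 1)) b = S.smashEquiv (b ⊗ₜ 1) := by
    intro b
    induction b using env_induction_right with
    | one => simp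
    | add b c hb hc => simp only [map_add, hb, hc, TensorProduct.add_tmul]
    | smul c b hb => simp only [map_smul, hb, ← TensorProduct.smul_tmul']
    | mul b X hb => rw [smashU_mul, hb, smashU_toEnv, smashD_tmul]; simp
  induction u using S.smash_induction with
  | add u v hu hv => simp only [map_add, hu, hv]
  | tmul a χ => rw [smashMul_tmul, h, smashA_tmul, one_mul]

instance : Ring S.Smash where
  mul u v := S.smashMul u v
  one := S.smashEquiv (1 ⊗ₜ 1)
  mul_assoc := S.smashMul_assoc
  one_mul := S.one_smashMul
  mul_one u := (S.smashMul_tmul u 1 1).trans (by rw [smashU_one, smashA_one])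
  left_distrib u v w := map_add (S.smashMul u) v w
  right_distrib u v w := LinearMap.map_add₂ S.smashMul u v w
  zero_mul u := LinearMap.map_zero₂ S.smashMul u
  mul_zero u := map_zero (S.smashMul u)
  zsmul := (· • ·)
  zsmul_zero' := zero_smul ℤ
  zsmul_succ' n a := SubNegMonoid.zsmul_succ' n a
  zsmul_neg' n a := SubNegMonoid.zsmul_neg' n a
  neg_add_cancel := neg_add_cancel

theorem smash_mul_def (u v : S.Smash) : u * v = S.smashMul u v := rfl

theorem smash_one_def : (1 : S.Smash) = S.smashEquiv (1 ⊗ₜ 1) := rfl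

instance : Algebra ℂ S.Smash :=
  Algebra.ofModule (fun c u v => LinearMap.map_smul₂ S.smashMul c u v)
    (fun c u v => map_smul (S.smashMul u) c v)

theorem smash_tmul_mul_tmul (a b : Env L) (φ ψ : A) :
    S.smashEquiv (a ⊗ₜ φ) * S.smashEquiv (b ⊗ₜ ψ) =
      S.smashEquiv (TensorProduct.map (LinearMap.mulLeft ℂ a) (LinearMap.mulRight ℂ ψ ∘ₗ S.act φ)
        (Coalgebra.comul (R := ℂ) b)) := by
  rw [smash_mul_def, smashMul_tmul, smashU_tmul]
  generalize Coalgebra.comul (R := ℂ) b = T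
  induction T with
  | zero => simp
  | add T₁ T₂ h₁ h₂ => simp only [map_add, LinearMap.add_apply, h₁, h₂]
  | tmul u v => simp

/-- The inclusion of the enveloping algebra. -/
def smashInl : Env L →ₐ[ℂ] S.Smash :=
  AlgHom.ofLinearMap (S.smashEquiv.toLinearMap ∘ₗ (TensorProduct.mk ℂ (Env L) A).flip 1) rfl
    (fun a b => by
      simp only [LinearMap.comp_apply, LinearMap.flip_apply, TensorProduct.mk_apply,
        LinearEquiv.coe_coe, smash_tmul_mul_tmul, LinearMap.mulRight_one, LinearMap.id_comp]
      induction b using env_induction_right with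
      | one => simp [Algebra.TensorProduct.one_def]
      | add b c hb hc => simp only [mul_add, map_add, TensorProduct.add_tmul, hb, hc]
      | smul c b hb => simp only [mul_smul_comm, map_smul, ← TensorProduct.smul_tmul', hb]
      | mul b X hb =>
        rw [← smashU_tmul] at hb ⊢
        rw [smashU_mul, ← hb, smashU_toEnv, smashD_tmul]
        simp [mul_assoc])

/-- The inclusion of the algebra acted on. -/
def smashInr : A →ₐ[ℂ] S.Smash :=
  AlgHom.ofLinearMap (S.smashEquiv.toLinearMap ∘ₗ TensorProduct.mk ℂ (Env L) A 1) rfl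
    (fun φ ψ => by
      simp [smash_tmul_mul_tmul, Algebra.TensorProduct.one_def])

theorem smashInl_apply (a : Env L) : S.smashInl a = S.smashEquiv (a ⊗ₜ 1) := rfl

theorem smashInr_apply (φ : A) : S.smashInr φ = S.smashEquiv (1 ⊗ₜ φ) := rfl

theorem smashEquiv_tmul (a : Env L) (φ : A) :
    S.smashEquiv (a ⊗ₜ φ) = S.smashInl a * S.smashInr φ := by
  rw [smashInl_apply, smashInr_apply, smash_tmul_mul_tmul]
  simp [Algebra.TensorProduct.one_def]

theorem smashInr_mul_smashInl (φ : A) (X : L) : S.smashInr φ * S.smashInl (toEnv 1 X) =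
    S.smashInl (toEnv 1 X) * S.smashInr φ + S.smashInr (S.D X φ) := by
  rw [← smashEquiv_tmul, smashInl_apply, smashInr_apply, smashInr_apply, smash_tmul_mul_tmul,
    comul_toEnv]
  simp

section lift

variable {C : Type*} [Ring C] [Algebra ℂ C] (f : Env L →ₐ[ℂ] C) (g : A →ₐ[ℂ] C)
  (h : ∀ φ X, g φ * f (toEnv 1 X) = f (toEnv 1 X) * g φ + g (S.D X φ))

/-- The universal property of the smash product. -/
def smashLift : S.Smash →ₐ[ℂ] C :=
  AlgHom.ofLinearMap
    (LinearMap.mul' ℂ C ∘ₗ TensorProduct.map f.toLinearMap g.toLinearMap ∘ₗ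
      S.smashEquiv.symm.toLinearMap) (by simp [smash_one_def])
    (by
      set F : S.Smash →ₗ[ℂ] C := LinearMap.mul' ℂ C ∘ₗ
        TensorProduct.map f.toLinearMap g.toLinearMap ∘ₗ S.smashEquiv.symm.toLinearMap
      have hF : ∀ a φ, F (S.smashEquiv (a ⊗ₜ φ)) = f a * g φ := fun a φ => by simp [F]
      have hA : ∀ u φ, F (S.smashA u φ) = F u * g φ := by
        intro u φ
        induction u using S.smash_induction with
        | add u v hu hv => simp only [map_add, LinearMap.add_apply, hu, hv, add_mul]
        | tmul a ψ => rw [smashA_tmul, hF, hF, map_mul, mul_assoc]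
      -- The commutation hypothesis `h` enters here only: it moves `f X` to the left of `g ψ` at the
      -- price of the derivative term already present in `smashD`.
      have hD : ∀ u X, F (S.smashD X u) = F u * f (toEnv 1 X) := by
        intro u X
        induction u using S.smash_induction with
        | add u v hu hv => simp only [map_add, hu, hv, add_mul]
        | tmul a ψ =>
          rw [smashD_tmul, map_add, hF, hF, hF, map_mul, mul_assoc, mul_assoc, h, mul_add]
      have hU : ∀ b u, F (S.smashU u b) = F u * f b := by
        intro b
        induction b using env_induction_right with
        | one => simp
        | add b c hb hc => intro u; simp only [map_add, hb, hc, mul_add]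
        | smul c b hb => intro u; simp only [map_smul, hb, mul_smul_comm]
        | mul b X hb => intro u; rw [smashU_mul, smashU_toEnv, hD, hb, map_mul, mul_assoc]
      intro u v
      rw [smash_mul_def]
      induction v using S.smash_induction with
      | add v w hv hw => simp only [map_add, mul_add, hv, hw]
      | tmul b ψ => rw [smashMul_tmul, hA, hU, hF, mul_assoc])

theorem smashLift_tmul (a : Env L) (φ : A) :
    S.smashLift f g h (S.smashEquiv (a ⊗ₜ φ)) = f a * g φ := rfl

@[simp] theorem smashLift_inl (a : Env L) : S.smashLift f g h (S.smashInl a) = f a := by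
  rw [smashInl_apply, smashLift_tmul, map_one, mul_one]

@[simp] theorem smashLift_inr (φ : A) : S.smashLift f g h (S.smashInr φ) = g φ := by
  rw [smashInr_apply, smashLift_tmul, map_one, one_mul]

end lift

/-- Reduces the coalgebra axioms of the bicrossproduct to Lie algebra elements and functions. -/
theorem smash_hom_ext {C : Type*} [Ring C] [Algebra ℂ C] {f g : S.Smash →ₐ[ℂ] C}
    (hl : ∀ X, f (S.smashInl (toEnv 1 X)) = g (S.smashInl (toEnv 1 X)))
    (hr : ∀ φ, f (S.smashInr φ) = g (S.smashInr φ)) : f = g := by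
  have h : f.comp S.smashInl = g.comp S.smashInl := env_hom_ext hl
  apply AlgHom.ext
  intro u
  induction u using S.smash_induction with
  | add u v hu hv => rw [map_add, map_add, hu, hv]
  | tmul a φ =>
    rw [smashEquiv_tmul, map_mul, map_mul, hr]
    exact congrArg (· * _) (DFunLike.congr_fun h a)

end DerAction

end Iwasawa


namespace Iwasawa

open Matrix ComplexConjugate

/-! ### The vector fields of the dressing action of `sl₂` on `SU₂⋆` -/

theorem SU2Star.ext {g h : SU2Star} (h₀ : g.1 0 0 = h.1 0 0) (h₁ : g.1 1 0 = h.1 1 0) :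
    g = h := by
  have e : g.1 1 1 = h.1 1 1 := by
    rw [← inv_eq_of_mul_eq_one_right (entry_mul g), ← inv_eq_of_mul_eq_one_right (entry_mul h), h₀]
  apply Subtype.ext
  apply Matrix.SpecialLinearGroup.ext
  intro i j
  fin_cases i <;> fin_cases j
  · exact h₀
  · exact (entry_zero_one g).trans (entry_zero_one h).symm
  · exact h₁
  · exact e

/-- The coordinates `(log w, z)`. -/
def logChart (g : SU2Star) : ℝ × ℂ := (Real.log (g.1 0 0).re, g.1 1 0)

/-- The group element with coordinates `(log w, z)`. -/
def expChart (q : ℝ × ℂ) : SU2Star := SU2Star.mk (Real.exp q.1) (Real.exp_pos _) q.2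

theorem expChart_logChart (g : SU2Star) : expChart (logChart g) = g := by
  apply SU2Star.ext
  · rw [entry_zero_zero g]
    simp only [expChart, logChart, SU2Star.mk, Real.exp_log g.2.2.2]
    simp
  · simp [expChart, logChart, SU2Star.mk]

theorem entry_one_one_eq (g : SU2Star) : g.1 1 1 = (g.1 0 0)⁻¹ :=
  (inv_eq_of_mul_eq_one_right (entry_mul g)).symm

theorem conj_entry_zero_zero (g : SU2Star) : conj (g.1 0 0) = g.1 0 0 := by
  rw [entry_zero_zero, Complex.conj_ofReal]

theorem entry_zero_zero_ne (g : SU2Star) : g.1 0 0 ≠ 0 :=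
  left_ne_zero_of_mul_eq_one (entry_mul g)

/-- A function on `SU₂⋆` in the coordinates `(log w, z)`. -/
def inChart (φ : FunSU2Star) (q : ℝ × ℂ) : ℂ := toFun φ (expChart q)

theorem inChart_logChart (φ : FunSU2Star) (g : SU2Star) :
    inChart φ (logChart g) = toFun φ g := by rw [inChart, expChart_logChart]

/-- The velocity in the coordinates `(log w, z)` of the curve `s ↦ solvablePart (exp (s M) g)`. -/
def velocity (M : Matrix (Fin 2) (Fin 2) ℂ) (g : SU2Star) : ℝ × ℂ :=
  ((M 0 0 + M 0 1 * (g.1 1 0 * g.1 1 1)).re,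
    g.1 0 0 * M 1 0 + conj (M 0 1) * g.1 1 1 ^ 3 - M 0 0 * g.1 1 0 +
      conj (M 0 0 + M 0 1 * (g.1 1 0 * g.1 1 1)) * g.1 1 0 -
      ((M 0 0 + M 0 1 * (g.1 1 0 * g.1 1 1)).re : ℂ) * g.1 1 0)

/-- The derivatives of the five coordinates along the vector field of `M`. -/
def dgen (M : Matrix (Fin 2) (Fin 2) ℂ) : Fin 5 → FunSU2Star :=
  let t : FunSU2Star := (2⁻¹ : ℂ) • ((M 0 0 + conj (M 0 0)) • 1 + M 0 1 • (gen 2 * gen 1) +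
    conj (M 0 1) • (gen 3 * gen 1))
  let q : FunSU2Star := M 0 0 • 1 + M 0 1 • (gen 2 * gen 1)
  let q' : FunSU2Star := conj (M 0 0) • 1 + conj (M 0 1) • (gen 3 * gen 1)
  ![gen 0 * t, -(gen 1 * t),
    M 1 0 • gen 0 + conj (M 0 1) • gen 1 ^ 3 - M 0 0 • gen 2 + q' * gen 2 - t * gen 2,
    conj (M 1 0) • gen 0 + M 0 1 • gen 1 ^ 3 - conj (M 0 0) • gen 3 + q * gen 3 - t * gen 3, t]

theorem hasFDerivAt_inChart_gen (i : Fin 5) (q : ℝ × ℂ) : HasFDerivAt (inChart (gen i))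
    ((![(Real.exp q.1 : ℂ) • Complex.ofRealCLM ∘L .fst ℝ ℝ ℂ,
      -((Real.exp q.1 : ℂ)⁻¹ • Complex.ofRealCLM ∘L .fst ℝ ℝ ℂ), .snd ℝ ℝ ℂ,
      Complex.conjCLE.toContinuousLinearMap ∘L .snd ℝ ℝ ℂ,
      Complex.ofRealCLM ∘L .fst ℝ ℝ ℂ] : Fin 5 → ℝ × ℂ →L[ℝ] ℂ) i) q := by
  have hfst : HasFDerivAt (Prod.fst : ℝ × ℂ → ℝ) (.fst ℝ ℝ ℂ) q := hasFDerivAt_fst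
  have hsnd : HasFDerivAt (Prod.snd : ℝ × ℂ → ℂ) (.snd ℝ ℝ ℂ) q := hasFDerivAt_snd
  have hof : HasFDerivAt (fun q : ℝ × ℂ => (q.1 : ℂ)) (Complex.ofRealCLM ∘L .fst ℝ ℝ ℂ) q :=
    Complex.ofRealCLM.hasFDerivAt.comp q hfst
  fin_cases i
  · have h := hof.cexp
    have e : inChart (gen 0) = fun q : ℝ × ℂ => Complex.exp (q.1 : ℂ) := by
      funext q; simp [inChart, coord, expChart, SU2Star.mk]
    change HasFDerivAt (inChart (gen 0)) _ q
    rw [e]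
    simpa using h
  · have h := hof.neg.cexp
    have e : inChart (gen 1) = fun q : ℝ × ℂ => Complex.exp (-(q.1 : ℂ)) := by
      funext q; simp [inChart, coord, expChart, SU2Star.mk, Complex.exp_neg]
    change HasFDerivAt (inChart (gen 1)) _ q
    rw [e]
    refine h.congr_fderiv ?_
    simp [Complex.exp_neg]
  · exact hsnd
  · exact Complex.conjCLE.toContinuousLinearMap.hasFDerivAt.comp q hsnd
  · have e : inChart (gen 4) = fun q : ℝ × ℂ => (q.1 : ℂ) := by
      funext q
      simp [inChart, coord, expChart, SU2Star.mk, -Complex.ofReal_exp]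
    change HasFDerivAt (inChart (gen 4)) _ q
    rw [e]
    exact hof

theorem inChart_add (φ ψ : FunSU2Star) : inChart (φ + ψ) = inChart φ + inChart ψ := by
  funext q; simp [inChart]

theorem inChart_mul (φ ψ : FunSU2Star) : inChart (φ * ψ) = inChart φ * inChart ψ := by
  funext q; simp [inChart]

theorem inChart_algebraMap (c : ℂ) : inChart (algebraMap ℂ _ c) = fun _ => c := by
  funext q; rw [inChart, AlgHom.commutes]; rfl

theorem inChart_smul (c : ℂ) (φ : FunSU2Star) : inChart (c • φ) = c • inChart φ := by
  funext q; simp [inChart]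

theorem differentiable_inChart (φ : FunSU2Star) : Differentiable ℝ (inChart φ) := by
  induction φ using coordRing_induction with
  | hgen i => exact fun q => (hasFDerivAt_inChart_gen i q).differentiableAt
  | halg c => rw [inChart_algebraMap]; exact differentiable_const c
  | hadd f g hf hg => rw [inChart_add]; exact hf.add hg
  | hmul f g hf hg => rw [inChart_mul]; exact hf.mul hg

/-- The derivative of a function along the vector field of `M`. -/
def vectorField (M : Matrix (Fin 2) (Fin 2) ℂ) (φ : FunSU2Star) (g : SU2Star) : ℂ :=
  fderiv ℝ (inChart φ) (logChart g) (velocity M g)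

section vectorField

variable (M : Matrix (Fin 2) (Fin 2) ℂ)

theorem vectorField_add (φ ψ : FunSU2Star) :
    vectorField M (φ + ψ) = vectorField M φ + vectorField M ψ := by
  funext g
  simp only [vectorField, inChart_add, Pi.add_apply]
  rw [fderiv_add (differentiable_inChart φ _) (differentiable_inChart ψ _)]
  rfl

theorem vectorField_smul (c : ℂ) (φ : FunSU2Star) :
    vectorField M (c • φ) = c • vectorField M φ := by
  funext g
  simp only [vectorField, inChart_smul, Pi.smul_apply]
  rw [fderiv_const_smul (differentiable_inChart φ _)]
  rfl

theorem vectorField_mul (φ ψ : FunSU2Star) : vectorField M (φ * ψ) =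
    toFun φ * vectorField M ψ + toFun ψ * vectorField M φ := by
  funext g
  simp only [vectorField, inChart_mul, Pi.mul_apply, Pi.add_apply]
  rw [fderiv_mul (differentiable_inChart φ _) (differentiable_inChart ψ _)]
  simp [inChart_logChart]

theorem vectorField_algebraMap (c : ℂ) : vectorField M (algebraMap ℂ _ c) = 0 := by
  funext g
  simp [vectorField, inChart_algebraMap]

/-- The field has polynomial coefficients in the five coordinates, which is what keeps the
coordinate ring stable. The real part in `velocity` is not holomorphic in `z`; it becomes the
half-sum `t` of `dgen` because `z̄` is among the generators. -/
theorem vectorField_gen (i : Fin 5) : vectorField M (gen i) = toFun (dgen M i) := by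
  funext g
  rw [vectorField, (hasFDerivAt_inChart_gen i _).fderiv]
  have h₁ : ((M 0 0 + M 0 1 * (g.1 1 0 * g.1 1 1)).re : ℂ) =
      2⁻¹ * (M 0 0 + conj (M 0 0) + M 0 1 * (g.1 1 0 * g.1 1 1) +
        conj (M 0 1) * (conj (g.1 1 0) * g.1 1 1)) := by
    rw [Complex.re_eq_add_conj]
    simp only [map_add, map_mul, entry_one_one]
    ring
  have h₂ : (Real.exp (logChart g).1 : ℂ) = g.1 0 0 := by
    rw [entry_zero_zero g, logChart, Real.exp_log g.2.2.2]
  have h₃ : conj (M 0 0 + M 0 1 * (g.1 1 0 * g.1 1 1)) =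
      conj (M 0 0) + conj (M 0 1) * (conj (g.1 1 0) * g.1 1 1) := by
    simp only [map_add, map_mul, entry_one_one]
  have hT : toFun (dgen M 4) g = ((M 0 0 + M 0 1 * (g.1 1 0 * g.1 1 1)).re : ℂ) := by
    rw [h₁]
    simp [dgen, coord]
    ring
  fin_cases i
  · have : toFun (dgen M 0) g = g.1 0 0 * toFun (dgen M 4) g := by simp [dgen, coord]
    change (Real.exp (logChart g).1 : ℂ) * ((velocity M g).1 : ℂ) = toFun (dgen M 0) g
    rw [h₂, this, hT, velocity]
  · have : toFun (dgen M 1) g = -(g.1 1 1 * toFun (dgen M 4) g) := by simp [dgen, coord]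
    change -((Real.exp (logChart g).1 : ℂ)⁻¹ * ((velocity M g).1 : ℂ)) = toFun (dgen M 1) g
    rw [h₂, this, hT, velocity, entry_one_one_eq]
  · have : toFun (dgen M 2) g = M 1 0 * g.1 0 0 + conj (M 0 1) * g.1 1 1 ^ 3 - M 0 0 * g.1 1 0 +
        (conj (M 0 0) + conj (M 0 1) * (conj (g.1 1 0) * g.1 1 1)) * g.1 1 0 -
        toFun (dgen M 4) g * g.1 1 0 := by simp [dgen, coord]
    change (velocity M g).2 = toFun (dgen M 2) g
    rw [this, hT, velocity, h₃, mul_comm (M 1 0)]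
  · have : toFun (dgen M 3) g = conj (M 1 0) * g.1 0 0 + M 0 1 * g.1 1 1 ^ 3 -
        conj (M 0 0) * conj (g.1 1 0) + (M 0 0 + M 0 1 * (g.1 1 0 * g.1 1 1)) * conj (g.1 1 0) -
        toFun (dgen M 4) g * conj (g.1 1 0) := by simp [dgen, coord]
    change conj (velocity M g).2 = toFun (dgen M 3) g
    rw [this, hT, velocity]
    simp only [map_add, map_sub, map_mul, map_pow, Complex.conj_conj, Complex.conj_ofReal,
      entry_one_one, conj_entry_zero_zero]
    ring
  · exact hT.symm

theorem vectorField_mem (φ : FunSU2Star) : vectorField M φ ∈ coordRing := by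
  induction φ using coordRing_induction with
  | hgen i => rw [vectorField_gen]; exact (dgen M i).2
  | halg c => rw [vectorField_algebraMap]; exact coordRing.zero_mem
  | hadd f g hf hg => rw [vectorField_add]; exact add_mem hf hg
  | hmul f g hf hg => rw [vectorField_mul]; exact add_mem (mul_mem f.2 hg) (mul_mem g.2 hf)

/-- The vector field of `M` as a derivation of `ℂ[SU₂⋆]`. -/
def dressing : Derivation ℂ FunSU2Star FunSU2Star :=
  Derivation.mk'
    { toFun := fun φ => ⟨vectorField M φ, vectorField_mem M φ⟩
      map_add' := fun φ ψ => Subtype.ext (vectorField_add M φ ψ)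
      map_smul' := fun c φ => Subtype.ext (vectorField_smul M c φ) }
    (fun φ ψ => Subtype.ext (vectorField_mul M φ ψ))

theorem toFun_dressing (φ : FunSU2Star) : toFun (dressing M φ) = vectorField M φ := rfl

@[simp] theorem dressing_gen (i : Fin 5) : dressing M (gen i) = dgen M i :=
  toFun_injective (vectorField_gen M i)

theorem derivation_ext {D₁ D₂ : Derivation ℂ FunSU2Star FunSU2Star}
    (h : ∀ i, D₁ (gen i) = D₂ (gen i)) : D₁ = D₂ := by
  apply Derivation.ext
  intro φ
  induction φ using coordRing_induction with
  | hgen i => exact h i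
  | halg c => rw [Derivation.map_algebraMap, Derivation.map_algebraMap]
  | hadd f g hf hg => rw [map_add, map_add, hf, hg]
  | hmul f g hf hg => rw [Derivation.leibniz, Derivation.leibniz, hf, hg]

theorem gen_zero_mul_gen_one : gen 0 * gen 1 = 1 :=
  toFun_injective (by funext g; exact entry_mul g)

end vectorField

theorem velocity_add (M N : Matrix (Fin 2) (Fin 2) ℂ) (g : SU2Star) :
    velocity (M + N) g = velocity M g + velocity N g := by
  apply Prod.ext
  · simp [velocity]; ring
  · simp [velocity]; ring

theorem velocity_smul (r : ℝ) (M : Matrix (Fin 2) (Fin 2) ℂ) (g : SU2Star) :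
    velocity (r • M) g = r • velocity M g := by
  apply Prod.ext
  · simp [velocity]; ring
  · simp [velocity]; ring

theorem dressing_add (M N : Matrix (Fin 2) (Fin 2) ℂ) (φ : FunSU2Star) :
    dressing (M + N) φ = dressing M φ + dressing N φ := by
  apply toFun_injective
  funext g
  simp only [toFun_dressing, map_add, Pi.add_apply, vectorField, velocity_add]

theorem dressing_smul (r : ℝ) (M : Matrix (Fin 2) (Fin 2) ℂ) (φ : FunSU2Star) :
    dressing (r • M) φ = (r : ℂ) • dressing M φ := by
  apply toFun_injective
  funext g
  rw [map_smul, Pi.smul_apply, toFun_dressing, toFun_dressing, vectorField, velocity_smul,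
    map_smul]
  exact Complex.real_smul

theorem lie_entries {M N : Matrix (Fin 2) (Fin 2) ℂ} (hM : M.trace = 0) (hN : N.trace = 0) :
    ⁅M, N⁆ 0 0 = M 0 1 * N 1 0 - N 0 1 * M 1 0 ∧
    ⁅M, N⁆ 0 1 = 2 * (M 0 0 * N 0 1 - N 0 0 * M 0 1) ∧
    ⁅M, N⁆ 1 0 = 2 * (N 0 0 * M 1 0 - M 0 0 * N 1 0) := by
  rw [Matrix.trace_fin_two] at hM hN
  have hM' : M 1 1 = -M 0 0 := by linear_combination hM
  have hN' : N 1 1 = -N 0 0 := by linear_combination hN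
  simp only [LieRing.of_associative_ring_bracket, Matrix.sub_apply, Matrix.mul_apply,
    Fin.sum_univ_two, hM', hN']
  refine ⟨?_, ?_, ?_⟩ <;> ring

section

variable (M N : Matrix (Fin 2) (Fin 2) ℂ) (g : SU2Star)

theorem toFun_dgen_zero : toFun (dgen M 0) g = g.1 0 0 * toFun (dgen M 4) g := by
  simp [dgen, coord]

theorem toFun_dgen_one : toFun (dgen M 1) g = -(g.1 1 1 * toFun (dgen M 4) g) := by
  simp [dgen, coord]

theorem toFun_dgen_four : toFun (dgen M 4) g = 2⁻¹ * (M 0 0 + conj (M 0 0) +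
    M 0 1 * (g.1 1 0 * g.1 1 1) + conj (M 0 1) * (conj (g.1 1 0) * g.1 1 1)) := by
  simp [dgen, coord]
  ring

theorem toFun_dgen_two : toFun (dgen M 2) g = M 1 0 * g.1 0 0 + conj (M 0 1) * g.1 1 1 ^ 3 -
    M 0 0 * g.1 1 0 + (conj (M 0 0) + conj (M 0 1) * (conj (g.1 1 0) * g.1 1 1)) * g.1 1 0 -
    toFun (dgen M 4) g * g.1 1 0 := by simp [dgen, coord]

theorem toFun_dgen_three : toFun (dgen M 3) g = conj (M 1 0) * g.1 0 0 + M 0 1 * g.1 1 1 ^ 3 -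
    conj (M 0 0) * conj (g.1 1 0) + (M 0 0 + M 0 1 * (g.1 1 0 * g.1 1 1)) * conj (g.1 1 0) -
    toFun (dgen M 4) g * conj (g.1 1 0) := by simp [dgen, coord]

theorem toFun_dressing_dgen_four : toFun (dressing N (dgen M 4)) g = 2⁻¹ *
    (M 0 1 * (g.1 1 0 * toFun (dgen N 1) g + g.1 1 1 * toFun (dgen N 2) g) +
    conj (M 0 1) * (conj (g.1 1 0) * toFun (dgen N 1) g + g.1 1 1 * toFun (dgen N 3) g)) := by
  have : dgen M 4 = (2⁻¹ : ℂ) • ((M 0 0 + conj (M 0 0)) • 1 + M 0 1 • (gen 2 * gen 1) +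
      conj (M 0 1) • (gen 3 * gen 1)) := rfl
  rw [this]
  simp only [Derivation.map_smul, map_add, Derivation.leibniz, dressing_gen,
    Derivation.map_one_eq_zero, smul_zero, zero_add, smul_eq_mul]
  simp [coord]
  ring

theorem toFun_dressing_dgen_zero : toFun (dressing N (dgen M 0)) g =
    g.1 0 0 * (toFun (dressing N (dgen M 4)) g + toFun (dgen M 4) g * toFun (dgen N 4) g) := by
  have : dgen M 0 = gen 0 * dgen M 4 := rfl
  rw [this, Derivation.leibniz, dressing_gen]
  simp [toFun_dgen_zero, coord]
  ring

theorem toFun_dressing_dgen_one : toFun (dressing N (dgen M 1)) g =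
    -(g.1 1 1 * (toFun (dressing N (dgen M 4)) g - toFun (dgen M 4) g * toFun (dgen N 4) g)) := by
  have : dgen M 1 = -(gen 1 * dgen M 4) := rfl
  rw [this, map_neg, Derivation.leibniz, dressing_gen]
  simp [toFun_dgen_one, coord]
  ring

theorem toFun_dressing_dgen_two : toFun (dressing N (dgen M 2)) g =
    M 1 0 * toFun (dgen N 0) g + conj (M 0 1) * (3 * g.1 1 1 ^ 2 * toFun (dgen N 1) g) -
    M 0 0 * toFun (dgen N 2) g +
    (conj (M 0 0) + conj (M 0 1) * (conj (g.1 1 0) * g.1 1 1)) * toFun (dgen N 2) g +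
    g.1 1 0 * (conj (M 0 1) * (conj (g.1 1 0) * toFun (dgen N 1) g +
      g.1 1 1 * toFun (dgen N 3) g)) -
    toFun (dgen M 4) g * toFun (dgen N 2) g - g.1 1 0 * toFun (dressing N (dgen M 4)) g := by
  have : dgen M 2 = M 1 0 • gen 0 + conj (M 0 1) • gen 1 ^ 3 - M 0 0 • gen 2 +
      (conj (M 0 0) • 1 + conj (M 0 1) • (gen 3 * gen 1)) * gen 2 - dgen M 4 * gen 2 := rfl
  have h₃ : toFun 3 = 3 := map_ofNat toFun 3
  rw [this]
  simp only [Derivation.map_smul, map_add, map_sub, Derivation.leibniz, Derivation.leibniz_pow, dressing_gen,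
    Derivation.map_one_eq_zero, smul_zero, zero_add, smul_eq_mul]
  simp [coord, h₃]
  ring

theorem toFun_dressing_dgen_three : toFun (dressing N (dgen M 3)) g =
    conj (M 1 0) * toFun (dgen N 0) g + M 0 1 * (3 * g.1 1 1 ^ 2 * toFun (dgen N 1) g) -
    conj (M 0 0) * toFun (dgen N 3) g +
    (M 0 0 + M 0 1 * (g.1 1 0 * g.1 1 1)) * toFun (dgen N 3) g +
    conj (g.1 1 0) * (M 0 1 * (g.1 1 0 * toFun (dgen N 1) g + g.1 1 1 * toFun (dgen N 2) g)) -
    toFun (dgen M 4) g * toFun (dgen N 3) g -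
      conj (g.1 1 0) * toFun (dressing N (dgen M 4)) g := by
  have : dgen M 3 = conj (M 1 0) • gen 0 + M 0 1 • gen 1 ^ 3 - conj (M 0 0) • gen 3 +
      (M 0 0 • 1 + M 0 1 • (gen 2 * gen 1)) * gen 3 - dgen M 4 * gen 3 := rfl
  have h₃ : toFun 3 = 3 := map_ofNat toFun 3
  rw [this]
  simp only [Derivation.map_smul, map_add, map_sub, Derivation.leibniz, Derivation.leibniz_pow, dressing_gen,
    Derivation.map_one_eq_zero, smul_zero, zero_add, smul_eq_mul]
  simp [coord, h₃]
  ring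

/-- The derivative of `log w` occurs inside the derivatives of all the other coordinates, so this
case is proved separately and substituted into the rest. -/
theorem dgen_four_lie (hM : M.trace = 0) (hN : N.trace = 0) : toFun (dgen ⁅M, N⁆ 4) g =
    toFun (dressing N (dgen M 4)) g - toFun (dressing M (dgen N 4)) g := by
  obtain ⟨h₀₀, h₀₁, h₁₀⟩ := lie_entries hM hN
  have hw := entry_zero_zero_ne g
  simp only [toFun_dressing_dgen_four, toFun_dgen_one, toFun_dgen_two, toFun_dgen_three,
    toFun_dgen_four, h₀₀, h₀₁, map_mul, map_sub, map_ofNat, entry_one_one_eq]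
  field_simp
  ring

theorem dgen_two_lie (hM : M.trace = 0) (hN : N.trace = 0) : toFun (dgen ⁅M, N⁆ 2) g =
    toFun (dressing N (dgen M 2)) g - toFun (dressing M (dgen N 2)) g := by
  obtain ⟨h₀₀, h₀₁, h₁₀⟩ := lie_entries hM hN
  have hw := entry_zero_zero_ne g
  rw [toFun_dgen_two, toFun_dressing_dgen_two, toFun_dressing_dgen_two, dgen_four_lie M N g hM hN]
  simp only [toFun_dgen_zero, toFun_dgen_one, toFun_dgen_two, toFun_dgen_three,
    toFun_dgen_four, h₀₀, h₀₁, h₁₀, map_mul, map_sub, map_ofNat, entry_one_one_eq]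
  field_simp
  ring

theorem dgen_three_lie (hM : M.trace = 0) (hN : N.trace = 0) : toFun (dgen ⁅M, N⁆ 3) g =
    toFun (dressing N (dgen M 3)) g - toFun (dressing M (dgen N 3)) g := by
  obtain ⟨h₀₀, h₀₁, h₁₀⟩ := lie_entries hM hN
  have hw := entry_zero_zero_ne g
  rw [toFun_dgen_three, toFun_dressing_dgen_three, toFun_dressing_dgen_three,
    dgen_four_lie M N g hM hN]
  simp only [toFun_dgen_zero, toFun_dgen_one, toFun_dgen_two, toFun_dgen_three,
    toFun_dgen_four, h₀₀, h₀₁, h₁₀, map_mul, map_sub, map_ofNat, entry_one_one_eq]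
  field_simp
  ring

end

/-- A left action of the group on points acts on functions from the right, whence the reversed
commutator. Both sides are derivations, so it is enough to compare them on the five coordinates. -/
theorem dressing_lie {M N : Matrix (Fin 2) (Fin 2) ℂ} (hM : M.trace = 0) (hN : N.trace = 0)
    (φ : FunSU2Star) : dressing ⁅M, N⁆ φ =
      dressing N (dressing M φ) - dressing M (dressing N φ) := by
  have e : dressing ⁅M, N⁆ = ⁅dressing N, dressing M⁆ := by
    apply derivation_ext
    intro i
    rw [Derivation.commutator_apply, dressing_gen, dressing_gen, dressing_gen]
    apply toFun_injective
    funext g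
    rw [map_sub, Pi.sub_apply]
    have h₄ := dgen_four_lie M N g hM hN
    fin_cases i
    · change toFun (dgen ⁅M, N⁆ 0) g = toFun (dressing N (dgen M 0)) g -
        toFun (dressing M (dgen N 0)) g
      rw [toFun_dressing_dgen_zero, toFun_dressing_dgen_zero, toFun_dgen_zero, h₄]
      ring
    · change toFun (dgen ⁅M, N⁆ 1) g = toFun (dressing N (dgen M 1)) g -
        toFun (dressing M (dgen N 1)) g
      rw [toFun_dressing_dgen_one, toFun_dressing_dgen_one, toFun_dgen_one, h₄]
      ring
    · exact dgen_two_lie M N g hM hN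
    · exact dgen_three_lie M N g hM hN
    · exact h₄
  rw [e, Derivation.commutator_apply]

end Iwasawa


namespace Iwasawa

open Matrix ComplexConjugate

/-! ### The Iwasawa factorisation and the dressing action of curves -/

/-- The inverse is the adjugate because the determinant is one and the conjugate transpose because
the matrix is unitary; comparing entries gives the shape. -/
theorem SU2.entries (u : SU2) : u.1 1 0 = -conj (u.1 0 1) ∧ u.1 1 1 = conj (u.1 0 0) ∧
    ‖u.1 0 0‖ ^ 2 + ‖u.1 0 1‖ ^ 2 = 1 := by
  have h₁ : (u.1 : Matrix (Fin 2) (Fin 2) ℂ) * star (u.1 : Matrix (Fin 2) (Fin 2) ℂ) = 1 :=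
    Matrix.mem_unitaryGroup_iff.1 u.2
  have h₂ : (u.1⁻¹).1 * u.1.1 = 1 := congrArg Subtype.val (inv_mul_cancel u.1)
  have h₃ : (u.1⁻¹).1 = star u.1.1 := left_inv_eq_right_inv h₂ h₁
  have h₄ : (u.1⁻¹).1 1 1 = u.1 0 0 := by
    simp [Matrix.SpecialLinearGroup.coe_inv, Matrix.adjugate_fin_two]
  have h₅ : (u.1⁻¹).1 1 0 = -u.1 1 0 := by
    simp [Matrix.SpecialLinearGroup.coe_inv, Matrix.adjugate_fin_two]
  rw [h₃] at h₄ h₅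
  refine ⟨?_, ?_, ?_⟩
  · exact (neg_eq_iff_eq_neg.1 h₅.symm)
  · rw [← h₄]; exact (Complex.conj_conj (u.1 1 1)).symm
  · have := congrFun (congrFun h₁ 0) 0
    rw [Matrix.mul_apply, Fin.sum_univ_two] at this
    change u.1 0 0 * conj (u.1 0 0) + u.1 0 1 * conj (u.1 0 1) = 1 at this
    rw [Complex.mul_conj, Complex.mul_conj, Complex.normSq_eq_norm_sq,
      Complex.normSq_eq_norm_sq] at this
    exact_mod_cast this

theorem SL_mul_entry (g h : SpecialLinearGroup (Fin 2) ℂ) (i j : Fin 2) :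
    (g * h) i j = g i 0 * h 0 j + g i 1 * h 1 j := by
  change (g.1 * h.1) i j = _
  rw [Matrix.mul_apply, Fin.sum_univ_two]

theorem firstRow_norm (s : SU2Star) (u : SU2) :
    √(‖(s.1 * u.1) 0 0‖ ^ 2 + ‖(s.1 * u.1) 0 1‖ ^ 2) = (s.1 0 0).re := by
  obtain ⟨-, -, h⟩ := SU2.entries u
  have e : ‖s.1 0 0‖ = (s.1 0 0).re := by
    conv_lhs => rw [entry_zero_zero s]
    rw [Complex.norm_real, Real.norm_of_nonneg s.2.2.2.le]
  rw [SL_mul_entry, SL_mul_entry, entry_zero_one, zero_mul, zero_mul, add_zero, add_zero, norm_mul,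
    norm_mul, mul_pow, mul_pow, ← mul_add, h, mul_one, e, Real.sqrt_sq s.2.2.2.le]

theorem solvablePart_entry (g : SpecialLinearGroup (Fin 2) ℂ) :
    (solvablePart g).1 0 0 = ((√(‖g 0 0‖ ^ 2 + ‖g 0 1‖ ^ 2) : ℝ) : ℂ) ∧
    (solvablePart g).1 1 0 = ((√(‖g 0 0‖ ^ 2 + ‖g 0 1‖ ^ 2) : ℝ) : ℂ)⁻¹ *
      (conj (g 0 0) * g 1 0 + conj (g 0 1) * g 1 1) := ⟨rfl, rfl⟩

/-- `solvablePart` uses only the norm of the first row and the Hermitian product of the two rows,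
and a unitary factor on the right preserves both. Uniqueness of the factorisation follows. -/
theorem solvablePart_mul (s : SU2Star) (u : SU2) : solvablePart (s.1 * u.1) = s := by
  obtain ⟨h₁, h₂, h₃⟩ := SU2.entries u
  have h₃' : u.1 0 0 * conj (u.1 0 0) + u.1 0 1 * conj (u.1 0 1) = 1 := by
    rw [Complex.mul_conj, Complex.mul_conj, Complex.normSq_eq_norm_sq, Complex.normSq_eq_norm_sq]
    exact_mod_cast h₃
  have hw := entry_zero_zero_ne s
  apply SU2Star.ext
  · rw [(solvablePart_entry _).1, firstRow_norm]; exact (entry_zero_zero s).symm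
  · rw [(solvablePart_entry _).2, firstRow_norm, ← entry_zero_zero s, inv_mul_eq_iff_eq_mul₀ hw]
    simp only [SL_mul_entry, entry_zero_one, zero_mul, add_zero, map_mul, conj_entry_zero_zero,
      h₁, h₂]
    linear_combination (s.1 0 0 * s.1 1 0) * h₃'

theorem solvablePart_coe (s : SU2Star) : solvablePart s.1 = s := by
  simpa using solvablePart_mul s 1

/-- This is Gram–Schmidt on the rows: the first is divided by its norm, the second loses its
component along the first, and determinant one fixes what remains. -/
theorem inv_solvablePart_mul_mem (g : SpecialLinearGroup (Fin 2) ℂ) :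
    (solvablePart g).1⁻¹ * g ∈ SU2 := by
  obtain ⟨h₀, h₁⟩ := solvablePart_entry g
  have hW := firstRow_pos g
  have hW2 : (((√(‖g 0 0‖ ^ 2 + ‖g 0 1‖ ^ 2) : ℝ) : ℂ)) ^ 2 =
      g 0 0 * conj (g 0 0) + g 0 1 * conj (g 0 1) := by
    rw [Complex.mul_conj, Complex.mul_conj, Complex.normSq_eq_norm_sq, Complex.normSq_eq_norm_sq]
    rw [← Complex.ofReal_pow, Real.sq_sqrt (by positivity)]
    push_cast; rfl
  generalize √(‖g 0 0‖ ^ 2 + ‖g 0 1‖ ^ 2) = W at *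
  have hW0 : (W : ℂ) ≠ 0 := Complex.ofReal_ne_zero.2 hW.ne'
  have hv : (solvablePart g).1 1 1 = (W : ℂ)⁻¹ := by rw [entry_one_one_eq, h₀]
  have hdet := g.det_coe
  rw [Matrix.det_fin_two] at hdet
  change g 0 0 * g 1 1 - g 0 1 * g 1 0 = 1 at hdet
  obtain ⟨k₀, k₁, k₂⟩ := inv_entry (solvablePart g)
  have k₃ := entry_zero_one (solvablePart g)⁻¹
  change (solvablePart g).1⁻¹ 0 0 = _ at k₀
  change (solvablePart g).1⁻¹ 1 1 = _ at k₁
  change (solvablePart g).1⁻¹ 1 0 = _ at k₂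
  change (solvablePart g).1⁻¹ 0 1 = _ at k₃
  set u := (solvablePart g).1⁻¹ * g with hu
  have e₀₀ : u 0 0 = (W : ℂ)⁻¹ * g 0 0 := by rw [hu, SL_mul_entry, k₀, k₃, hv]; ring
  have e₀₁ : u 0 1 = (W : ℂ)⁻¹ * g 0 1 := by rw [hu, SL_mul_entry, k₀, k₃, hv]; ring
  have e₁₀ : u 1 0 = -((W : ℂ)⁻¹ * conj (g 0 1)) := by
    rw [hu, SL_mul_entry, k₂, k₁, h₀, h₁]
    field_simp
    linear_combination g 1 0 * hW2 - conj (g 0 1) * hdet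
  have e₁₁ : u 1 1 = (W : ℂ)⁻¹ * conj (g 0 0) := by
    rw [hu, SL_mul_entry, k₂, k₁, h₀, h₁]
    field_simp
    linear_combination g 1 1 * hW2 + conj (g 0 0) * hdet
  change u.1 ∈ Matrix.unitaryGroup (Fin 2) ℂ
  rw [Matrix.mem_unitaryGroup_iff]
  ext i j
  rw [Matrix.mul_apply, Fin.sum_univ_two]
  change u i 0 * conj (u j 0) + u i 1 * conj (u j 1) = _
  fin_cases i <;> fin_cases j <;>
    simp only [Fin.zero_eta, Fin.mk_one, e₀₀, e₀₁, e₁₀, e₁₁, map_neg, map_mul, map_inv₀,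
      Complex.conj_ofReal, Complex.conj_conj, Matrix.one_apply_eq, Matrix.one_apply_ne, ne_eq,
      zero_ne_one, one_ne_zero, not_false_eq_true] <;> field_simp <;>
    first | ring1 | linear_combination -hW2

theorem iwasawa (g : SpecialLinearGroup (Fin 2) ℂ) :
    ∃! q : SU2Star × SU2, g = q.1.1 * q.2.1 := by
  refine ⟨(solvablePart g, ⟨_, inv_solvablePart_mul_mem g⟩), ?_, ?_⟩
  · simp
  · rintro ⟨s, u⟩ h
    dsimp only at h
    have hs : s = solvablePart g := by rw [h, solvablePart_mul]
    refine Prod.ext hs (Subtype.ext ?_)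
    change u.1 = (solvablePart g).1⁻¹ * g
    rw [← hs, h, inv_mul_cancel_left]

theorem iwasawa_formulas {g : SpecialLinearGroup (Fin 2) ℂ} {q : SU2Star × SU2}
    (h : g = q.1.1 * q.2.1) : q.1 = solvablePart g ∧
      q.2.1 0 0 = ((√(‖g 0 0‖ ^ 2 + ‖g 0 1‖ ^ 2) : ℝ) : ℂ)⁻¹ * g 0 0 ∧
      q.2.1 0 1 = ((√(‖g 0 0‖ ^ 2 + ‖g 0 1‖ ^ 2) : ℝ) : ℂ)⁻¹ * g 0 1 := by
  subst h
  have hw := entry_zero_zero_ne q.1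
  rw [solvablePart_mul, firstRow_norm, ← entry_zero_zero, SL_mul_entry, SL_mul_entry,
    entry_zero_one]
  refine ⟨rfl, ?_, ?_⟩ <;> field_simp <;> ring

/-- The solvable part is given by formulas in the matrix entries, so only the first-order behaviour
of the curve `m` at `0` matters. This one computation serves the derivative pairing and the dressing
action alike. -/
theorem hasDerivAt_logChart {M : Matrix (Fin 2) (Fin 2) ℂ} (hM : M.trace = 0) (g : SU2Star)
    {m : ℝ → SpecialLinearGroup (Fin 2) ℂ} (h₁ : m 0 = 1) (hm : HasVelocity m M) :
    HasDerivAt (fun s => logChart (solvablePart (m s * g.1))) (velocity M g) 0 := by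
  rw [Matrix.trace_fin_two] at hM
  have hM' : M 1 1 = -M 0 0 := by linear_combination hM
  have hw := entry_zero_zero_ne g
  have hwp := g.2.2.2
  have e₀₀ : HasDerivAt (fun s => (m s * g.1) 0 0) (M 0 0 * g.1 0 0 + M 0 1 * g.1 1 0) 0 := by
    simp only [SL_mul_entry]
    exact ((hm 0 0).mul_const _).add ((hm 0 1).mul_const _)
  have e₀₁ : HasDerivAt (fun s => (m s * g.1) 0 1) (M 0 1 * g.1 1 1) 0 := by
    simp only [SL_mul_entry, entry_zero_one, mul_zero, zero_add]
    exact (hm 0 1).mul_const _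
  have e₁₀ : HasDerivAt (fun s => (m s * g.1) 1 0) (M 1 0 * g.1 0 0 - M 0 0 * g.1 1 0) 0 := by
    simp only [SL_mul_entry]
    exact (((hm 1 0).mul_const (g.1 0 0)).add ((hm 1 1).mul_const (g.1 1 0))).congr_deriv
      (by rw [hM']; ring)
  have e₁₁ : HasDerivAt (fun s => (m s * g.1) 1 1) (-(M 0 0 * g.1 1 1)) 0 := by
    simp only [SL_mul_entry, entry_zero_one, mul_zero, zero_add]
    exact ((hm 1 1).mul_const (g.1 1 1)).congr_deriv (by rw [hM']; ring)
  have z : m 0 * g.1 = g.1 := by rw [h₁, one_mul]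
  have hN := e₀₀.norm_sq.add e₀₁.norm_sq
  have hN0 : ‖g.1 0 0‖ ^ 2 + ‖g.1 0 1‖ ^ 2 = (g.1 0 0).re ^ 2 := by
    rw [entry_zero_one, entry_zero_zero g, Complex.norm_real]
    simp
  have hW0 : √(‖g.1 0 0‖ ^ 2 + ‖g.1 0 1‖ ^ 2) = (g.1 0 0).re := by
    rw [hN0, Real.sqrt_sq hwp.le]
  have hr : (g.1 0 0).im = 0 := g.2.2.1
  have hW : HasDerivAt (fun s => √(‖(m s * g.1) 0 0‖ ^ 2 + ‖(m s * g.1) 0 1‖ ^ 2))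
      (M 0 0 * g.1 0 0 + M 0 1 * g.1 1 0).re 0 := by
    refine (hN.sqrt (by simp only [Pi.add_apply, z, hN0]; positivity)).congr_deriv ?_
    simp only [Pi.add_apply, z]
    rw [hW0]
    simp only [Complex.inner, entry_zero_one, map_zero,
      Complex.zero_re, mul_zero, add_zero, conj_entry_zero_zero]
    rw [Complex.mul_re, hr]
    field_simp
    ring
  have hWpos : (√(‖(m 0 * g.1) 0 0‖ ^ 2 + ‖(m 0 * g.1) 0 1‖ ^ 2)) ≠ 0 := by
    rw [z, hW0]; exact hwp.ne'
  have hZ := (hW.ofReal_comp.fun_inv (Complex.ofReal_ne_zero.2 hWpos)).mul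
    ((e₀₀.star.mul e₁₀).add (e₀₁.star.mul e₁₁))
  have hL := hW.log hWpos
  refine (hL.prodMk hZ).congr_deriv ?_
  -- As `w` is real, dividing by it commutes with taking real parts; this matches the derivative of
  -- `log w` with the first component of `velocity`.
  have hq : ((M 0 0 + M 0 1 * (g.1 1 0 * g.1 1 1)).re : ℂ) =
      ((M 0 0 * g.1 0 0 + M 0 1 * g.1 1 0).re : ℂ) / g.1 0 0 := by
    rw [entry_one_one_eq, eq_div_iff hw]
    have : M 0 0 * g.1 0 0 + M 0 1 * g.1 1 0 =
      (M 0 0 + M 0 1 * (g.1 1 0 * (g.1 0 0)⁻¹)) * g.1 0 0 := by field_simp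
    rw [this, Complex.mul_re, hr, mul_zero, sub_zero, Complex.ofReal_mul, ← entry_zero_zero]
  apply Prod.ext
  · apply Complex.ofReal_injective
    simp only [velocity]
    rw [hq, z, hW0, Complex.ofReal_div, ← entry_zero_zero g]
  · simp only [velocity]
    rw [hq]
    simp only [z, Pi.add_apply, Pi.mul_apply]
    rw [hW0]
    simp only [← entry_zero_zero g, entry_zero_one, entry_one_one_eq, star_zero]
    simp only [← starRingEnd_apply, map_add, map_mul, map_inv₀, conj_entry_zero_zero]
    field_simp
    ring

theorem hasDerivAt_dressing_of_chart {M : Matrix (Fin 2) (Fin 2) ℂ} {g : SU2Star} {s : ℝ}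
    {γ : ℝ → SU2Star} (h₁ : γ s = g)
    (h : HasDerivAt (fun s => logChart (γ s)) (velocity M g) s) (φ : FunSU2Star) :
    HasDerivAt (fun s => toFun φ (γ s)) (toFun (dressing M φ) g) s := by
  have e : (fun s => toFun φ (γ s)) = fun s => inChart φ (logChart (γ s)) := by
    funext s; rw [inChart_logChart]
  rw [e, toFun_dressing, vectorField, ← h₁]
  rw [← h₁] at h
  exact (differentiable_inChart φ _).hasFDerivAt.comp_hasDerivAt s h

theorem hasDerivAt_dressing {M : Matrix (Fin 2) (Fin 2) ℂ} (hM : M.trace = 0) (g : SU2Star)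
    {m : ℝ → SpecialLinearGroup (Fin 2) ℂ} (h₁ : m 0 = 1) (hm : HasVelocity m M)
    (φ : FunSU2Star) : HasDerivAt (fun s => toFun φ (solvablePart (m s * g.1)))
      (toFun (dressing M φ) g) 0 :=
  hasDerivAt_dressing_of_chart (by rw [h₁, one_mul, solvablePart_coe])
    (hasDerivAt_logChart hM g h₁ hm) φ

end Iwasawa


namespace Iwasawa

open Matrix ComplexConjugate

/-! ### The `su₂`-part of `g⁻¹ M g` and its cocycle identities -/

/-- The coefficients of the `su₂`-part of `g⁻¹ M g` in the basis `rotBasis`, as functions of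
`g ∈ SU₂⋆`. -/
def rotCoeff (M : Matrix (Fin 2) (Fin 2) ℂ) : Fin 3 → FunSU2Star :=
  ![(Complex.I * (M 0 1 - conj (M 0 1))) • (gen 1 * gen 1),
    (-(M 0 1 + conj (M 0 1))) • (gen 1 * gen 1),
    Complex.I • ((M 0 0 - conj (M 0 0)) • 1 + M 0 1 • (gen 2 * gen 1) -
      conj (M 0 1) • (gen 3 * gen 1))]

section

variable (M N : Matrix (Fin 2) (Fin 2) ℂ) (g h : SU2Star)

theorem toFun_rotCoeff_zero : toFun (rotCoeff M 0) g =
    Complex.I * (M 0 1 - conj (M 0 1)) * (g.1 1 1 * g.1 1 1) := by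
  simp [rotCoeff, coord]

theorem toFun_rotCoeff_one : toFun (rotCoeff M 1) g =
    -(M 0 1 + conj (M 0 1)) * (g.1 1 1 * g.1 1 1) := by
  have : rotCoeff M 1 = (-(M 0 1 + conj (M 0 1))) • (gen 1 * gen 1) := rfl
  rw [this, map_smul]
  simp [coord]

theorem toFun_rotCoeff_two : toFun (rotCoeff M 2) g = Complex.I * (M 0 0 - conj (M 0 0) +
    M 0 1 * (g.1 1 0 * g.1 1 1) - conj (M 0 1) * (conj (g.1 1 0) * g.1 1 1)) := by
  simp [rotCoeff, coord]

theorem toFun_dressing_rotCoeff_zero : toFun (dressing N (rotCoeff M 0)) g =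
    Complex.I * (M 0 1 - conj (M 0 1)) * (2 * g.1 1 1 * toFun (dgen N 1) g) := by
  have : rotCoeff M 0 = (Complex.I * (M 0 1 - conj (M 0 1))) • (gen 1 * gen 1) := rfl
  rw [this, Derivation.map_smul, Derivation.leibniz, dressing_gen]
  simp [coord]
  ring

theorem toFun_dressing_rotCoeff_one : toFun (dressing N (rotCoeff M 1)) g =
    -(M 0 1 + conj (M 0 1)) * (2 * g.1 1 1 * toFun (dgen N 1) g) := by
  have : rotCoeff M 1 = (-(M 0 1 + conj (M 0 1))) • (gen 1 * gen 1) := rfl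
  rw [this, Derivation.map_smul, Derivation.leibniz, dressing_gen, map_smul]
  simp only [smul_eq_mul, map_add, map_mul, toFun_gen, Pi.smul_apply, Pi.add_apply, Pi.mul_apply]
  simp only [coord, Matrix.cons_val]
  ring

theorem toFun_dressing_rotCoeff_two : toFun (dressing N (rotCoeff M 2)) g = Complex.I *
    (M 0 1 * (g.1 1 0 * toFun (dgen N 1) g + g.1 1 1 * toFun (dgen N 2) g) -
      conj (M 0 1) * (conj (g.1 1 0) * toFun (dgen N 1) g + g.1 1 1 * toFun (dgen N 3) g)) := by
  have : rotCoeff M 2 = Complex.I • ((M 0 0 - conj (M 0 0)) • 1 + M 0 1 • (gen 2 * gen 1) -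
      conj (M 0 1) • (gen 3 * gen 1)) := rfl
  rw [this]
  simp only [Derivation.map_smul, map_add, map_sub, Derivation.leibniz, dressing_gen,
    Derivation.map_one_eq_zero, smul_zero, zero_add, smul_eq_mul]
  simp [coord]
  ring

theorem toFun_injective_iff {φ ψ : FunSU2Star} : φ = ψ ↔ ∀ g, toFun φ g = toFun ψ g :=
  ⟨fun h g => by rw [h], fun h => toFun_injective (funext h)⟩

-- Write `g⁻¹ M g = s_M + r_M` with `s_M` in `su₂⋆` and `r_M` in `su₂`. Along the field of `N` one
-- has `g⁻¹ g' = s_N`, so `r_M` has derivative the `su₂`-part of `[g⁻¹ M g, s_N]`, which is that of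
-- `[r_M, s_N]`. Expanding `[s_M + r_M, s_N + r_N]` gives `r_{[M,N]}` as the two derivative terms
-- plus `[r_M, r_N]`. In the basis `rotBasis` the last bracket is the cross product, whose
-- components appear in this lemma and the next two.
variable {M N} in
theorem rotCoeff_lie_zero (hM : M.trace = 0) (hN : N.trace = 0) : rotCoeff ⁅M, N⁆ 0 =
    dressing N (rotCoeff M 0) - dressing M (rotCoeff N 0) +
      (rotCoeff M 1 * rotCoeff N 2 - rotCoeff M 2 * rotCoeff N 1) := by
  obtain ⟨h₀₀, h₀₁, h₁₀⟩ := lie_entries hM hN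
  rw [toFun_injective_iff]
  intro g
  simp only [map_add, map_sub, map_mul, Pi.add_apply, Pi.sub_apply, Pi.mul_apply,
    toFun_dressing_rotCoeff_zero, toFun_rotCoeff_zero, toFun_rotCoeff_one, toFun_rotCoeff_two,
    toFun_dgen_one, toFun_dgen_four, h₀₁, map_ofNat]
  ring

variable {M N} in
theorem rotCoeff_lie_one (hM : M.trace = 0) (hN : N.trace = 0) : rotCoeff ⁅M, N⁆ 1 =
    dressing N (rotCoeff M 1) - dressing M (rotCoeff N 1) +
      (rotCoeff M 2 * rotCoeff N 0 - rotCoeff M 0 * rotCoeff N 2) := by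
  obtain ⟨h₀₀, h₀₁, h₁₀⟩ := lie_entries hM hN
  rw [toFun_injective_iff]
  intro g
  simp only [map_add, map_sub, map_mul, Pi.add_apply, Pi.sub_apply, Pi.mul_apply,
    toFun_dressing_rotCoeff_one, toFun_rotCoeff_zero, toFun_rotCoeff_one, toFun_rotCoeff_two,
    toFun_dgen_one, toFun_dgen_four, h₀₁, map_ofNat]
  -- Both factors of the cross product carry `i` for this component only, so `i² = -1` is needed
  -- here.
  linear_combination (g.1 1 1 ^ 2 * ((M 0 0 - conj (M 0 0) +
    M 0 1 * (g.1 1 0 * g.1 1 1) - conj (M 0 1) * (conj (g.1 1 0) * g.1 1 1)) *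
    (N 0 1 - conj (N 0 1)) - (N 0 0 - conj (N 0 0) +
    N 0 1 * (g.1 1 0 * g.1 1 1) - conj (N 0 1) * (conj (g.1 1 0) * g.1 1 1)) *
    (M 0 1 - conj (M 0 1)))) * (-1) * Complex.I_sq

variable {M N} in
theorem rotCoeff_lie_two (hM : M.trace = 0) (hN : N.trace = 0) : rotCoeff ⁅M, N⁆ 2 =
    dressing N (rotCoeff M 2) - dressing M (rotCoeff N 2) +
      (rotCoeff M 0 * rotCoeff N 1 - rotCoeff M 1 * rotCoeff N 0) := by
  obtain ⟨h₀₀, h₀₁, h₁₀⟩ := lie_entries hM hN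
  rw [toFun_injective_iff]
  intro g
  have hw := entry_zero_zero_ne g
  simp only [map_add, map_sub, map_mul, Pi.add_apply, Pi.sub_apply, Pi.mul_apply,
    toFun_dressing_rotCoeff_two, toFun_rotCoeff_zero, toFun_rotCoeff_one, toFun_rotCoeff_two,
    toFun_dgen_one, toFun_dgen_two, toFun_dgen_three, toFun_dgen_four, h₀₁, h₀₀, map_ofNat,
    entry_one_one_eq]
  field_simp
  ring

end

theorem rotBasis_entries :
    ((rotBasis 0).1 0 0 = 0 ∧ (rotBasis 0).1 0 1 = -(Complex.I / 2) ∧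
      (rotBasis 0).1 1 0 = -(Complex.I / 2)) ∧
    ((rotBasis 1).1 0 0 = 0 ∧ (rotBasis 1).1 0 1 = -(1 / 2) ∧ (rotBasis 1).1 1 0 = 1 / 2) ∧
    ((rotBasis 2).1 0 0 = -(Complex.I / 2) ∧ (rotBasis 2).1 0 1 = 0 ∧
      (rotBasis 2).1 1 0 = 0) :=
  ⟨⟨rfl, rfl, rfl⟩, ⟨rfl, rfl, rfl⟩, ⟨rfl, rfl, rfl⟩⟩

/-! #### Derivations of tensor products -/

section

variable {A B : Type*} [CommRing A] [Algebra ℂ A] [Ring B] [Algebra ℂ B]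

theorem rTensor_leibniz (D : Derivation ℂ A A) (x y : A ⊗[ℂ] B) :
    LinearMap.rTensor B (D : A →ₗ[ℂ] A) (x * y) = x * LinearMap.rTensor B (D : A →ₗ[ℂ] A) y +
      LinearMap.rTensor B (D : A →ₗ[ℂ] A) x * y := by
  induction x with
  | zero => simp
  | add x₁ x₂ h₁ h₂ => simp only [add_mul, map_add, h₁, h₂]; abel
  | tmul a b =>
    induction y with
    | zero => simp
    | add y₁ y₂ h₁ h₂ => simp only [mul_add, map_add, h₁, h₂]; abel
    | tmul c d =>
      simp [TensorProduct.add_tmul, mul_comm]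

theorem lTensor_leibniz (D : Derivation ℂ A A) (x y : A ⊗[ℂ] A) :
    LinearMap.lTensor A (D : A →ₗ[ℂ] A) (x * y) = x * LinearMap.lTensor A (D : A →ₗ[ℂ] A) y +
      LinearMap.lTensor A (D : A →ₗ[ℂ] A) x * y := by
  induction x with
  | zero => simp
  | add x₁ x₂ h₁ h₂ => simp only [add_mul, map_add, h₁, h₂]; abel
  | tmul a b =>
    induction y with
    | zero => simp
    | add y₁ y₂ h₁ h₂ => simp only [mul_add, map_add, h₁, h₂]; abel
    | tmul c d =>
      simp [TensorProduct.tmul_add, mul_comm]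

end

/-! #### Compatibility with the Hopf algebra structure -/

theorem comul_fun_eq (φ : FunSU2Star) : Coalgebra.comul (R := ℂ) φ = comulHom φ := rfl

theorem counit_fun_eq (φ : FunSU2Star) : Coalgebra.counit (R := ℂ) φ = toFun φ 1 := rfl

theorem entry_conj_mul (g h : SU2Star) : conj ((g * h).1 1 0) =
    conj (g.1 1 0) * h.1 0 0 + g.1 1 1 * conj (h.1 1 0) := by
  rw [mul_entry, map_add, map_mul, map_mul, conj_entry_zero_zero, entry_one_one]

theorem comulHom_gen (i : Fin 5) : comulHom (gen i) =
    (![gen 0 ⊗ₜ gen 0, gen 1 ⊗ₜ gen 1, gen 2 ⊗ₜ gen 0 + gen 1 ⊗ₜ gen 2,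
      gen 3 ⊗ₜ gen 0 + gen 1 ⊗ₜ gen 3, gen 4 ⊗ₜ 1 + 1 ⊗ₜ gen 4] :
      Fin 5 → FunSU2Star ⊗[ℂ] FunSU2Star) i := by
  apply eval₂_injective
  funext ⟨g, h⟩
  rw [eval₂_comulHom]
  fin_cases i
  · simp [coord, SL_mul_entry, entry_zero_one]
  · simp [coord, SL_mul_entry, entry_zero_one]
  · simp [coord, SL_mul_entry]
  · simp [coord]
    exact (entry_conj_mul g h)
  · have e : ((g * h).1 0 0).re = (g.1 0 0).re * (h.1 0 0).re := by
      rw [mul_entry, entry_zero_one, zero_mul, add_zero, Complex.mul_re, g.2.2.1]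
      ring
    have := Real.log_mul g.2.2.2.ne' h.2.2.2.ne'
    simp only [toFun_gen]
    change (Real.log ((g * h).1 0 0).re : ℂ) = _
    rw [e, this]
    simp [coord]

/-- The coproduct of a function moved by a vector field. -/
theorem comulHom_dressing (M : Matrix (Fin 2) (Fin 2) ℂ) (φ : FunSU2Star) :
    comulHom (dressing M φ) =
      LinearMap.rTensor FunSU2Star (dressing M : FunSU2Star →ₗ[ℂ] FunSU2Star) (comulHom φ) +
      ∑ k, (rotCoeff M k ⊗ₜ 1) * LinearMap.lTensor FunSU2Star
        (dressing (rotBasis k).1 : FunSU2Star →ₗ[ℂ] FunSU2Star) (comulHom φ) := by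
  -- To first order `m g h = g' k h` with `k` in `SU₂` of velocity `rotElt M` at `g`: the field acts
  -- on `g` directly and on `h` through `k`. Both sides obey the Leibniz rule over the coproduct,
  -- which leaves the five coordinates to compute.
  induction φ using coordRing_induction with
  | halg c =>
    rw [Derivation.map_algebraMap, map_zero, AlgHom.commutes, Algebra.algebraMap_eq_smul_one,
      Algebra.TensorProduct.one_def]
    simp
  | hadd f g hf hg =>
    simp only [map_add, hf, hg, mul_add, Finset.sum_add_distrib]
    abel
  | hmul f g hf hg =>
    simp only [Derivation.leibniz, map_add, smul_eq_mul, map_mul, hf, hg, rTensor_leibniz,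
      lTensor_leibniz, mul_add, Finset.sum_add_distrib, Finset.mul_sum]
    simp only [mul_comm, mul_left_comm]
    abel
  | hgen i =>
    obtain ⟨⟨a₀, a₁, a₂⟩, ⟨b₀, b₁, b₂⟩, ⟨c₀, c₁, c₂⟩⟩ := rotBasis_entries
    apply eval₂_injective
    funext ⟨g, h⟩
    have hw := entry_zero_zero_ne g
    have hw' := entry_zero_zero_ne h
    have e₀ : (g * h).1 0 0 = g.1 0 0 * h.1 0 0 := by
      rw [mul_entry, entry_zero_one]; ring
    have e₁ : (g * h).1 1 0 = g.1 1 0 * h.1 0 0 + g.1 1 1 * h.1 1 0 := mul_entry _ _ _ _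
    have e₃ : (g * h).1 1 1 = g.1 1 1 * h.1 1 1 := by
      rw [mul_entry, entry_zero_one]; ring
    rw [eval₂_comulHom, dressing_gen]
    have d₀ := comulHom_gen 0
    have d₁ := comulHom_gen 1
    have d₂ := comulHom_gen 2
    have d₃ := comulHom_gen 3
    have d₄ := comulHom_gen 4
    simp only [Matrix.cons_val] at d₀ d₁ d₂ d₃ d₄
    fin_cases i <;> simp only [Fin.zero_eta, Fin.mk_one, Fin.reduceFinMk, d₀, d₁, d₂, d₃, d₄] <;>
      simp only [map_add, Fin.sum_univ_three, LinearMap.rTensor_tmul, LinearMap.lTensor_tmul,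
        mul_add, Algebra.TensorProduct.tmul_mul_tmul, one_mul, Pi.add_apply, eval₂_tmul,
        Derivation.coeFn_coe, dressing_gen, Derivation.map_one_eq_zero, map_zero, Pi.zero_apply,
        mul_zero, zero_mul, add_zero, zero_add, map_mul, Pi.mul_apply, map_one, Pi.one_apply,
        mul_one, toFun_gen]
    all_goals
      simp only [toFun_dgen_zero, toFun_dgen_one, toFun_dgen_two, toFun_dgen_three,
        toFun_dgen_four, toFun_rotCoeff_zero, toFun_rotCoeff_one, toFun_rotCoeff_two,
        a₀, a₁, a₂, b₀, b₁, b₂, c₀, c₁, c₂, coord, Matrix.cons_val, e₀, e₁, e₃,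
        entry_one_one_eq, map_neg, map_div₀, Complex.conj_I, map_zero, map_one, map_ofNat,
        map_add, map_mul, map_inv₀, conj_entry_zero_zero]
      field_simp
      ring_nf
      simp only [Complex.I_sq]
      ring_nf

/-- The coefficients `rotCoeff` form a corepresentation. -/
theorem comulHom_rotCoeff (M : Matrix (Fin 2) (Fin 2) ℂ) (l : Fin 3) :
    comulHom (rotCoeff M l) = ∑ k, rotCoeff M k ⊗ₜ rotCoeff (rotBasis k).1 l := by
  -- Conjugating by `g h` means conjugating by `g` and then by `h`. The `su₂⋆`-part of `g⁻¹ M g`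
  -- stays in `su₂⋆` under `h`, so only its `su₂`-part contributes.
  obtain ⟨⟨a₀, a₁, a₂⟩, ⟨b₀, b₁, b₂⟩, ⟨c₀, c₁, c₂⟩⟩ := rotBasis_entries
  apply eval₂_injective
  funext ⟨g, h⟩
  have hw := entry_zero_zero_ne g
  have hw' := entry_zero_zero_ne h
  have e₀ : (g * h).1 0 0 = g.1 0 0 * h.1 0 0 := by
    rw [mul_entry, entry_zero_one]; ring
  have e₁ : (g * h).1 1 0 = g.1 1 0 * h.1 0 0 + g.1 1 1 * h.1 1 0 := mul_entry _ _ _ _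
  rw [eval₂_comulHom]
  simp only [Fin.sum_univ_three, map_add, Pi.add_apply, eval₂_tmul]
  fin_cases l <;> simp only [Fin.zero_eta, Fin.mk_one, Fin.reduceFinMk] <;>
    simp only [toFun_rotCoeff_zero, toFun_rotCoeff_one, toFun_rotCoeff_two,
        a₀, a₁, b₀, b₁, c₀, c₁, e₀, e₁, entry_one_one_eq, map_neg, map_div₀, Complex.conj_I,
        map_zero, map_one, map_ofNat, map_add, map_mul, map_inv₀, conj_entry_zero_zero] <;>
    field_simp <;> ring_nf <;> simp only [Complex.I_sq] <;> ring_nf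

theorem antipodeHom_gen (i : Fin 5) : antipodeHom (gen i) =
    (![gen 1, gen 0, -gen 2, -gen 3, -gen 4] : Fin 5 → FunSU2Star) i := by
  rw [toFun_injective_iff]
  intro g
  obtain ⟨h₀, h₁, h₂⟩ := inv_entry g
  rw [toFun_antipodeHom]
  fin_cases i
  · exact h₀
  · exact h₁
  · exact h₂
  · change conj ((g⁻¹).1 1 0) = -conj (g.1 1 0)
    rw [h₂, map_neg]
  · simp only [toFun_gen]
    change (Real.log ((g⁻¹).1 0 0).re : ℂ) = -(Real.log (g.1 0 0).re : ℂ)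
    rw [h₀, entry_one_one_eq, entry_zero_zero, ← Complex.ofReal_inv, Complex.ofReal_re,
      Complex.ofReal_re, Real.log_inv, Complex.ofReal_neg]

/-- The antipode of a function moved by a vector field of `su₂`. -/
theorem antipodeHom_dressing (Y : su2) (φ : FunSU2Star) : antipodeHom (dressing Y.1 φ) =
    ∑ k, antipodeHom (rotCoeff Y.1 k) * dressing (rotBasis k).1 (antipodeHom φ) := by
  -- If `u g⁻¹ = g'⁻¹ k` with `u`, `k` in `SU₂`, then `k g = g' u`. So moving `g⁻¹` by `u` and
  -- inverting is moving `g` by `k`, whose velocity is `rotElt Y` at `g⁻¹`; this needs `u` unitary,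
  -- hence `Y` in `su₂`.
  induction φ using coordRing_induction with
  | halg c => simp
  | hadd f g hf hg => simp only [map_add, hf, hg, mul_add, Finset.sum_add_distrib]
  | hmul f g hf hg =>
    simp only [Derivation.leibniz, map_add, smul_eq_mul, map_mul, hf, hg, mul_add,
      Finset.sum_add_distrib, Finset.mul_sum]
    simp only [mul_left_comm]
  | hgen i =>
    obtain ⟨⟨a₀, a₁, a₂⟩, ⟨b₀, b₁, b₂⟩, ⟨c₀, c₁, c₂⟩⟩ := rotBasis_entries
    obtain ⟨ht, hs⟩ := Y.2
    have y₀ : conj (Y.1 0 0) = -Y.1 0 0 := congrFun (congrFun hs 0) 0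
    have y₁ : Y.1 1 0 = -conj (Y.1 0 1) := by
      have : conj (Y.1 0 1) = -Y.1 1 0 := congrFun (congrFun hs 1) 0
      rw [this, neg_neg]
    rw [toFun_injective_iff]
    intro g
    have hw := entry_zero_zero_ne g
    obtain ⟨h₀, h₁, h₂⟩ := inv_entry g
    have d₀ := antipodeHom_gen 0
    have d₁ := antipodeHom_gen 1
    have d₂ := antipodeHom_gen 2
    have d₃ := antipodeHom_gen 3
    have d₄ := antipodeHom_gen 4
    simp only [Matrix.cons_val] at d₀ d₁ d₂ d₃ d₄
    rw [toFun_antipodeHom, dressing_gen]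
    simp only [Fin.sum_univ_three, map_add, map_mul, Pi.add_apply, Pi.mul_apply,
      toFun_antipodeHom]
    fin_cases i <;> simp only [Fin.zero_eta, Fin.mk_one, Fin.reduceFinMk, d₀, d₁, d₂, d₃, d₄]
    all_goals
      simp only [map_neg, Pi.neg_apply, dressing_gen]
      simp only [toFun_dgen_zero, toFun_dgen_one, toFun_dgen_two, toFun_dgen_three,
        toFun_dgen_four, toFun_rotCoeff_zero, toFun_rotCoeff_one, toFun_rotCoeff_two,
        a₀, a₁, a₂, b₀, b₁, b₂, c₀, c₁, c₂, h₀, h₁, h₂, y₀, y₁,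
        entry_one_one_eq, map_neg, map_div₀, Complex.conj_I, map_zero, map_one, map_ofNat,
        Complex.conj_conj]
      field_simp
      ring_nf
      simp only [Complex.I_sq]
      ring_nf

end Iwasawa


/-! ### Pairings of bialgebras and antipodes. -/

namespace Semidual

open WithConv

variable {k A H : Type*} [CommRing k] [Ring A] [HopfAlgebra k A] [Ring H] [HopfAlgebra k H]

/-- A dual pairing of bialgebras between Hopf algebras is compatible with the antipodes. -/
theorem pairing_antipode {p : A →ₗ[k] H →ₗ[k] k}
    (mul_left : ∀ (φ ψ : A) (h : H), p (φ * ψ) h =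
      LinearMap.mul' k k (TensorProduct.map (p φ) (p ψ) (Coalgebra.comul (R := k) h)))
    (one_left : ∀ h : H, p 1 h = Coalgebra.counit (R := k) h)
    (mul_right : ∀ (φ : A) (h g : H), p φ (h * g) =
      LinearMap.mul' k k (TensorProduct.map (p.flip h) (p.flip g) (Coalgebra.comul (R := k) φ)))
    (one_right : ∀ φ : A, p φ 1 = Coalgebra.counit (R := k) φ) (φ : A) (h : H) :
    p (HopfAlgebra.antipode k φ) h = p φ (HopfAlgebra.antipode k h) := by
  -- In the convolution algebra of functionals on `A ⊗ H`, inserting the antipode on the `A`-side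
  -- gives a left inverse `F` of the pairing `Q`, and inserting it on the `H`-side gives a right
  -- inverse `G`. The two inverses coincide.
  let F : WithConv (A ⊗[k] H →ₗ[k] k) := toConv (TensorProduct.lift (p ∘ₗ HopfAlgebra.antipode k))
  let Q : WithConv (A ⊗[k] H →ₗ[k] k) := toConv (TensorProduct.lift p)
  let G : WithConv (A ⊗[k] H →ₗ[k] k) := toConv (TensorProduct.lift (p.compl₂ (HopfAlgebra.antipode k)))
  have hFQ : F * Q = 1 := by
    apply ofConv_injective
    apply TensorProduct.ext'
    intro φ h
    have h₁ := congrArg (p.flip h)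
      (HopfAlgebra.mul_antipode_rTensor_comul_apply (R := k) φ)
    have h₂ : (1 : WithConv (A ⊗[k] H →ₗ[k] k)).ofConv (φ ⊗ₜ h) =
        p (algebraMap k A (Coalgebra.counit (R := k) φ)) h := by
      rw [Algebra.algebraMap_eq_smul_one, map_smul, LinearMap.smul_apply, one_left,
        LinearMap.convOne_def]
      simp [mul_comm]
    rw [h₂]
    refine Eq.trans ?_ h₁
    change LinearMap.mul' k k (TensorProduct.map F.ofConv Q.ofConv (Coalgebra.comul (φ ⊗ₜ h))) = _
    rw [TensorProduct.comul_tmul]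
    generalize Coalgebra.comul (R := k) φ = T
    induction T with
    | zero => simp
    | add T₁ T₂ h₁ h₂ => simp only [map_add, TensorProduct.add_tmul, h₁, h₂]
    | tmul φ ψ =>
      rw [LinearMap.rTensor_tmul, LinearMap.mul'_apply, LinearMap.flip_apply, mul_left]
      generalize Coalgebra.comul (R := k) h = S
      induction S with
      | zero => simp
      | add T₁ T₂ h₁ h₂ => simp only [map_add, TensorProduct.tmul_add, h₁, h₂]
      | tmul h g =>
        rw [TensorProduct.AlgebraTensorModule.tensorTensorTensorComm_tmul]
        rfl
  have hQG : Q * G = 1 := by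
    apply ofConv_injective
    apply TensorProduct.ext'
    intro φ h
    have h₁ := congrArg (p φ) (HopfAlgebra.mul_antipode_lTensor_comul_apply (R := k) h)
    have h₂ : (1 : WithConv (A ⊗[k] H →ₗ[k] k)).ofConv (φ ⊗ₜ h) =
        p φ (algebraMap k H (Coalgebra.counit (R := k) h)) := by
      rw [Algebra.algebraMap_eq_smul_one, map_smul, one_right, LinearMap.convOne_def]
      simp
    rw [h₂]
    refine Eq.trans ?_ h₁
    change LinearMap.mul' k k (TensorProduct.map Q.ofConv G.ofConv (Coalgebra.comul (φ ⊗ₜ h))) = _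
    rw [TensorProduct.comul_tmul]
    generalize Coalgebra.comul (R := k) h = S
    induction S with
    | zero => simp
    | add T₁ T₂ h₁ h₂ => simp only [map_add, TensorProduct.tmul_add, h₁, h₂]
    | tmul h g =>
      rw [LinearMap.lTensor_tmul, LinearMap.mul'_apply, mul_right]
      generalize Coalgebra.comul (R := k) φ = T
      induction T with
      | zero => simp
      | add T₁ T₂ h₁ h₂ => simp only [map_add, TensorProduct.add_tmul, h₁, h₂]
      | tmul φ ψ =>
        rw [TensorProduct.AlgebraTensorModule.tensorTensorTensorComm_tmul]
        rfl
  have h₀ : F = G := left_inv_eq_right_inv hFQ hQG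
  exact congrArg (fun f => f.ofConv (φ ⊗ₜ h)) h₀

end Semidual

namespace Iwasawa

open Matrix ComplexConjugate

/-! ### The pairing of `ℂ[SU₂⋆]` with `U(su₂⋆)` -/

/-- The dressing action of `sl₂` on `ℂ[SU₂⋆]`. -/
def dressingSl2 : DerAction sl2 FunSU2Star where
  D M := dressing M.1
  D_add M N φ := dressing_add M.1 N.1 φ
  D_smul r M φ := dressing_smul r M.1 φ
  D_lie M N φ := dressing_lie M.2 N.2 φ

/-- The dressing action of `su₂` on `ℂ[SU₂⋆]`. -/
def dressingSU2 : DerAction su2 FunSU2Star where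
  D M := dressing M.1
  D_add M N φ := dressing_add M.1 N.1 φ
  D_smul r M φ := dressing_smul r M.1 φ
  D_lie M N φ := dressing_lie M.2.1 N.2.1 φ

/-- The action of `su₂⋆` on `ℂ[SU₂⋆]` by left translation. -/
def dressingStar : DerAction su2Star FunSU2Star where
  D M := dressing M.1
  D_add M N φ := dressing_add M.1 N.1 φ
  D_smul r M φ := dressing_smul r M.1 φ
  D_lie M N φ := dressing_lie M.2.1 N.2.1 φ

theorem inclSU2Star_toEnv (X : su2Star) :
    inclSU2Star (toEnv 1 X) = toEnv 1 (LieSubalgebra.inclusion su2Star_le X) :=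
  map_complexify_toEnv _ _ _

theorem inclSU2_toEnv (X : su2) :
    inclSU2 (toEnv 1 X) = toEnv 1 (LieSubalgebra.inclusion su2_le X) :=
  map_complexify_toEnv _ _ _

theorem dressingSl2_act_inclSU2Star (φ : FunSU2Star) (h : Env su2Star) :
    dressingSl2.act φ (inclSU2Star h) = dressingStar.act φ h := by
  induction h using env_induction_right with
  | one => rw [map_one, DerAction.act_one, DerAction.act_one]
  | add u v hu hv => simp only [map_add, hu, hv]
  | smul c u hu => simp only [map_smul, hu]
  | mul u X hu =>
    rw [map_mul, DerAction.act_mul, hu, inclSU2Star_toEnv, DerAction.act_mul, DerAction.act_toEnv,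
      DerAction.act_toEnv]
    rfl

theorem dressingSl2_act_inclSU2 (φ : FunSU2Star) (h : Env su2) :
    dressingSl2.act φ (inclSU2 h) = dressingSU2.act φ h := by
  induction h using env_induction_right with
  | one => rw [map_one, DerAction.act_one, DerAction.act_one]
  | add u v hu hv => simp only [map_add, hu, hv]
  | smul c u hu => simp only [map_smul, hu]
  | mul u X hu =>
    rw [map_mul, DerAction.act_mul, hu, inclSU2_toEnv, DerAction.act_mul, DerAction.act_toEnv,
      DerAction.act_toEnv]
    rfl

/-- The pairing of `ℂ[SU₂⋆]` with `U(su₂⋆)`: differentiation at the identity. -/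
def pairing : FunSU2Star →ₗ[ℂ] Env su2Star →ₗ[ℂ] ℂ :=
  dressingStar.act.compr₂ (Coalgebra.counit (R := ℂ))

theorem pairing_apply (φ : FunSU2Star) (h : Env su2Star) :
    pairing φ h = Coalgebra.counit (R := ℂ) (dressingStar.act φ h) := rfl

theorem pairing_mul (φ : FunSU2Star) (h g : Env su2Star) :
    pairing φ (h * g) = pairing (dressingStar.act φ h) g := by
  rw [pairing_apply, DerAction.act_mul, pairing_apply]

theorem pairing_one_right (φ : FunSU2Star) : pairing φ 1 = Coalgebra.counit (R := ℂ) φ := by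
  rw [pairing_apply, DerAction.act_one]

theorem pairing_one_left (h : Env su2Star) : pairing 1 h = Coalgebra.counit (R := ℂ) h := by
  rw [pairing_apply, DerAction.one_act, map_smul, Bialgebra.counit_one, smul_eq_mul, mul_one]

theorem pairing_mul_left (φ ψ : FunSU2Star) (h : Env su2Star) : pairing (φ * ψ) h =
    LinearMap.mul' ℂ ℂ (TensorProduct.map (pairing φ) (pairing ψ) (Coalgebra.comul (R := ℂ) h)) := by
  rw [pairing_apply, DerAction.mul_act]
  generalize Coalgebra.comul (R := ℂ) h = T
  induction T with
  | zero => simp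
  | add T₁ T₂ h₁ h₂ => simp only [map_add, h₁, h₂]
  | tmul u v => simp [pairing_apply]

theorem rotCoeff_of_su2Star (X : su2Star) (k : Fin 3) : rotCoeff X.1 k = 0 := by
  have h₀ : conj (X.1 0 0) = X.1 0 0 := Complex.conj_eq_iff_im.2 X.2.2.2
  fin_cases k <;> simp [rotCoeff, X.2.2.1, h₀]

/-- Left translation by `SU₂⋆` needs no unitary correction, so the field moves only the first
argument of `φ(g h)`. -/
theorem comulHom_dressing_su2Star (X : su2Star) (φ : FunSU2Star) : comulHom (dressing X.1 φ) =
    LinearMap.rTensor _ (dressing X.1 : FunSU2Star →ₗ[ℂ] FunSU2Star) (comulHom φ) := by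
  rw [comulHom_dressing]
  simp [rotCoeff_of_su2Star]

/-- Left translations touch only the first leg of the coproduct, so acting by `h` evaluates that leg
against `h`. The leftmost factor acts first, whence the induction from the left with `φ` varying. -/
theorem dressingStar_act_eq (φ : FunSU2Star) (h : Env su2Star) : dressingStar.act φ h =
    TensorProduct.lid ℂ FunSU2Star (LinearMap.rTensor FunSU2Star (pairing.flip h)
      (Coalgebra.comul (R := ℂ) φ)) := by
  induction h using env_induction_left generalizing φ with
  | one =>
    have : pairing.flip 1 = Coalgebra.counit (R := ℂ) := LinearMap.ext pairing_one_right
    rw [this, Coalgebra.rTensor_counit_comul]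
    simp
  | add u v hu hv => simp only [map_add, LinearMap.rTensor_add, LinearMap.add_apply, hu, hv]
  | smul c u hu => simp only [map_smul, LinearMap.rTensor_smul, LinearMap.smul_apply, hu]
  | mul u X hu =>
    rw [DerAction.act_mul, hu, DerAction.act_toEnv]
    change TensorProduct.lid ℂ FunSU2Star (LinearMap.rTensor FunSU2Star (pairing.flip u)
      (comulHom (dressing X.1 φ))) = _
    rw [comulHom_dressing_su2Star, ← LinearMap.comp_apply (LinearMap.rTensor _ _),
      ← LinearMap.rTensor_comp]
    congr 3
    apply LinearMap.ext
    intro ψ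
    simp only [LinearMap.comp_apply, LinearMap.flip_apply, pairing_mul, DerAction.act_toEnv]
    rfl

theorem pairing_mul_right (φ : FunSU2Star) (h g : Env su2Star) : pairing φ (h * g) =
    LinearMap.mul' ℂ ℂ (TensorProduct.map (pairing.flip h) (pairing.flip g)
      (Coalgebra.comul (R := ℂ) φ)) := by
  rw [pairing_mul, dressingStar_act_eq]
  generalize Coalgebra.comul (R := ℂ) φ = T
  induction T with
  | zero => simp
  | add T₁ T₂ h₁ h₂ => simp only [map_add, LinearMap.add_apply, h₁, h₂]
  | tmul u v => simp

theorem isDerivativePairing : IsDerivativePairing pairing := by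
  intro φ X γ h₀ hγ
  have := hasDerivAt_dressing X.2.1 1 (m := fun t => (γ t).1) (by rw [h₀]; rfl) hγ φ
  refine (this.congr_of_eventuallyEq (.of_forall fun t => ?_)).congr_deriv ?_
  · change _ = toFun φ (solvablePart ((γ t).1 * (1 : SU2Star).1))
    have : (1 : SU2Star).1 = 1 := rfl
    rw [this, mul_one, solvablePart_coe]
  · rw [pairing_apply, DerAction.act_toEnv]; rfl

theorem isDressingAction : IsDressingAction dressingSU2.act := by
  intro φ Y g u h₀ hu
  rw [DerAction.act_toEnv]
  exact hasDerivAt_dressing Y.2.1 g (m := fun t => (u t).1) (by rw [h₀]; rfl) hu φ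

theorem velocity_su2Star (X : su2Star) (g : SU2Star) : velocity X.1 g =
    ((X.1 0 0).re, g.1 0 0 * X.1 1 0 - X.1 0 0 * g.1 1 0) := by
  have h₀ : X.1 0 0 = ((X.1 0 0).re : ℂ) := Complex.ext rfl (by simpa using X.2.2.2)
  simp only [velocity, X.2.2.1, zero_mul, add_zero, map_zero]
  rw [← h₀, Complex.conj_eq_iff_im.2 X.2.2.2]
  ext1
  · rfl
  · simp

theorem logChart_expChart (q : ℝ × ℂ) : logChart (expChart q) = q := by
  have : Real.log ((Real.exp q.1 : ℝ) : ℂ).re = q.1 := by rw [Complex.ofReal_re, Real.log_exp]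
  exact Prod.ext this rfl

/-- The element `!![a, 0; c, -a]` of `su₂⋆`. -/
def su2Star.mk (a : ℝ) (c : ℂ) : su2Star :=
  ⟨!![(a : ℂ), 0; c, -(a : ℂ)], by simp [Matrix.trace_fin_two], by simp, by simp⟩

/-- Every element of `SU₂⋆` lies on an analytic one-parameter subgroup. -/
theorem exists_oneParameter (g : SU2Star) : ∃ (X : su2Star) (a : ℝ) (r : ℝ → ℝ) (z : ℂ),
    (∀ s, AnalyticAt ℝ r s) ∧ r 0 = 0 ∧ expChart (1 * a, z * r 1) = g ∧
    ∀ s, HasDerivAt (fun s => ((s * a, z * r s) : ℝ × ℂ))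
      (velocity X.1 (expChart (s * a, z * r s))) s := by
  set a := Real.log (g.1 0 0).re with ha
  have hd : ∀ s, HasDerivAt (fun s : ℝ => s * a) a s := fun s => by
    simpa using (hasDerivAt_id s).mul_const a
  -- The square of `!![a, 0; c, -a]` is `a²` times the identity, so its exponential at time `s` has
  -- lower left entry `c sinh(s a) / a`, or `c s` when `a = 0`. The witnesses choose `c` so that the
  -- curve reaches `g` at time `1`.
  by_cases h : a = 0
  · refine ⟨su2Star.mk a (g.1 1 0), a, id, g.1 1 0, fun s => analyticAt_id, rfl, ?_, fun s => ?_⟩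
    · simp only [one_mul, id, Complex.ofReal_one, mul_one]
      exact expChart_logChart g
    · rw [velocity_su2Star]
      refine ((hd s).prodMk ((hasDerivAt_id s).ofReal_comp.const_mul _)).congr_deriv ?_
      simp [su2Star.mk, h, expChart, SU2Star.mk]
  · have hs : Real.sinh a ≠ 0 := by rwa [Ne, Real.sinh_eq_zero]
    have hs' : (Real.sinh a : ℂ) ≠ 0 := Complex.ofReal_ne_zero.2 hs
    refine ⟨su2Star.mk a (a * g.1 1 0 / Real.sinh a), a, fun s => Real.sinh (s * a),
      g.1 1 0 / Real.sinh a, fun s => ?_, by simp, ?_, fun s => ?_⟩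
    · simp only [Real.sinh_eq]
      fun_prop
    · have : g.1 1 0 / Real.sinh a * Real.sinh (1 * a) = g.1 1 0 := by
        rw [one_mul, div_mul_cancel₀ _ hs']
      rw [this, one_mul]
      exact expChart_logChart g
    · rw [velocity_su2Star]
      refine ((hd s).prodMk ((hd s).sinh.ofReal_comp.const_mul _)).congr_deriv ?_
      ext1
      · simp [su2Star.mk]
      · simp [su2Star.mk, expChart, SU2Star.mk, Complex.cosh, Complex.sinh, Complex.exp_neg]
        field_simp
        ring

theorem analyticAt_inChart (φ : FunSU2Star) {a z : ℝ → ℝ} {c : ℂ} {s : ℝ} (ha : AnalyticAt ℝ a s)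
    (hz : AnalyticAt ℝ z s) : AnalyticAt ℝ (fun s => inChart φ (a s, c * z s)) s := by
  have hof : ∀ {f : ℝ → ℝ}, AnalyticAt ℝ f s → AnalyticAt ℝ (fun s => (f s : ℂ)) s :=
    fun hf => (Complex.ofRealCLM.analyticAt _).comp hf
  induction φ using coordRing_induction with
  | hgen i =>
    fin_cases i
    · exact hof ha.rexp
    · refine (hof ha.neg.rexp).congr (.of_forall fun t => ?_)
      simp [inChart, expChart, SU2Star.mk, coord, Real.exp_neg]
    · exact analyticAt_const.mul (hof hz)
    · refine (analyticAt_const.mul (hof hz)).congr (f := fun t => conj c * (z t : ℂ))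
        (.of_forall fun t => ?_)
      simp [inChart, expChart, SU2Star.mk, coord]
    · refine (hof ha).congr (.of_forall fun t => ?_)
      exact congrArg (fun q : ℝ × ℂ => (q.1 : ℂ)) (logChart_expChart (a t, c * z t)).symm
  | halg b => simp only [inChart_algebraMap]; exact analyticAt_const
  | hadd f g hf hg => simp only [inChart_add]; exact hf.add hg
  | hmul f g hf hg => simp only [inChart_mul]; exact hf.mul hg

/-- Along a one-parameter subgroup through `g` the function is real analytic, and its Taylor
coefficients at the identity are multiples of the pairings with powers of the generator. If all
these vanish, so does the value at `g`. -/
theorem pairing_separatingLeft : pairing.SeparatingLeft := by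
  intro φ hφ
  rw [toFun_injective_iff]
  intro g
  obtain ⟨X, a, r, z, hr, hr0, hg, hX⟩ := exists_oneParameter g
  have h₀ : expChart (0 * a, z * r 0) = 1 := by
    apply SU2Star.ext <;> simp [expChart, SU2Star.mk, hr0]
  have han : AnalyticOnNhd ℝ (fun s => inChart φ (s * a, z * r s)) Set.univ := fun s _ =>
    analyticAt_inChart φ (analyticAt_id.mul analyticAt_const) (hr s)
  -- The curve is an integral curve of the field of `X` at every time, not only at `0`; hence each
  -- differentiation is one more action of `X`.
  have hder : ∀ n, iteratedDeriv n (fun s => inChart φ (s * a, z * r s)) =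
      fun s => inChart (dressingStar.act φ (toEnv 1 X ^ n)) (s * a, z * r s) := by
    intro n
    induction n with
    | zero => rw [iteratedDeriv_zero, pow_zero, DerAction.act_one]
    | succ n ih =>
      rw [iteratedDeriv_succ, ih, pow_succ, DerAction.act_mul, DerAction.act_toEnv]
      funext s
      refine (hasDerivAt_dressing_of_chart (γ := fun s => expChart (s * a, z * r s)) rfl ?_ _).deriv
      refine (hX s).congr_of_eventuallyEq (.of_forall fun t => ?_)
      exact logChart_expChart _
  have hev : (fun s => inChart φ (s * a, z * r s)) =ᶠ[nhds 0] 0 := by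
    refine analyticOrderAt_eq_top.1 (ENat.eq_top_iff_forall_ge.2 fun n => ?_)
    rw [natCast_le_analyticOrderAt_iff_iteratedDeriv_eq_zero (han 0 trivial)]
    intro i _
    rw [hder]
    change toFun _ (expChart (0 * a, z * r 0)) = 0
    rw [h₀]
    exact hφ _
  have := han.eqOn_zero_of_preconnected_of_eventuallyEq_zero isPreconnected_univ trivial hev
    (Set.mem_univ 1)
  rw [← hg]
  exact this

end Iwasawa


/-! ### The coregular action and skew derivations. -/

namespace Semidual

variable {k A H : Type*} [CommRing k] [Ring A] [HopfAlgebra k A] [Ring H] [HopfAlgebra k H]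

/-- The coregular action `φ ▷ h = ∑ h₍₁₎ ⟨φ, h₍₂₎⟩`. -/
def coregular (p : A →ₗ[k] H →ₗ[k] k) : A →ₗ[k] H →ₗ[k] H :=
  LinearMap.mk₂ k (fun φ h => TensorProduct.rid k H
      (LinearMap.lTensor H (p φ) (Coalgebra.comul (R := k) h)))
    (fun φ ψ h => by rw [map_add, LinearMap.lTensor_add, LinearMap.add_apply, map_add])
    (fun c φ h => by rw [map_smul, LinearMap.lTensor_smul, LinearMap.smul_apply, map_smul])
    (fun φ h g => by rw [map_add, map_add, map_add])
    (fun c φ h => by rw [map_smul, map_smul, map_smul])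

variable {p : A →ₗ[k] H →ₗ[k] k}

theorem coregular_apply (φ : A) (h : H) : coregular p φ h =
    TensorProduct.rid k H (LinearMap.lTensor H (p φ) (Coalgebra.comul (R := k) h)) := rfl

theorem coregular_one_right (one_right : ∀ φ : A, p φ 1 = Coalgebra.counit (R := k) φ) (φ : A) :
    coregular p φ 1 = Coalgebra.counit (R := k) φ • 1 := by
  rw [coregular_apply, Bialgebra.comul_one, Algebra.TensorProduct.one_def,
    LinearMap.lTensor_tmul, TensorProduct.rid_tmul, one_right]

/-- The coproduct of `H` is multiplicative and the pairing turns a product on its second argument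
into the coproduct of `φ`; together these give the module algebra law. -/
theorem coregular_mul_right (mul_right : ∀ (φ : A) (h g : H), p φ (h * g) =
      LinearMap.mul' k k (TensorProduct.map (p.flip h) (p.flip g) (Coalgebra.comul (R := k) φ)))
    (φ : A) (h g : H) : coregular p φ (h * g) =
      LinearMap.mul' k H (TensorProduct.map ((coregular p).flip h) ((coregular p).flip g)
        (Coalgebra.comul (R := k) φ)) := by
  -- Arbitrary tensors replace the coproducts of `h` and `g`, so that both can be reduced to simple
  -- tensors.
  have key : ∀ S T : H ⊗[k] H, TensorProduct.rid k H (LinearMap.lTensor H (p φ) (S * T)) =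
      LinearMap.mul' k H (TensorProduct.map
        ((TensorProduct.rid k H).toLinearMap ∘ₗ
          ((LinearMap.lTensorHom (R := k) H).flip S) ∘ₗ p)
        ((TensorProduct.rid k H).toLinearMap ∘ₗ
          ((LinearMap.lTensorHom (R := k) H).flip T) ∘ₗ p)
        (Coalgebra.comul (R := k) φ)) := by
    intro S T
    induction S with
    | zero => simp
    | add S₁ S₂ h₁ h₂ =>
      simp only [map_add, add_mul, h₁, h₂, LinearMap.add_comp, LinearMap.comp_add,
        TensorProduct.map_add_left, LinearMap.add_apply]
    | tmul h h' =>
      induction T with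
      | zero => simp
      | add S₁ S₂ h₁ h₂ =>
        simp only [map_add, mul_add, h₁, h₂, LinearMap.add_comp, LinearMap.comp_add,
          TensorProduct.map_add_right, LinearMap.add_apply]
      | tmul g g' =>
        rw [Algebra.TensorProduct.tmul_mul_tmul, LinearMap.lTensor_tmul, TensorProduct.rid_tmul,
          mul_right]
        generalize Coalgebra.comul (R := k) φ = U
        induction U with
        | zero => simp
        | add S₁ S₂ h₁ h₂ => simp only [map_add, add_smul, h₁, h₂]
        | tmul φ ψ => simp [mul_smul, smul_comm (p φ h')]
  rw [coregular_apply, Bialgebra.comul_mul, key]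
  rfl

/-- The coregular action of `ψ` is the transpose of multiplication by `ψ` on the right; with a
non-degenerate pairing this determines it. -/
theorem pairing_coregular (mul_left : ∀ (φ ψ : A) (h : H), p (φ * ψ) h =
      LinearMap.mul' k k (TensorProduct.map (p φ) (p ψ) (Coalgebra.comul (R := k) h)))
    (φ ψ : A) (h : H) : p φ (coregular p ψ h) = p (φ * ψ) h := by
  rw [mul_left, coregular_apply]
  generalize Coalgebra.comul (R := k) h = T
  induction T with
  | zero => simp
  | add S₁ S₂ h₁ h₂ => simp only [map_add, h₁, h₂]
  | tmul h g => simp [mul_comm]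

section SkewDerivation

variable {T E : H →ₗ[k] H}

theorem skewDerivation_mul_mul (hT : ∀ h g, T (h * g) = T h * g + E h * T g)
    (u v w : H) :
    T (u * v * w) = T u * v * w + E u * T v * w + E (u * v) * T w := by
  rw [hT, hT, add_mul]

theorem skewDerivation_pow_eq_zero (hT : ∀ h g, T (h * g) = T h * g + E h * T g)
    (h₁ : T 1 = 0) {x : H} (hx : T x = 0) (n : ℕ) : T (x ^ n) = 0 := by
  induction n with
  | zero => rw [pow_zero, h₁]
  | succ n ih => rw [pow_succ, hT, ih, hx, zero_mul, mul_zero, add_zero]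

/-- Because `E` fixes `x`, the twist is invisible at each step and the ordinary power rule results.
For `n = 0` the truncated exponent is harmless, as the coefficient vanishes. -/
theorem skewDerivation_pow (hT : ∀ h g, T (h * g) = T h * g + E h * T g) (h₁ : T 1 = 0)
    {x : H} {c : k} (hx : T x = c • 1) (hE : E x = x) (n : ℕ) :
    T (x ^ n) = (n * c) • x ^ (n - 1) := by
  induction n with
  | zero => rw [pow_zero, h₁, Nat.cast_zero, zero_mul, zero_smul]
  | succ n ih =>
    rw [pow_succ', hT, ih, hx, hE, smul_mul_assoc, one_mul, mul_smul_comm]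
    rcases n with _ | n
    · simp
    · rw [Nat.add_sub_cancel, Nat.add_sub_cancel, ← pow_succ', ← add_smul]
      push_cast
      congr 1
      ring

end SkewDerivation

end Semidual

namespace Iwasawa

open Matrix ComplexConjugate Semidual

/-! ### The momentum generators -/

theorem P_zero (lam : ℝ) : P lam 0 = ((lam : ℂ)⁻¹ * 2⁻¹) • ((gen 2 + gen 3) * gen 1) := by
  rw [toFun_injective_iff]
  intro g
  have : ((g.1 1 0 * g.1 1 1).re : ℂ) = (g.1 1 0 + conj (g.1 1 0)) * g.1 1 1 / 2 := by
    rw [Complex.re_eq_add_conj, map_mul, entry_one_one]; ring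
  change (((g.1 1 0 * g.1 1 1).re / lam : ℝ) : ℂ) =
    (lam : ℂ)⁻¹ * 2⁻¹ * ((g.1 1 0 + conj (g.1 1 0)) * g.1 1 1)
  rw [Complex.ofReal_div, this]; ring

theorem P_one (lam : ℝ) :
    P lam 1 = ((lam : ℂ)⁻¹ * (2 * Complex.I)⁻¹) • ((gen 2 - gen 3) * gen 1) := by
  rw [toFun_injective_iff]
  intro g
  have : ((g.1 1 0 * g.1 1 1).im : ℂ) =
      (g.1 1 0 - conj (g.1 1 0)) * g.1 1 1 / (2 * Complex.I) := by
    rw [Complex.im_eq_sub_conj, map_mul, entry_one_one]; ring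
  change (((g.1 1 0 * g.1 1 1).im / lam : ℝ) : ℂ) =
    (lam : ℂ)⁻¹ * (2 * Complex.I)⁻¹ * ((g.1 1 0 - conj (g.1 1 0)) * g.1 1 1)
  rw [Complex.ofReal_div, this]; ring

theorem P_two (lam : ℝ) : P lam 2 = (2 / (lam : ℂ)) • gen 4 := by
  rw [toFun_injective_iff]
  intro g
  change ((2 / lam * Real.log (g.1 0 0).re : ℝ) : ℂ) = 2 / lam * (Real.log (g.1 0 0).re : ℂ)
  push_cast
  rfl

theorem expP_eq (lam : ℝ) (hl : lam ≠ 0) : expP lam hl = gen 1 * gen 1 := by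
  rw [toFun_injective_iff]
  intro g
  have h₁ : -lam * momentum lam 2 g =
      Real.log ((g.1 0 0).re)⁻¹ + Real.log ((g.1 0 0).re)⁻¹ := by
    have : momentum lam 2 g = 2 / lam * Real.log (g.1 0 0).re := rfl
    rw [this, Real.log_inv]; field_simp; ring
  have h₂ : g.1 1 1 = (((g.1 0 0).re)⁻¹ : ℝ) := by
    rw [Complex.ofReal_inv, ← entry_zero_zero, entry_one_one_eq]
  change (Real.exp (-lam * momentum lam 2 g) : ℂ) = g.1 1 1 * g.1 1 1
  rw [h₁, Real.exp_add, Real.exp_log (inv_pos.2 g.2.2.2), h₂, Complex.ofReal_mul]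

theorem comulHom_expP (lam : ℝ) (hl : lam ≠ 0) :
    comulHom (expP lam hl) = expP lam hl ⊗ₜ expP lam hl := by
  rw [expP_eq, map_mul, comulHom_gen]
  simp

theorem comulHom_P_zero (lam : ℝ) (hl : lam ≠ 0) :
    comulHom (P lam 0) = P lam 0 ⊗ₜ 1 + expP lam hl ⊗ₜ P lam 0 := by
  rw [P_zero, expP_eq, map_smul, map_mul, map_add, comulHom_gen, comulHom_gen, comulHom_gen]
  simp only [Matrix.cons_val, add_mul, Algebra.TensorProduct.tmul_mul_tmul, gen_zero_mul_gen_one,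
    TensorProduct.tmul_add, TensorProduct.add_tmul, ← TensorProduct.smul_tmul',
    TensorProduct.tmul_smul, ← smul_add]
  congr 1
  abel

theorem comulHom_P_one (lam : ℝ) (hl : lam ≠ 0) :
    comulHom (P lam 1) = P lam 1 ⊗ₜ 1 + expP lam hl ⊗ₜ P lam 1 := by
  rw [P_one, expP_eq, map_smul, map_mul, map_sub, comulHom_gen, comulHom_gen, comulHom_gen]
  simp only [Matrix.cons_val, add_mul, sub_mul, Algebra.TensorProduct.tmul_mul_tmul,
    gen_zero_mul_gen_one, TensorProduct.tmul_sub, TensorProduct.sub_tmul,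
    ← TensorProduct.smul_tmul', TensorProduct.tmul_smul, ← smul_add]
  congr 1
  abel

theorem comulHom_P_two (lam : ℝ) :
    comulHom (P lam 2) = P lam 2 ⊗ₜ 1 + 1 ⊗ₜ P lam 2 := by
  rw [P_two, map_smul, comulHom_gen]
  simp only [Matrix.cons_val, ← TensorProduct.smul_tmul', TensorProduct.tmul_smul, ← smul_add]

theorem counit_gen (i : Fin 5) :
    Coalgebra.counit (R := ℂ) (gen i) = (![1, 1, 0, 0, 0] : Fin 5 → ℂ) i := by
  rw [counit_fun_eq]
  fin_cases i <;> simp [coord]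

theorem counit_P (lam : ℝ) (a : Fin 3) : Coalgebra.counit (R := ℂ) (P lam a) = 0 := by
  rw [counit_fun_eq]
  change ((momentum lam a 1 : ℝ) : ℂ) = 0
  fin_cases a <;> simp [momentum]

theorem counit_expP (lam : ℝ) (hl : lam ≠ 0) : Coalgebra.counit (R := ℂ) (expP lam hl) = 1 := by
  rw [expP_eq, Bialgebra.counit_mul, counit_gen]
  simp

theorem pairing_toEnv (φ : FunSU2Star) (c : ℂ) (X : su2Star) :
    pairing φ (toEnv c X) = c * Coalgebra.counit (R := ℂ) (dressing X.1 φ) := by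
  rw [pairing_apply, DerAction.act_toEnv', map_smul, smul_eq_mul]
  rfl

theorem counit_dgen_su2Star (X : su2Star) (i : Fin 5) :
    Coalgebra.counit (R := ℂ) (dgen X.1 i) =
      (![X.1 0 0, -X.1 0 0, X.1 1 0, conj (X.1 1 0), X.1 0 0] : Fin 5 → ℂ) i := by
  have h₀ : conj (X.1 0 0) = X.1 0 0 := Complex.conj_eq_iff_im.2 X.2.2.2
  have h₁ : (1 : SU2Star).1 0 0 = 1 := rfl
  have h₃ : (1 : SU2Star).1 1 1 = 1 := rfl
  have h₄ : toFun (dgen X.1 4) 1 = X.1 0 0 := by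
    rw [toFun_dgen_four, h₀, X.2.2.1]
    simp only [map_zero, zero_mul, add_zero]
    ring
  rw [counit_fun_eq]
  fin_cases i
  · refine (toFun_dgen_zero _ _).trans ?_
    rw [h₄, h₁, one_mul]; rfl
  · refine (toFun_dgen_one _ _).trans ?_
    rw [h₄, h₃, one_mul]; rfl
  · refine (toFun_dgen_two _ _).trans ?_
    simp [X.2.2.1]
  · refine (toFun_dgen_three _ _).trans ?_
    simp [X.2.2.1]
  · exact h₄

theorem transBasis_entries (lam : ℝ) :
    ((transBasis lam 0).1 0 0 = 0 ∧ (transBasis lam 0).1 1 0 = lam) ∧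
    ((transBasis lam 1).1 0 0 = 0 ∧ (transBasis lam 1).1 1 0 = Complex.I * lam) ∧
    ((transBasis lam 2).1 0 0 = ((lam / 2 : ℝ) : ℂ) ∧ (transBasis lam 2).1 1 0 = 0) :=
  ⟨⟨rfl, rfl⟩, ⟨rfl, rfl⟩, ⟨rfl, rfl⟩⟩

/-- To first order at the identity the `P_a` are the coordinates dual to the basis `transBasis`; the
`i` is the one in the definition of `x`. -/
theorem pairing_P_x (lam : ℝ) (hl : lam ≠ 0) (a b : Fin 3) :
    pairing (P lam a) (x lam b) = if a = b then Complex.I else 0 := by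
  have hl' : (lam : ℂ) ≠ 0 := Complex.ofReal_ne_zero.2 hl
  obtain ⟨⟨h₁, h₂⟩, ⟨h₃, h₄⟩, h₅, h₆⟩ := transBasis_entries lam
  have key : ∀ X : su2Star, Coalgebra.counit (R := ℂ) (dressing X.1 (P lam a)) =
      (![((lam : ℂ)⁻¹ * 2⁻¹) * (X.1 1 0 + conj (X.1 1 0)),
        ((lam : ℂ)⁻¹ * (2 * Complex.I)⁻¹) * (X.1 1 0 - conj (X.1 1 0)),
        2 / (lam : ℂ) * X.1 0 0] : Fin 3 → ℂ) a := by
    intro X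
    fin_cases a
    · change Coalgebra.counit (R := ℂ) (dressing X.1 (P lam 0)) = _
      rw [P_zero, Derivation.map_smul, Derivation.leibniz, map_add, dressing_gen, dressing_gen,
        dressing_gen]
      simp [counit_dgen_su2Star, counit_gen]
    · change Coalgebra.counit (R := ℂ) (dressing X.1 (P lam 1)) = _
      rw [P_one, Derivation.map_smul, Derivation.leibniz, map_sub, dressing_gen, dressing_gen,
        dressing_gen]
      simp [counit_dgen_su2Star, counit_gen]
    · change Coalgebra.counit (R := ℂ) (dressing X.1 (P lam 2)) = _
      rw [P_two, Derivation.map_smul, dressing_gen]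
      simp [counit_dgen_su2Star]
  rw [x, pairing_toEnv, key]
  fin_cases a <;> fin_cases b <;> simp [h₁, h₂, h₃, h₄, h₅, h₆, sub_eq_add_neg]
  · field_simp
    norm_num
  · field_simp
    linear_combination -2 * Complex.I_sq
  · exact hl

/-- The directions `λ e₂₁` and `i λ e₂₁` do not change `w`. As `exp(-λ P₃)` has counit one, it
therefore fixes `x₁` and `x₂` under the coregular action. -/
theorem pairing_expP_x (lam : ℝ) (hl : lam ≠ 0) (b : Fin 3) (hb : b ≠ 2) :
    pairing (expP lam hl) (x lam b) = 0 := by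
  obtain ⟨⟨h₁, h₂⟩, ⟨h₃, h₄⟩, h₅, h₆⟩ := transBasis_entries lam
  rw [x, pairing_toEnv, expP_eq, Derivation.leibniz, dressing_gen]
  fin_cases b <;> simp [counit_dgen_su2Star, h₁, h₃] at hb ⊢

/-! ### The relations of the coordinates `x_a` and normal ordering -/

theorem x_lie (lam : ℝ) (a b : Fin 3) : x lam a * x lam b - x lam b * x lam a =
    -toEnv 1 ⁅transBasis lam a, transBasis lam b⁆ := by
  rw [toEnv_lie, x, x, toEnv_eq_smul, toEnv_eq_smul Complex.I (transBasis lam b)]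
  simp only [smul_mul_smul_comm, Complex.I_mul_I, neg_smul, one_smul]
  abel

theorem x_lie_two (lam : ℝ) (i : Fin 3) (hi : i ≠ 2) :
    x lam i * x lam 2 - x lam 2 * x lam i = (Complex.I * lam) • x lam i := by
  have h : ⁅transBasis lam i, transBasis lam 2⁆ = lam • transBasis lam i := by
    apply Subtype.ext
    change ⁅(transBasis lam i).1, (transBasis lam 2).1⁆ = lam • (transBasis lam i).1
    rw [LieRing.of_associative_ring_bracket]
    fin_cases i
    · ext r s
      fin_cases r <;> fin_cases s <;> simp [transBasis]
      ring
    · ext r s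
      fin_cases r <;> fin_cases s <;> simp [transBasis]
      ring
    · simp at hi
  rw [x_lie, h, toEnv_smul, x, toEnv_eq_smul Complex.I, smul_smul, ← neg_smul]
  congr 1
  linear_combination (-(lam : ℂ)) * Complex.I_sq

theorem x_zero_mul_x_one (lam : ℝ) : x lam 0 * x lam 1 = x lam 1 * x lam 0 := by
  have h : ⁅transBasis lam 0, transBasis lam 1⁆ = 0 := by
    apply Subtype.ext
    change ⁅(transBasis lam 0).1, (transBasis lam 1).1⁆ = 0
    rw [LieRing.of_associative_ring_bracket]
    ext r s
    fin_cases r <;> fin_cases s <;> simp [transBasis]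
  rw [← sub_eq_zero, x_lie, h, toEnv, TensorProduct.tmul_zero, map_zero, neg_zero]

theorem normalOrder_monomial (lam : ℝ) (n : Fin 3 →₀ ℕ) (c : ℂ) :
    normalOrder lam (MvPolynomial.monomial n c) =
      c • (x lam 0 ^ n 0 * x lam 1 ^ n 1 * x lam 2 ^ n 2) := by
  have h : MvPolynomial.monomial n c = c • MvPolynomial.basisMonomials (Fin 3) ℂ n := by
    rw [MvPolynomial.coe_basisMonomials, MvPolynomial.smul_monomial, smul_eq_mul, mul_one]
  rw [h, map_smul, normalOrder, Module.Basis.constr_basis]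

theorem x_two_mul_pow (lam : ℝ) (i : Fin 3) (hi : i ≠ 2) (l : ℕ) : x lam 2 * x lam i ^ l =
    x lam i ^ l * x lam 2 - (l * (Complex.I * lam)) • x lam i ^ l := by
  have h := x_lie_two lam i hi
  induction l with
  | zero => simp
  | succ l ih =>
    have h' : x lam 2 * x lam i = x lam i * x lam 2 - (Complex.I * lam) • x lam i := by
      rw [← h]; abel
    rw [pow_succ, ← mul_assoc, ih, sub_mul, mul_assoc, h', mul_sub, smul_mul_assoc,
      mul_smul_comm, ← mul_assoc, sub_sub, ← add_smul]
    push_cast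
    congr 2
    ring

theorem toEnv_su2Star_eq (lam : ℝ) (hl : lam ≠ 0) (X : su2Star) :
    ∃ c : Fin 3 → ℂ, toEnv 1 X = ∑ a, c a • x lam a := by
  have h₁ : X = ((X.1 1 0).re / lam) • transBasis lam 0 + ((X.1 1 0).im / lam) • transBasis lam 1 +
      (2 * (X.1 0 0).re / lam) • transBasis lam 2 := by
    have hl' : (lam : ℂ) ≠ 0 := Complex.ofReal_ne_zero.2 hl
    have h₀ : X.1 0 0 = ((X.1 0 0).re : ℂ) := Complex.ext rfl (by simpa using X.2.2.2)
    have h₂ : X.1 1 1 = -X.1 0 0 := by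
      have := X.2.1
      rw [Matrix.trace_fin_two] at this
      linear_combination this
    have h₃ := Complex.re_add_im (X.1 1 0)
    apply Subtype.ext
    change X.1 = ((X.1 1 0).re / lam) • (transBasis lam 0).1 +
      ((X.1 1 0).im / lam) • (transBasis lam 1).1 + (2 * (X.1 0 0).re / lam) • (transBasis lam 2).1
    ext r s
    fin_cases r <;> fin_cases s <;> simp [transBasis]
    · rw [← h₀]; field_simp
    · exact X.2.2.1
    · nth_rw 1 [← h₃]; field_simp
    · rw [h₂, ← h₀]; field_simp
  have h₂ : ∀ a, toEnv 1 (transBasis lam a) = (-Complex.I) • x lam a := by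
    intro a
    rw [x, toEnv_eq_smul, toEnv_eq_smul Complex.I, smul_smul, neg_mul, Complex.I_mul_I, neg_neg,
      one_smul]
  refine ⟨fun a => (((![(X.1 1 0).re / lam, (X.1 1 0).im / lam, 2 * (X.1 0 0).re / lam] :
    Fin 3 → ℝ) a : ℝ) : ℂ) * -Complex.I, ?_⟩
  rw [Fin.sum_univ_three]
  conv_lhs => rw [h₁]
  simp only [toEnv_add, toEnv_smul, h₂, smul_smul]
  rfl

/-- The range contains `1` and is stable under left multiplication by each `x_a`: `x₁` and `x₂`
commute, and moving `x₃` through their powers costs only a multiple of the same monomial. -/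
theorem normalOrder_surjective (lam : ℝ) (hl : lam ≠ 0) :
    Function.Surjective (normalOrder lam) := by
  have mono : ∀ l m n : ℕ, x lam 0 ^ l * x lam 1 ^ m * x lam 2 ^ n ∈
      LinearMap.range (normalOrder lam) := by
    intro l m n
    refine ⟨MvPolynomial.monomial (Finsupp.equivFunOnFinite.symm ![l, m, n]) 1, ?_⟩
    rw [normalOrder_monomial, one_smul]
    rfl
  have hmul : ∀ a : Fin 3, ∀ h ∈ LinearMap.range (normalOrder lam),
      x lam a * h ∈ LinearMap.range (normalOrder lam) := by
    rintro a _ ⟨f, rfl⟩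
    induction f using MvPolynomial.induction_on' with
    | add p q hp hq => rw [map_add, mul_add]; exact add_mem hp hq
    | monomial n c =>
      rw [normalOrder_monomial, mul_smul_comm]
      refine Submodule.smul_mem _ _ ?_
      fin_cases a
      · have := mono (n 0 + 1) (n 1) (n 2)
        rwa [pow_succ', mul_assoc, mul_assoc, ← mul_assoc (x lam 0 ^ n 0)] at this
      · have := mono (n 0) (n 1 + 1) (n 2)
        have hc : Commute (x lam 1) (x lam 0 ^ n 0) :=
          Commute.pow_right (x_zero_mul_x_one lam).symm _
        rw [pow_succ', ← mul_assoc, ← hc.eq, mul_assoc, mul_assoc,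
          ← mul_assoc (x lam 0 ^ n 0)] at this
        exact this
      · have e : x lam 2 * (x lam 0 ^ n 0 * x lam 1 ^ n 1 * x lam 2 ^ n 2) =
            x lam 0 ^ n 0 * x lam 1 ^ n 1 * x lam 2 ^ (n 2 + 1) -
            ((n 0 + n 1) * (Complex.I * lam)) • (x lam 0 ^ n 0 * x lam 1 ^ n 1 * x lam 2 ^ n 2) := by
          rw [← mul_assoc, ← mul_assoc, x_two_mul_pow lam 0 (by decide), sub_mul, mul_assoc _ (x lam 2),
            x_two_mul_pow lam 1 (by decide), pow_succ', add_mul, add_smul]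
          simp only [mul_sub, sub_mul, smul_mul_assoc, mul_smul_comm, mul_assoc]
          abel
        exact e ▸ sub_mem (mono _ _ _) (Submodule.smul_mem _ _ (mono _ _ _))
  intro h
  induction h using env_induction_left with
  | one => exact (by simpa using mono 0 0 0)
  | add u v hu hv => exact add_mem (S := Submodule ℂ _) (s := LinearMap.range _) hu hv
  | smul c u hu => exact Submodule.smul_mem (LinearMap.range _) c hu
  | mul u X hu =>
    obtain ⟨c, hc⟩ := toEnv_su2Star_eq lam hl X
    rw [hc, Finset.sum_mul]
    refine Submodule.sum_mem (LinearMap.range (normalOrder lam)) fun a _ => ?_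
    rw [smul_mul_assoc]
    exact Submodule.smul_mem _ _ (hmul a u hu)

/-! ### The momentum generators act on normally ordered polynomials by differentiation -/

theorem coregular_x (φ : FunSU2Star) (lam : ℝ) (a : Fin 3) : coregular pairing φ (x lam a) =
    Coalgebra.counit (R := ℂ) φ • x lam a + pairing φ (x lam a) • 1 := by
  rw [coregular_apply, x, comul_toEnv, map_add, map_add, LinearMap.lTensor_tmul,
    LinearMap.lTensor_tmul, TensorProduct.rid_tmul, TensorProduct.rid_tmul, pairing_one_right]

theorem coregular_P_one (lam : ℝ) (a : Fin 3) : coregular pairing (P lam a) 1 = 0 := by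
  rw [coregular_one_right pairing_one_right, counit_P, zero_smul]

theorem coregular_P_x (lam : ℝ) (hl : lam ≠ 0) (a b : Fin 3) :
    coregular pairing (P lam a) (x lam b) = (if a = b then Complex.I else 0) • 1 := by
  rw [coregular_x, counit_P, zero_smul, zero_add, pairing_P_x lam hl]

theorem coregular_expP_x (lam : ℝ) (hl : lam ≠ 0) (b : Fin 3) (hb : b ≠ 2) :
    coregular pairing (expP lam hl) (x lam b) = x lam b := by
  rw [coregular_x, counit_expP, one_smul, pairing_expP_x lam hl b hb, zero_smul, add_zero]

theorem coregular_one_left (h : Env su2Star) : coregular pairing 1 h = h := by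
  have : pairing 1 = Coalgebra.counit (R := ℂ) := LinearMap.ext pairing_one_left
  rw [coregular_apply, this, Coalgebra.lTensor_counit_comul]
  simp

/-- The coproduct of `P_a` read through the module algebra law: `P₃` acts as a derivation, `P₁` and
`P₂` as derivations twisted by `exp(-λ P₃)`. -/
theorem coregular_P_mul (lam : ℝ) (hl : lam ≠ 0) (a : Fin 3) (h g : Env su2Star) :
    coregular pairing (P lam a) (h * g) = coregular pairing (P lam a) h * g +
      coregular pairing (if a = 2 then 1 else expP lam hl) h * coregular pairing (P lam a) g := by
  have e : Coalgebra.comul (R := ℂ) (P lam a) = P lam a ⊗ₜ 1 +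
      (if a = 2 then 1 else expP lam hl) ⊗ₜ P lam a := by
    rw [comul_fun_eq]
    fin_cases a
    · exact comulHom_P_zero lam hl
    · exact comulHom_P_one lam hl
    · exact comulHom_P_two lam
  rw [coregular_mul_right pairing_mul_right, e]
  simp [coregular_one_left]

theorem coregular_P_x_pow_of_ne (lam : ℝ) (hl : lam ≠ 0) {a b : Fin 3} (hb : a ≠ b) (l : ℕ) :
    coregular pairing (P lam a) (x lam b ^ l) = 0 := by
  refine skewDerivation_pow_eq_zero (coregular_P_mul lam hl a) (coregular_P_one lam a) ?_ l
  rw [coregular_P_x lam hl, if_neg hb, zero_smul]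

theorem coregular_P_x_pow (lam : ℝ) (hl : lam ≠ 0) (a : Fin 3) (l : ℕ) :
    coregular pairing (P lam a) (x lam a ^ l) = (l * Complex.I) • x lam a ^ (l - 1) := by
  refine skewDerivation_pow (coregular_P_mul lam hl a) (coregular_P_one lam a)
    ((coregular_P_x lam hl a a).trans (by rw [if_pos rfl])) ?_ l
  split_ifs with h
  · exact coregular_one_left _
  · exact coregular_expP_x lam hl a h

theorem coregular_expP_x_pow (lam : ℝ) (hl : lam ≠ 0) {b : Fin 3} (hb : b ≠ 2) (l : ℕ) :
    coregular pairing (expP lam hl) (x lam b ^ l) = x lam b ^ l := by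
  induction l with
  | zero => rw [pow_zero, coregular_one_right pairing_one_right, counit_expP, one_smul]
  | succ l ih =>
    rw [pow_succ, coregular_mul_right pairing_mul_right, comul_fun_eq, comulHom_expP,
      TensorProduct.map_tmul, LinearMap.mul'_apply, LinearMap.flip_apply, LinearMap.flip_apply, ih,
      coregular_expP_x lam hl b hb]

/-- The ordering matters here. For `P₁` and `P₂` the twist is only ever applied to powers of `x₁`
and `x₂`, which it fixes, because `x₃` stands on the right; for `P₃` there is no twist. The
exponents are truncated, with coefficient zero when truncation occurs. -/
theorem coregular_P_monomial (lam : ℝ) (hl : lam ≠ 0) (a : Fin 3) (n : Fin 3 →₀ ℕ) :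
    coregular pairing (P lam a) (x lam 0 ^ n 0 * x lam 1 ^ n 1 * x lam 2 ^ n 2) =
      (n a * Complex.I) • (x lam 0 ^ (n - Finsupp.single a 1 : Fin 3 →₀ ℕ) 0 *
        x lam 1 ^ (n - Finsupp.single a 1 : Fin 3 →₀ ℕ) 1 *
        x lam 2 ^ (n - Finsupp.single a 1 : Fin 3 →₀ ℕ) 2) := by
  have hne {b : Fin 3} (hb : a ≠ b) := coregular_P_x_pow_of_ne lam hl hb (n b)
  have he := coregular_P_x_pow lam hl a (n a)
  have hE {b : Fin 3} (hb : b ≠ 2) := coregular_expP_x_pow lam hl hb (n b)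
  rw [skewDerivation_mul_mul (coregular_P_mul lam hl a)]
  simp only [Finsupp.tsub_apply]
  obtain rfl | rfl | rfl : a = 0 ∨ a = 1 ∨ a = 2 := by fin_cases a <;> simp
  · rw [he, hne (by decide : (0 : Fin 3) ≠ 1), hne (by decide : (0 : Fin 3) ≠ 2)]
    simp
  · rw [hne (by decide : (1 : Fin 3) ≠ 0), he,
      hne (by decide : (1 : Fin 3) ≠ 2), if_neg (by decide), hE (by decide : (0 : Fin 3) ≠ 2)]
    simp
  · have h₀ := hne (by decide : (2 : Fin 3) ≠ 0)
    have h₁ := hne (by decide : (2 : Fin 3) ≠ 1)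
    simp only [↓reduceIte, coregular_one_left, h₀, h₁, he, zero_mul, mul_zero, zero_add,
      mul_smul_comm]
    simp

theorem coregular_P_normalOrder (lam : ℝ) (hl : lam ≠ 0) (a : Fin 3) (f : MvPolynomial (Fin 3) ℂ) :
    coregular pairing (P lam a) (normalOrder lam f) =
      Complex.I • normalOrder lam (MvPolynomial.pderiv a f) := by
  induction f using MvPolynomial.induction_on' with
  | add p q hp hq => simp only [map_add, smul_add, hp, hq]
  | monomial n c =>
    rw [normalOrder_monomial, map_smul, MvPolynomial.pderiv_monomial, normalOrder_monomial,
      coregular_P_monomial lam hl, smul_smul, smul_smul]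
    congr 1
    ring

theorem counit_normalOrder (lam : ℝ) (f : MvPolynomial (Fin 3) ℂ) :
    Coalgebra.counit (R := ℂ) (normalOrder lam f) = MvPolynomial.coeff 0 f := by
  induction f using MvPolynomial.induction_on' with
  | add p q hp hq => simp only [map_add, hp, hq, MvPolynomial.coeff_add]
  | monomial n c =>
    have hx : ∀ a, Bialgebra.counitAlgHom ℂ (Env su2Star) (x lam a) = 0 := fun a => counit_toEnv _ _
    rw [normalOrder_monomial, map_smul, MvPolynomial.coeff_monomial]
    change c • Bialgebra.counitAlgHom ℂ (Env su2Star) _ = _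
    simp only [map_mul, map_pow, hx]
    split_ifs with h
    · simp [h]
    · have : ∃ a, n a ≠ 0 := by
        by_contra! hn
        exact h (Finsupp.ext hn)
      obtain ⟨a, ha⟩ := this
      fin_cases a <;> simp_all

/-- Pairing with `φ P_a` is pairing `φ` with `i :∂_a f:`, so the polynomials killed by all functions
are closed under partial derivatives. Pairing with `1` is the counit and reads off the constant
term; differentiating first reaches every other coefficient. Both injectivity of normal ordering and
non-degeneracy on `U(su₂⋆)` follow. -/
theorem eq_zero_of_pairing_normalOrder (lam : ℝ) (hl : lam ≠ 0) (f : MvPolynomial (Fin 3) ℂ)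
    (hf : ∀ φ, pairing φ (normalOrder lam f) = 0) : f = 0 := by
  have key : ∀ (d : ℕ) (n : Fin 3 →₀ ℕ), n.degree = d → ∀ f : MvPolynomial (Fin 3) ℂ,
      (∀ φ, pairing φ (normalOrder lam f) = 0) → MvPolynomial.coeff n f = 0 := by
    intro d
    induction d with
    | zero =>
      intro n hn f hf
      rw [(Finsupp.degree_eq_zero_iff n).1 hn, ← counit_normalOrder lam, ← pairing_one_left]
      exact hf 1
    | succ d ih =>
      intro n hn f hf
      have : ∃ a, n a ≠ 0 := by
        by_contra! h
        rw [show n = 0 from Finsupp.ext h] at hn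
        simp at hn
      obtain ⟨a, ha⟩ := this
      have hna : n - Finsupp.single a 1 + Finsupp.single a 1 = n :=
        tsub_add_cancel_of_le (Finsupp.single_le_iff.2 (Nat.one_le_iff_ne_zero.2 ha))
      have hd : (n - Finsupp.single a 1).degree = d := by
        have := congrArg Finsupp.degree hna
        rw [map_add, Finsupp.degree_single, hn] at this
        omega
      -- The induction on the degree of the exponent lets `f` vary, so that it applies to the
      -- derivative.
      have h := ih _ hd (MvPolynomial.pderiv a f) (fun φ => by
        have h := hf (φ * P lam a)
        rw [← pairing_coregular pairing_mul_left, coregular_P_normalOrder lam hl, map_smul,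
          smul_eq_mul] at h
        exact (mul_eq_zero.1 h).resolve_left Complex.I_ne_zero)
      rw [MvPolynomial.coeff_pderiv, hna] at h
      refine (mul_eq_zero.1 h).resolve_right ?_
      exact Nat.cast_add_one_ne_zero _
  ext n
  rw [MvPolynomial.coeff_zero]
  exact key _ n rfl f hf

theorem normalOrder_bijective (lam : ℝ) (hl : lam ≠ 0) :
    Function.Bijective (normalOrder lam) := by
  refine ⟨(injective_iff_map_eq_zero _).2 fun f hf => ?_, normalOrder_surjective lam hl⟩
  exact eq_zero_of_pairing_normalOrder lam hl f fun φ => by rw [hf, map_zero]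

theorem pairing_separatingRight : pairing.SeparatingRight := by
  intro h hh
  obtain ⟨f, rfl⟩ := normalOrder_surjective 1 one_ne_zero h
  rw [eq_zero_of_pairing_normalOrder 1 one_ne_zero f hh, map_zero]

theorem isHopfPairing : IsHopfPairing pairing where
  mul_left := pairing_mul_left
  one_left := pairing_one_left
  mul_right := pairing_mul_right
  one_right := pairing_one_right
  antipode := pairing_antipode pairing_mul_left pairing_one_left pairing_mul_right pairing_one_right
  separatingLeft := pairing_separatingLeft
  separatingRight := pairing_separatingRight

end Iwasawa


namespace Iwasawa

open Matrix ComplexConjugate Semidual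

/-! ### The factorisation of `U(sl₂)` -/

/-- Addition in `Fin 3` is cyclic, which packs the three bracket relations into one. -/
theorem rotBasis_lie (a : Fin 3) : ⁅rotBasis a, rotBasis (a + 1)⁆ = rotBasis (a + 2) := by
  apply Subtype.ext
  change ⁅(rotBasis a).1, (rotBasis (a + 1)).1⁆ = (rotBasis (a + 2)).1
  rw [LieRing.of_associative_ring_bracket]
  fin_cases a
  · change (rotBasis 0).1 * (rotBasis 1).1 - (rotBasis 1).1 * (rotBasis 0).1 = (rotBasis 2).1
    ext r s
    fin_cases r <;> fin_cases s <;> simp [rotBasis] <;> ring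
  · change (rotBasis 1).1 * (rotBasis 2).1 - (rotBasis 2).1 * (rotBasis 1).1 = (rotBasis 0).1
    ext r s
    fin_cases r <;> fin_cases s <;> simp [rotBasis] <;> ring
  · change (rotBasis 2).1 * (rotBasis 0).1 - (rotBasis 0).1 * (rotBasis 2).1 = (rotBasis 1).1
    ext r s
    fin_cases r <;> fin_cases s <;> simp [rotBasis]
    · linear_combination (2⁻¹ : ℂ) * Complex.I_sq
    · linear_combination -(2⁻¹ : ℂ) * Complex.I_sq

theorem toEnv_rotBasis_comm :
    toEnv 1 (rotBasis 1) * toEnv 1 (rotBasis 0) =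
      toEnv 1 (rotBasis 0) * toEnv 1 (rotBasis 1) - toEnv 1 (rotBasis 2) ∧
    toEnv 1 (rotBasis 2) * toEnv 1 (rotBasis 1) =
      toEnv 1 (rotBasis 1) * toEnv 1 (rotBasis 2) - toEnv 1 (rotBasis 0) ∧
    toEnv 1 (rotBasis 2) * toEnv 1 (rotBasis 0) =
      toEnv 1 (rotBasis 0) * toEnv 1 (rotBasis 2) + toEnv 1 (rotBasis 1) := by
  have h₀ := rotBasis_lie 0
  have h₁ := rotBasis_lie 1
  have h₂ := rotBasis_lie 2
  have h₃ := (toEnv_lie (rotBasis 0) (rotBasis 1)).symm.trans (congrArg (toEnv 1) h₀)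
  have h₄ := (toEnv_lie (rotBasis 1) (rotBasis 2)).symm.trans (congrArg (toEnv 1) h₁)
  have h₅ := (toEnv_lie (rotBasis 2) (rotBasis 0)).symm.trans (congrArg (toEnv 1) h₂)
  have h₆ : toEnv 1 (rotBasis (0 + 2)) = toEnv 1 (rotBasis 2) := rfl
  have h₇ : toEnv 1 (rotBasis (1 + 2)) = toEnv 1 (rotBasis 0) := rfl
  have h₈ : toEnv 1 (rotBasis (2 + 2)) = toEnv 1 (rotBasis 1) := rfl
  refine ⟨?_, ?_, ?_⟩
  · rw [← h₆, ← h₃]; abel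
  · rw [← h₇, ← h₄]; abel
  · rw [← h₈, ← h₅]; abel

/-- The `su₂`-part of `g⁻¹ M g`, as a function of `g ∈ SU₂⋆` with values in `U(su₂)`. -/
def rotElt (M : Matrix (Fin 2) (Fin 2) ℂ) : FunSU2Star ⊗[ℂ] Env su2 :=
  ∑ k, rotCoeff M k ⊗ₜ toEnv 1 (rotBasis k)

theorem rotElt_of_su2Star (X : su2Star) : rotElt X.1 = 0 := by
  simp [rotElt, rotCoeff_of_su2Star]

theorem rotCoeff_add (M N : Matrix (Fin 2) (Fin 2) ℂ) (k : Fin 3) :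
    rotCoeff (M + N) k = rotCoeff M k + rotCoeff N k := by
  rw [toFun_injective_iff]
  intro g
  rw [map_add, Pi.add_apply]
  fin_cases k
  · refine (toFun_rotCoeff_zero _ g).trans (Eq.trans ?_ (congrArg₂ (· + ·)
      (toFun_rotCoeff_zero M g) (toFun_rotCoeff_zero N g)).symm)
    simp only [Matrix.add_apply, map_add]
    ring
  · refine (toFun_rotCoeff_one _ g).trans (Eq.trans ?_ (congrArg₂ (· + ·)
      (toFun_rotCoeff_one M g) (toFun_rotCoeff_one N g)).symm)
    simp only [Matrix.add_apply, map_add]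
    ring
  · refine (toFun_rotCoeff_two _ g).trans (Eq.trans ?_ (congrArg₂ (· + ·)
      (toFun_rotCoeff_two M g) (toFun_rotCoeff_two N g)).symm)
    simp only [Matrix.add_apply, map_add]
    ring

theorem rotCoeff_smul (r : ℝ) (M : Matrix (Fin 2) (Fin 2) ℂ) (k : Fin 3) :
    rotCoeff (r • M) k = (r : ℂ) • rotCoeff M k := by
  rw [toFun_injective_iff]
  intro g
  rw [map_smul, Pi.smul_apply, smul_eq_mul]
  fin_cases k
  · refine (toFun_rotCoeff_zero _ g).trans (Eq.trans ?_ (congrArg ((r : ℂ) * ·)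
      (toFun_rotCoeff_zero M g)).symm)
    simp
    ring
  · refine (toFun_rotCoeff_one _ g).trans (Eq.trans ?_ (congrArg ((r : ℂ) * ·)
      (toFun_rotCoeff_one M g)).symm)
    simp
    ring
  · refine (toFun_rotCoeff_two _ g).trans (Eq.trans ?_ (congrArg ((r : ℂ) * ·)
      (toFun_rotCoeff_two M g)).symm)
    simp
    ring

theorem rotElt_add (M N : Matrix (Fin 2) (Fin 2) ℂ) : rotElt (M + N) = rotElt M + rotElt N := by
  simp only [rotElt, rotCoeff_add, TensorProduct.add_tmul, Finset.sum_add_distrib]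

theorem rotElt_smul (r : ℝ) (M : Matrix (Fin 2) (Fin 2) ℂ) :
    rotElt (r • M) = (r : ℂ) • rotElt M := by
  simp only [rotElt, rotCoeff_smul, ← TensorProduct.smul_tmul', Finset.smul_sum]

/-- The cross product in the coefficient identities becomes a commutator once the coefficients are
attached to the basis, since functions commute and the basis satisfies the cyclic bracket relations.
-/
theorem rotElt_lie {M N : Matrix (Fin 2) (Fin 2) ℂ} (hM : M.trace = 0) (hN : N.trace = 0) :
    rotElt ⁅M, N⁆ =
      LinearMap.rTensor _ (dressing N : FunSU2Star →ₗ[ℂ] FunSU2Star) (rotElt M) -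
      LinearMap.rTensor _ (dressing M : FunSU2Star →ₗ[ℂ] FunSU2Star) (rotElt N) +
      (rotElt M * rotElt N - rotElt N * rotElt M) := by
  obtain ⟨h₀, h₁, h₂⟩ := toEnv_rotBasis_comm
  simp only [rotElt, Fin.sum_univ_three, rotCoeff_lie_zero hM hN, rotCoeff_lie_one hM hN,
    rotCoeff_lie_two hM hN, map_add, LinearMap.rTensor_tmul, add_mul, mul_add,
    Algebra.TensorProduct.tmul_mul_tmul, h₀, h₁, h₂, TensorProduct.add_tmul,
    TensorProduct.sub_tmul, TensorProduct.tmul_add, TensorProduct.tmul_sub,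
    mul_comm (rotCoeff N _) (rotCoeff M _), Derivation.coeFn_coe]
  abel

theorem rTensor_dressing_add (M N : Matrix (Fin 2) (Fin 2) ℂ) (v : FunSU2Star ⊗[ℂ] Env su2) :
    LinearMap.rTensor (Env su2) (dressing (M + N) : FunSU2Star →ₗ[ℂ] FunSU2Star) v =
      LinearMap.rTensor _ (dressing M : FunSU2Star →ₗ[ℂ] FunSU2Star) v +
      LinearMap.rTensor _ (dressing N : FunSU2Star →ₗ[ℂ] FunSU2Star) v := by
  have h : (dressing (M + N) : FunSU2Star →ₗ[ℂ] FunSU2Star) = dressing M + dressing N :=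
    LinearMap.ext (dressing_add M N)
  rw [h, LinearMap.rTensor_add, LinearMap.add_apply]

theorem rTensor_dressing_smul (r : ℝ) (M : Matrix (Fin 2) (Fin 2) ℂ)
    (v : FunSU2Star ⊗[ℂ] Env su2) :
    LinearMap.rTensor (Env su2) (dressing (r • M) : FunSU2Star →ₗ[ℂ] FunSU2Star) v =
      (r : ℂ) • LinearMap.rTensor _ (dressing M : FunSU2Star →ₗ[ℂ] FunSU2Star) v := by
  have h : (dressing (r • M) : FunSU2Star →ₗ[ℂ] FunSU2Star) = (r : ℂ) • dressing M :=
    LinearMap.ext (dressing_smul r M)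
  rw [h, LinearMap.rTensor_smul, LinearMap.smul_apply]

theorem rTensor_dressing_lie {M N : Matrix (Fin 2) (Fin 2) ℂ} (hM : M.trace = 0)
    (hN : N.trace = 0) (v : FunSU2Star ⊗[ℂ] Env su2) :
    LinearMap.rTensor (Env su2) (dressing ⁅M, N⁆ : FunSU2Star →ₗ[ℂ] FunSU2Star) v =
      LinearMap.rTensor _ (dressing N : FunSU2Star →ₗ[ℂ] FunSU2Star)
        (LinearMap.rTensor _ (dressing M : FunSU2Star →ₗ[ℂ] FunSU2Star) v) -
      LinearMap.rTensor _ (dressing M : FunSU2Star →ₗ[ℂ] FunSU2Star)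
        (LinearMap.rTensor _ (dressing N : FunSU2Star →ₗ[ℂ] FunSU2Star) v) := by
  induction v with
  | zero => simp only [map_zero, sub_zero]
  | add v w hv hw => simp only [map_add, hv, hw]; abel
  | tmul φ a =>
    simp only [LinearMap.rTensor_tmul, Derivation.coeFn_coe, dressing_lie hM hN,
      TensorProduct.sub_tmul]

/-- The vector field of `M` on `ℂ[SU₂⋆] ⊗ U(su₂)`, twisted by `rotElt M`. -/
def twistedOp (M : Matrix (Fin 2) (Fin 2) ℂ) : Module.End ℂ (FunSU2Star ⊗[ℂ] Env su2) :=
  LinearMap.rTensor _ (dressing M : FunSU2Star →ₗ[ℂ] FunSU2Star) + LinearMap.mulRight ℂ (rotElt M)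

theorem twistedOp_apply (M : Matrix (Fin 2) (Fin 2) ℂ) (v : FunSU2Star ⊗[ℂ] Env su2) :
    twistedOp M v = LinearMap.rTensor _ (dressing M : FunSU2Star →ₗ[ℂ] FunSU2Star) v +
      v * rotElt M := rfl

/-- These operators model functions on `SL₂(ℂ)` with values in `U(su₂)` that are equivariant under
`SU₂` on the right, moved by left translation. The cocycle identity is exactly what cancels the
terms beyond the bracket of the fields. -/
theorem twistedOp_lie {M N : Matrix (Fin 2) (Fin 2) ℂ} (hM : M.trace = 0) (hN : N.trace = 0) :
    twistedOp ⁅M, N⁆ = twistedOp N * twistedOp M - twistedOp M * twistedOp N := by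
  apply LinearMap.ext
  intro v
  rw [LinearMap.sub_apply, Module.End.mul_apply, Module.End.mul_apply]
  simp only [twistedOp_apply, rTensor_dressing_lie hM hN, rotElt_lie hM hN, map_add,
    rTensor_leibniz]
  generalize LinearMap.rTensor _ (dressing N : FunSU2Star →ₗ[ℂ] FunSU2Star)
    (LinearMap.rTensor _ (dressing M : FunSU2Star →ₗ[ℂ] FunSU2Star) v) = v₁
  generalize LinearMap.rTensor _ (dressing M : FunSU2Star →ₗ[ℂ] FunSU2Star)
    (LinearMap.rTensor _ (dressing N : FunSU2Star →ₗ[ℂ] FunSU2Star) v) = v₂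
  generalize LinearMap.rTensor _ (dressing M : FunSU2Star →ₗ[ℂ] FunSU2Star) v = v₃
  generalize LinearMap.rTensor _ (dressing N : FunSU2Star →ₗ[ℂ] FunSU2Star) v = v₄
  generalize LinearMap.rTensor _ (dressing M : FunSU2Star →ₗ[ℂ] FunSU2Star) (rotElt N) = v₅
  generalize LinearMap.rTensor _ (dressing N : FunSU2Star →ₗ[ℂ] FunSU2Star) (rotElt M) = v₆
  simp only [mul_add, mul_sub, mul_assoc]
  abel

/-- The right action of `U(sl₂)` on `ℂ[SU₂⋆] ⊗ U(su₂)` by the operators `twistedOp`. -/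
def twisted : FunSU2Star ⊗[ℂ] Env su2 →ₗ[ℂ] Env sl2 →ₗ[ℂ] FunSU2Star ⊗[ℂ] Env su2 :=
  envRightModule (fun M : sl2 => twistedOp M.1)
    (fun M N => by
      apply LinearMap.ext
      intro v
      rw [LinearMap.add_apply, twistedOp_apply, twistedOp_apply, twistedOp_apply]
      refine (congrArg₂ (· + ·) (rTensor_dressing_add M.1 N.1 v)
        (congrArg (v * ·) (rotElt_add M.1 N.1))).trans ?_
      rw [mul_add]
      abel)
    (fun r M => by
      apply LinearMap.ext
      intro v
      rw [LinearMap.smul_apply, twistedOp_apply, twistedOp_apply]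
      refine (congrArg₂ (· + ·) (rTensor_dressing_smul r M.1 v)
        (congrArg (v * ·) (rotElt_smul r M.1))).trans ?_
      rw [mul_smul_comm, smul_add])
    (fun M N => twistedOp_lie M.2 N.2)

theorem twisted_one (v : FunSU2Star ⊗[ℂ] Env su2) : twisted v 1 = v := envRightModule_one _ _ _ _ _

theorem twisted_mul (v : FunSU2Star ⊗[ℂ] Env su2) (a b : Env sl2) :
    twisted v (a * b) = twisted (twisted v a) b := envRightModule_mul _ _ _ _ _ _ _

theorem twisted_toEnv (v : FunSU2Star ⊗[ℂ] Env su2) (M : sl2) : twisted v (toEnv 1 M) =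
    LinearMap.rTensor _ (dressing M.1 : FunSU2Star →ₗ[ℂ] FunSU2Star) v + v * rotElt M.1 :=
  envRightModule_toEnv _ _ _ _ _ _

theorem twisted_inclSU2Star (v : FunSU2Star ⊗[ℂ] Env su2) (h : Env su2Star) :
    twisted v (inclSU2Star h) = LinearMap.rTensor _ (dressingStar.act.flip h) v := by
  induction h using env_induction_right with
  | one =>
    have : dressingStar.act.flip 1 = LinearMap.id :=
      LinearMap.ext fun φ => DerAction.act_one _ φ
    rw [map_one inclSU2Star, twisted_one, this, LinearMap.rTensor_id]
    rfl
  | add u w hu hw => simp only [map_add, hu, hw, LinearMap.rTensor_add, LinearMap.add_apply]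
  | smul c u hu => simp only [map_smul, hu, LinearMap.rTensor_smul, LinearMap.smul_apply]
  | mul u X hu =>
    rw [map_mul, twisted_mul, hu, inclSU2Star_toEnv, twisted_toEnv]
    have h₁ : rotElt (LieSubalgebra.inclusion su2Star_le X).1 = 0 := rotElt_of_su2Star X
    have h₂ : dressingStar.act.flip (u * toEnv 1 X) =
        (dressing (LieSubalgebra.inclusion su2Star_le X).1 : FunSU2Star →ₗ[ℂ] FunSU2Star) ∘ₗ
          dressingStar.act.flip u := by
      apply LinearMap.ext
      intro φ
      simp only [LinearMap.flip_apply, LinearMap.comp_apply, DerAction.act_mul, DerAction.act_toEnv]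
      rfl
    rw [h₁, mul_zero, add_zero, h₂, LinearMap.rTensor_comp, LinearMap.comp_apply]

/-- Evaluation at the identity, `φ ⊗ a ↦ ε(φ) a`. -/
def evalOne : FunSU2Star ⊗[ℂ] Env su2 →ₐ[ℂ] Env su2 :=
  (Algebra.TensorProduct.lid ℂ (Env su2)).toAlgHom.comp
    (Algebra.TensorProduct.map (Bialgebra.counitAlgHom ℂ FunSU2Star) (AlgHom.id ℂ (Env su2)))

theorem evalOne_tmul (φ : FunSU2Star) (a : Env su2) :
    evalOne (φ ⊗ₜ a) = Coalgebra.counit (R := ℂ) φ • a := by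
  simp [evalOne]

/-- `SU₂` fixes the identity of `SU₂⋆`, so its fields vanish there. -/
theorem counit_dressing_su2 (Y : su2) (φ : FunSU2Star) :
    Coalgebra.counit (R := ℂ) (dressing Y.1 φ) = 0 := by
  have h := Y.2.2
  have h₀₀ : conj (Y.1 0 0) = -Y.1 0 0 := congrFun (congrFun h 0) 0
  have h₀₁ : conj (Y.1 0 1) = -Y.1 1 0 := congrFun (congrFun h 1) 0
  have hre : (Y.1 0 0).re = 0 := by
    have := congrArg Complex.re h₀₀
    simp only [Complex.conj_re, Complex.neg_re] at this
    linarith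
  have hv : velocity Y.1 1 = 0 := by
    ext1
    · simp [velocity, hre]
    · simp [velocity, h₀₁]
  rw [counit_fun_eq, toFun_dressing, vectorField, hv, map_zero]

theorem evalOne_rTensor_dressing_su2 (Y : su2) (v : FunSU2Star ⊗[ℂ] Env su2) :
    evalOne (LinearMap.rTensor _ (dressing Y.1 : FunSU2Star →ₗ[ℂ] FunSU2Star) v) = 0 := by
  induction v with
  | zero => simp
  | add v w hv hw => simp only [map_add, hv, hw, add_zero]
  | tmul φ a =>
    rw [LinearMap.rTensor_tmul, evalOne_tmul, Derivation.coeFn_coe, counit_dressing_su2, zero_smul]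

theorem evalOne_rotElt (Y : su2) : evalOne (rotElt Y.1) = toEnv 1 Y := by
  have h := Y.2.2
  have h₀₀ : conj (Y.1 0 0) = -Y.1 0 0 := congrFun (congrFun h 0) 0
  have h₀₁ : conj (Y.1 0 1) = -Y.1 1 0 := congrFun (congrFun h 1) 0
  have h₁₁ : Y.1 1 1 = -Y.1 0 0 := by
    have := Y.2.1
    rw [Matrix.trace_fin_two] at this
    linear_combination this
  have hre : (Y.1 0 0).re = 0 := by
    have := congrArg Complex.re h₀₀
    simp only [Complex.conj_re, Complex.neg_re] at this
    linarith
  have hY : Y = (-(2 * (Y.1 0 1).im)) • rotBasis 0 + (-(2 * (Y.1 0 1).re)) • rotBasis 1 +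
      (-(2 * (Y.1 0 0).im)) • rotBasis 2 := by
    apply Subtype.ext
    change Y.1 = (-(2 * (Y.1 0 1).im)) • (rotBasis 0).1 + (-(2 * (Y.1 0 1).re)) • (rotBasis 1).1 +
      (-(2 * (Y.1 0 0).im)) • (rotBasis 2).1
    have h₁₀ : Y.1 1 0 = -conj (Y.1 0 1) := by rw [h₀₁, neg_neg]
    ext r s
    fin_cases r <;> fin_cases s
    · apply Complex.ext <;> simp [rotBasis, hre] <;> ring
    · apply Complex.ext <;> simp [rotBasis] <;> ring
    · refine h₁₀.trans ?_
      apply Complex.ext <;> simp [rotBasis] <;> ring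
    · refine h₁₁.trans ?_
      apply Complex.ext <;> simp [rotBasis, hre] <;> ring
  have c₀ : Coalgebra.counit (R := ℂ) (rotCoeff Y.1 0) = ((-(2 * (Y.1 0 1).im) : ℝ) : ℂ) := by
    rw [counit_fun_eq, toFun_rotCoeff_zero, Complex.sub_conj]
    have h₃ : (1 : SU2Star).1 1 1 = 1 := rfl
    rw [h₃]
    push_cast
    linear_combination (2 * (Y.1 0 1).im : ℂ) * Complex.I_sq
  have c₁ : Coalgebra.counit (R := ℂ) (rotCoeff Y.1 1) = ((-(2 * (Y.1 0 1).re) : ℝ) : ℂ) := by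
    rw [counit_fun_eq, toFun_rotCoeff_one, Complex.add_conj]
    have h₃ : (1 : SU2Star).1 1 1 = 1 := rfl
    rw [h₃]
    push_cast
    ring
  have c₂ : Coalgebra.counit (R := ℂ) (rotCoeff Y.1 2) = ((-(2 * (Y.1 0 0).im) : ℝ) : ℂ) := by
    have h₂ : (1 : SU2Star).1 1 0 = 0 := rfl
    rw [counit_fun_eq, toFun_rotCoeff_two, Complex.sub_conj, h₂, map_zero]
    push_cast
    linear_combination (2 * (Y.1 0 0).im : ℂ) * Complex.I_sq
  conv_rhs => rw [hY]
  simp only [toEnv_add, toEnv_smul]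
  rw [rotElt, Fin.sum_univ_three, map_add, map_add, evalOne_tmul, evalOne_tmul, evalOne_tmul, c₀,
    c₁, c₂]

/-- At the identity the fields of `su₂` vanish and the `su₂`-part of `Y` is `Y` itself, so only
right multiplication by `Y` survives. -/
theorem evalOne_twisted_inclSU2 (v : FunSU2Star ⊗[ℂ] Env su2) (a : Env su2) :
    evalOne (twisted v (inclSU2 a)) = evalOne v * a := by
  induction a using env_induction_right with
  | one => rw [map_one, twisted_one, mul_one]
  | add u w hu hw => simp only [map_add, hu, hw, mul_add]
  | smul c u hu => simp only [map_smul, hu, mul_smul_comm]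
  | mul u Y hu =>
    rw [map_mul, twisted_mul, inclSU2_toEnv, twisted_toEnv, map_add, map_mul, hu]
    have h₁ := evalOne_rTensor_dressing_su2 Y (twisted v (inclSU2 u))
    have h₂ := evalOne_rotElt Y
    refine (congrArg₂ (· + ·) h₁ (congrArg (evalOne v * u * ·) h₂)).trans ?_
    rw [zero_add, mul_assoc]

/-- The detecting functional: it sees a product `h a` in `U(sl₂)` as `⟨φ, h⟩ a`, which separates the
two factors. Injectivity of multiplication and the formula for the coaction both rest on it. -/
theorem evalOne_twisted_tmul (φ : FunSU2Star) (h : Env su2Star) (a : Env su2) :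
    evalOne (twisted (φ ⊗ₜ 1) (inclSU2Star h * inclSU2 a)) = pairing φ h • a := by
  rw [twisted_mul, evalOne_twisted_inclSU2, twisted_inclSU2Star, LinearMap.rTensor_tmul,
    evalOne_tmul, smul_mul_assoc, one_mul]
  rfl

/-- Elements of `U(su₂⋆)` are functions of `φ` through the pairing and elements of `U(su₂)` are
functions on the linear dual, both faithfully. A tensor is then determined by a function of two
variables, whose values are computed from its image in `U(sl₂)`. -/
theorem mulMap_injective : Function.Injective (mulMap inclSU2Star inclSU2) := by
  rw [injective_iff_map_eq_zero]
  intro t ht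
  let f : Env su2Star →ₗ[ℂ] (FunSU2Star → ℂ) := LinearMap.pi fun φ => pairing φ
  let g : Env su2 →ₗ[ℂ] (Module.Dual ℂ (Env su2) → ℂ) := LinearMap.pi fun ξ => ξ
  have hf : Function.Injective f := by
    rw [injective_iff_map_eq_zero]
    exact fun h hh => pairing_separatingRight h fun φ => congrFun hh φ
  have hg : Function.Injective g := by
    rw [injective_iff_map_eq_zero]
    exact fun a ha => (Module.forall_dual_apply_eq_zero_iff ℂ a).1 fun ξ => congrFun ha ξ
  apply evalTensor_injective f g hf hg
  rw [map_zero]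
  funext ⟨φ, ξ⟩
  have key : ∀ t, evalTensor f g t (φ, ξ) =
      ξ (evalOne (twisted (φ ⊗ₜ 1) (mulMap inclSU2Star inclSU2 t))) := by
    intro t
    induction t with
    | zero => simp
    | add s t hs ht => simp only [map_add, Pi.add_apply, hs, ht]
    | tmul h a =>
      rw [evalTensor_tmul, mulMap_tmul, evalOne_twisted_tmul, map_smul]
      rfl
  rw [key, ht, map_zero, map_zero, map_zero]
  rfl

theorem exists_sl2_decomposition (M : sl2) : ∃ (X : su2Star) (Y : su2),
    M = LieSubalgebra.inclusion su2Star_le X + LieSubalgebra.inclusion su2_le Y := by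
  have h₁₁ : M.1 1 1 = -M.1 0 0 := by
    have := M.2
    change M.1.trace = 0 at this
    rw [Matrix.trace_fin_two] at this
    linear_combination this
  have hre := Complex.re_add_im (M.1 0 0)
  -- The upper right entry must come from `su₂`, which forces its lower left entry; `su₂⋆` absorbs
  -- the difference. On the diagonal, the real part goes to `su₂⋆` and the imaginary part to `su₂`.
  refine ⟨su2Star.mk (M.1 0 0).re (M.1 1 0 + conj (M.1 0 1)),
    ⟨!![(M.1 0 0).im * Complex.I, M.1 0 1; -conj (M.1 0 1), -((M.1 0 0).im * Complex.I)],
      by simp [Matrix.trace_fin_two], ?_⟩, ?_⟩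
  · ext r s
    fin_cases r <;> fin_cases s <;> simp
  · apply Subtype.ext
    change M.1 = !![((M.1 0 0).re : ℂ), 0; M.1 1 0 + conj (M.1 0 1), -((M.1 0 0).re : ℂ)] +
      !![(M.1 0 0).im * Complex.I, M.1 0 1; -conj (M.1 0 1), -((M.1 0 0).im * Complex.I)]
    ext r s
    fin_cases r <;> fin_cases s <;> simp
    · rw [h₁₁]; nth_rw 1 [← hre]; ring

/-- The range is stable under left multiplication by `su₂⋆` at once, and by `su₂` after moving `Y`
through the factors of `h`; each exchange leaves a bracket that splits again into the two Lie
algebras. -/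
theorem mulMap_surjective : Function.Surjective (mulMap inclSU2Star inclSU2) := by
  set R := LinearMap.range (mulMap inclSU2Star inclSU2) with hR
  have mem : ∀ h a, inclSU2Star h * inclSU2 a ∈ R := fun h a => ⟨h ⊗ₜ a, mulMap_tmul h a⟩
  have hX : ∀ (X : su2Star), ∀ t ∈ R, toEnv 1 (LieSubalgebra.inclusion su2Star_le X) * t ∈ R := by
    rintro X _ ⟨t, rfl⟩
    induction t with
    | zero => simp
    | add s t hs ht => rw [map_add, mul_add]; exact add_mem hs ht
    | tmul h a =>
      rw [mulMap_tmul, ← mul_assoc, ← inclSU2Star_toEnv, ← map_mul]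
      exact mem _ _
  -- `Y` stays universally quantified during the induction on `h`, because the bracket produces a
  -- new element `Y'` of `su₂`.
  have hY : ∀ (h : Env su2Star) (Y : su2) (a : Env su2),
      toEnv 1 (LieSubalgebra.inclusion su2_le Y) * (inclSU2Star h * inclSU2 a) ∈ R := by
    intro h
    induction h using env_induction_left with
    | one =>
      intro Y a
      have := mem 1 (toEnv 1 Y * a)
      rwa [map_one, one_mul, map_mul, inclSU2_toEnv, ← one_mul (inclSU2 a),
        ← map_one inclSU2Star] at this
    | add u w hu hw =>
      intro Y a
      rw [map_add, add_mul, mul_add]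
      exact add_mem (hu Y a) (hw Y a)
    | smul c u hu =>
      intro Y a
      rw [map_smul, smul_mul_assoc, mul_smul_comm]
      exact Submodule.smul_mem _ _ (hu Y a)
    | mul u X hu =>
      intro Y a
      obtain ⟨X', Y', h'⟩ := exists_sl2_decomposition
        ⁅LieSubalgebra.inclusion su2_le Y, LieSubalgebra.inclusion su2Star_le X⁆
      have hc := toEnv_lie (LieSubalgebra.inclusion su2_le Y) (LieSubalgebra.inclusion su2Star_le X)
      rw [h', toEnv_add] at hc
      have e : toEnv 1 (LieSubalgebra.inclusion su2_le Y) *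
          (inclSU2Star (toEnv 1 X * u) * inclSU2 a) =
          toEnv 1 (LieSubalgebra.inclusion su2Star_le X) *
            (toEnv 1 (LieSubalgebra.inclusion su2_le Y) * (inclSU2Star u * inclSU2 a)) +
          (toEnv 1 (LieSubalgebra.inclusion su2Star_le X') * (inclSU2Star u * inclSU2 a) +
          toEnv 1 (LieSubalgebra.inclusion su2_le Y') * (inclSU2Star u * inclSU2 a)) := by
        rw [← add_mul, hc, map_mul, inclSU2Star_toEnv]
        noncomm_ring
      rw [e]
      exact add_mem (hX X _ (hu Y a)) (add_mem (hX X' _ (mem _ _)) (hu Y' a))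
  have hY' : ∀ (Y : su2), ∀ t ∈ R, toEnv 1 (LieSubalgebra.inclusion su2_le Y) * t ∈ R := by
    rintro Y _ ⟨t, rfl⟩
    induction t with
    | zero => simp
    | add s t hs ht => rw [map_add, mul_add]; exact add_mem hs ht
    | tmul h a => rw [mulMap_tmul]; exact hY h Y a
  intro t
  change t ∈ R
  induction t using env_induction_left with
  | one => have := mem 1 1; rwa [map_one, map_one, one_mul] at this
  | add u w hu hw => exact add_mem hu hw
  | smul c u hu => exact Submodule.smul_mem _ _ hu
  | mul u M hu =>
    obtain ⟨X, Y, rfl⟩ := exists_sl2_decomposition M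
    rw [toEnv_add, add_mul]
    exact add_mem (hX X u hu) (hY' Y u hu)

theorem isFactorisation : IsFactorisation inclSU2Star inclSU2 := by
  refine ⟨fun h g e => ?_, fun a b e => ?_, mulMap_injective, mulMap_surjective⟩
  · have : h ⊗ₜ[ℂ] (1 : Env su2) = g ⊗ₜ 1 := by
      apply mulMap_injective
      rw [mulMap_tmul, mulMap_tmul, e]
    simpa using congrArg (fun t => TensorProduct.rid ℂ _
      (LinearMap.lTensor (Env su2Star) (Coalgebra.counit (R := ℂ)) t)) this
  · have : (1 : Env su2Star) ⊗ₜ[ℂ] a = 1 ⊗ₜ b := by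
      apply mulMap_injective
      rw [mulMap_tmul, mulMap_tmul, e]
    simpa using congrArg (fun t => TensorProduct.lid ℂ _
      (LinearMap.rTensor (Env su2) (Coalgebra.counit (R := ℂ)) t)) this

/-! ### The dual action and coaction -/

theorem counit_dressingSU2_act (φ : FunSU2Star) (a : Env su2) :
    Coalgebra.counit (R := ℂ) (dressingSU2.act φ a) =
      Coalgebra.counit (R := ℂ) a * Coalgebra.counit (R := ℂ) φ := by
  induction a using env_induction_right with
  | one => rw [DerAction.act_one, Bialgebra.counit_one, one_mul]
  | add u w hu hw => simp only [map_add, hu, hw, add_mul]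
  | smul c u hu => simp only [map_smul, hu, smul_mul_assoc]
  | mul u Y hu =>
    rw [DerAction.act_mul, DerAction.act_toEnv, Bialgebra.counit_mul, counit_toEnv, mul_zero,
      zero_mul]
    exact counit_dressing_su2 Y _

/-- On `h a` the factor `a` acts last and contributes only its counit at the identity. Applying this
to `t = a h` and letting `a` act on `φ` first shows that `◁` is dual to `▷`. -/
theorem counit_dressingSl2_act (φ : FunSU2Star) (t : Env sl2) :
    Coalgebra.counit (R := ℂ) (dressingSl2.act φ t) = pairing φ (proj₁ isFactorisation t) := by
  induction t using factor_induction isFactorisation with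
  | add x y hx hy => simp only [map_add, hx, hy]
  | mul h a =>
    rw [proj₁_mul, map_smul, DerAction.act_mul, dressingSl2_act_inclSU2Star,
      dressingSl2_act_inclSU2, counit_dressingSU2_act, smul_eq_mul, pairing_apply]

theorem isDualAction : IsDualAction isFactorisation pairing dressingSU2.act := by
  intro φ a h
  rw [lact_eq, ← counit_dressingSl2_act, DerAction.act_mul, dressingSl2_act_inclSU2,
    dressingSl2_act_inclSU2Star]
  rfl

/-- The coaction of `ℂ[SU₂⋆]` on `U(su₂)`. -/
def coaction : Env su2 →ₗ[ℂ] FunSU2Star ⊗[ℂ] Env su2 :=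
  twisted 1 ∘ₗ (inclSU2 : Env su2 →ₗ[ℂ] Env sl2)

theorem coaction_apply (a : Env su2) : coaction a = twisted 1 (inclSU2 a) := rfl

theorem coaction_one : coaction 1 = 1 := by
  rw [coaction_apply, map_one inclSU2, twisted_one]

theorem coaction_mul_toEnv (a : Env su2) (Y : su2) : coaction (a * toEnv 1 Y) =
    LinearMap.rTensor _ (dressing Y.1 : FunSU2Star →ₗ[ℂ] FunSU2Star) (coaction a) +
      coaction a * rotElt Y.1 := by
  rw [coaction_apply, map_mul, twisted_mul, inclSU2_toEnv, twisted_toEnv]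
  rfl

/-- The detecting functional at `φ = 1`, where the pairing is the counit. For `t = a h` it exhibits
`a ◁ h` as the evaluation of `(1 · a) · h`, so that `1 · a` is the coaction. -/
theorem proj₂_eq_evalOne (t : Env sl2) : proj₂ isFactorisation t = evalOne (twisted 1 t) := by
  induction t using factor_induction isFactorisation with
  | add x y hx hy => simp only [map_add, hx, hy]
  | mul h a =>
    rw [proj₂_mul, Algebra.TensorProduct.one_def, evalOne_twisted_tmul, pairing_one_left]

theorem isDualCoaction : IsDualCoaction isFactorisation pairing coaction := by
  intro a h
  rw [ract_eq, proj₂_eq_evalOne, twisted_mul, ← coaction_apply, twisted_inclSU2Star]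
  generalize coaction a = t
  induction t with
  | zero => simp
  | add s t hs ht => simp only [map_add, hs, ht]
  | tmul φ b =>
    rw [LinearMap.rTensor_tmul, evalOne_tmul, LinearMap.rTensor_tmul, TensorProduct.lid_tmul]
    rfl

end Iwasawa


/-- A bialgebra with an algebra anti-endomorphism that satisfies the axioms of an antipode on a set
of generators is a Hopf algebra. -/
abbrev HopfAlgebra.ofGenerators {k B : Type*} [CommRing k] [Ring B] [Bialgebra k B]
    (S : B →ₐ[k] Bᵐᵒᵖ) (s : Set B) (hs : Algebra.adjoin k s = ⊤)
    (hl : ∀ b ∈ s, LinearMap.mul' k B (LinearMap.rTensor B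
      ((MulOpposite.opLinearEquiv k).symm.toLinearMap ∘ₗ S.toLinearMap)
        (Coalgebra.comul (R := k) b)) = algebraMap k B (Coalgebra.counit (R := k) b))
    (hr : ∀ b ∈ s, LinearMap.mul' k B (LinearMap.lTensor B
      ((MulOpposite.opLinearEquiv k).symm.toLinearMap ∘ₗ S.toLinearMap)
        (Coalgebra.comul (R := k) b)) = algebraMap k B (Coalgebra.counit (R := k) b)) :
    HopfAlgebra k B where
  antipode := (MulOpposite.opLinearEquiv k).symm.toLinearMap ∘ₗ S.toLinearMap
  mul_antipode_rTensor_comul := by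
    set σ : B →ₗ[k] B := (MulOpposite.opLinearEquiv k).symm.toLinearMap ∘ₗ S.toLinearMap
    have hσ : ∀ u v, σ (u * v) = σ v * σ u := fun u v => by simp [σ]
    -- Since `σ` reverses products, multiplying `T` by `a ⊗ b` sandwiches the value of `T` between
    -- `σ a` and `b`; a scalar value can be pulled out, and the antipode axiom passes to products.
    have key : ∀ (c : k) (T : B ⊗[k] B), LinearMap.mul' k B (σ.rTensor B T) = algebraMap k _ c →
        ∀ W, LinearMap.mul' k B (σ.rTensor B (T * W)) =
          c • LinearMap.mul' k B (σ.rTensor B W) := by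
      intro c T hT W
      induction W with
      | zero => simp
      | add W₁ W₂ h₁ h₂ => simp only [mul_add, map_add, h₁, h₂, smul_add]
      | tmul a b =>
        have : LinearMap.mul' k B (σ.rTensor B (T * a ⊗ₜ[k] b)) =
            σ a * LinearMap.mul' k B (σ.rTensor B T) * b := by
          clear hT
          induction T with
          | zero => simp
          | add W₁ W₂ h₁ h₂ => simp only [add_mul, mul_add, map_add, h₁, h₂]
          | tmul s t => simp [hσ, mul_assoc]
        rw [this, hT]
        simp [Algebra.algebraMap_eq_smul_one]
    ext u
    have hu : u ∈ Algebra.adjoin k s := by rw [hs]; trivial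
    simp only [LinearMap.comp_apply, Algebra.linearMap_apply]
    induction hu using Algebra.adjoin_induction with
    | mem x hx => exact hl x hx
    | algebraMap r => simp [Algebra.algebraMap_eq_smul_one, Algebra.TensorProduct.one_def, σ]
    | add x y _ _ hx hy => simp only [map_add, hx, hy]
    | mul x y _ _ hx hy =>
      rw [Bialgebra.comul_mul, Bialgebra.counit_mul, key _ _ hx, hy, Algebra.smul_def, map_mul]
  mul_antipode_lTensor_comul := by
    set σ : B →ₗ[k] B := (MulOpposite.opLinearEquiv k).symm.toLinearMap ∘ₗ S.toLinearMap
    have hσ : ∀ u v, σ (u * v) = σ v * σ u := fun u v => by simp [σ]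
    have key : ∀ (c : k) (W : B ⊗[k] B), LinearMap.mul' k B (σ.lTensor B W) = algebraMap k _ c →
        ∀ T, LinearMap.mul' k B (σ.lTensor B (T * W)) =
          c • LinearMap.mul' k B (σ.lTensor B T) := by
      intro c W hW T
      induction T with
      | zero => simp
      | add W₁ W₂ h₁ h₂ => simp only [add_mul, map_add, h₁, h₂, smul_add]
      | tmul a b =>
        have : LinearMap.mul' k B (σ.lTensor B (a ⊗ₜ[k] b * W)) =
            a * LinearMap.mul' k B (σ.lTensor B W) * σ b := by
          clear hW
          induction W with
          | zero => simp
          | add W₁ W₂ h₁ h₂ => simp only [add_mul, mul_add, map_add, h₁, h₂]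
          | tmul s t => simp [hσ, mul_assoc]
        rw [this, hW]
        simp [Algebra.algebraMap_eq_smul_one]
    ext u
    have hu : u ∈ Algebra.adjoin k s := by rw [hs]; trivial
    simp only [LinearMap.comp_apply, Algebra.linearMap_apply]
    induction hu using Algebra.adjoin_induction with
    | mem x hx => exact hr x hx
    | algebraMap r => simp [Algebra.algebraMap_eq_smul_one, Algebra.TensorProduct.one_def, σ]
    | add x y _ _ hx hy => simp only [map_add, hx, hy]
    | mul x y _ _ hx hy =>
      rw [Bialgebra.comul_mul, Bialgebra.counit_mul, key _ _ hy, hx, Algebra.smul_def, map_mul,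
        Algebra.commutes]

namespace Iwasawa

open Matrix ComplexConjugate Semidual

theorem DerAction.adjoin_smash {L A : Type*} [LieRing L] [LieAlgebra ℝ L] [CommRing A]
    [Algebra ℂ A] (S : DerAction L A) : Algebra.adjoin ℂ
      (Set.range (fun X : L => S.smashInl (toEnv 1 X)) ∪ Set.range S.smashInr) = ⊤ := by
  rw [eq_top_iff]
  rintro u -
  induction u using S.smash_induction with
  | add u v hu hv => exact add_mem hu hv
  | tmul a φ =>
    rw [DerAction.smashEquiv_tmul]
    refine mul_mem ?_ (Algebra.subset_adjoin (.inr ⟨φ, rfl⟩))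
    induction a using env_induction_right with
    | one => rw [map_one]; exact one_mem _
    | add u v hu hv => rw [map_add]; exact add_mem hu hv
    | smul c u hu => rw [map_smul]; exact Subalgebra.smul_mem _ hu c
    | mul u X hu => rw [map_mul]; exact mul_mem hu (Algebra.subset_adjoin (.inl ⟨X, rfl⟩))

/-! ### The Hopf algebra structure of the bicrossproduct -/

/-- The algebra `U(su₂) ▷◂ ℂ[SU₂⋆]`. -/
abbrev Bicross : Type := dressingSU2.Smash

/-- The inclusion of `U(su₂)`. -/
abbrev bInl : Env su2 →ₐ[ℂ] Bicross := dressingSU2.smashInl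

/-- The inclusion of `ℂ[SU₂⋆]`. -/
abbrev bInr : FunSU2Star →ₐ[ℂ] Bicross := dressingSU2.smashInr

theorem bInr_mul_bInl (φ : FunSU2Star) (Y : su2) : bInr φ * bInl (toEnv 1 Y) =
    bInl (toEnv 1 Y) * bInr φ + bInr (dressing Y.1 φ) := dressingSU2.smashInr_mul_smashInl φ Y

/-- The map `φ ⊗ a ↦ φ ⊗ a` from `ℂ[SU₂⋆] ⊗ U(su₂)`. -/
def mixed : FunSU2Star ⊗[ℂ] Env su2 →ₐ[ℂ] Bicross ⊗[ℂ] Bicross :=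
  Algebra.TensorProduct.map bInr bInl

theorem mixed_tmul (φ : FunSU2Star) (a : Env su2) : mixed (φ ⊗ₜ a) = bInr φ ⊗ₜ bInl a := rfl

theorem mixed_mul (v : FunSU2Star ⊗[ℂ] Env su2) (Y : su2) :
    mixed v * (bInl (toEnv 1 Y) ⊗ₜ 1) = (bInl (toEnv 1 Y) ⊗ₜ 1) * mixed v +
      mixed (LinearMap.rTensor _ (dressing Y.1 : FunSU2Star →ₗ[ℂ] FunSU2Star) v) := by
  induction v with
  | zero => simp only [map_zero, zero_mul, mul_zero, add_zero]
  | add v w hv hw => simp only [map_add, add_mul, mul_add, hv, hw]; abel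
  | tmul φ a =>
    rw [LinearMap.rTensor_tmul, mixed_tmul, mixed_tmul, Algebra.TensorProduct.tmul_mul_tmul,
      Algebra.TensorProduct.tmul_mul_tmul, bInr_mul_bInl, mul_one, one_mul, TensorProduct.add_tmul]
    rfl

theorem commutator_add_eq {R : Type*} [Ring R] {x y a b p q : R} (h₁ : a * y = y * a + p)
    (h₂ : b * x = x * b + q) : (x + a) * (y + b) - (y + b) * (x + a) =
      (x * y - y * x) + (p - q + (a * b - b * a)) := by
  simp only [add_mul, mul_add, h₁, h₂]
  abel

/-- Commuting `Y ⊗ 1` past the functions in `rotElt X` differentiates them along `Y`. These cross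
terms, with the commutator of the two `rotElt`, make up the cocycle identity. -/
theorem mixed_rotElt_lie (X Y : su2) : bInl (toEnv 1 ⁅X, Y⁆) ⊗ₜ 1 + mixed (rotElt ⁅X, Y⁆.1) =
    (bInl (toEnv 1 X) ⊗ₜ 1 + mixed (rotElt X.1)) * (bInl (toEnv 1 Y) ⊗ₜ 1 + mixed (rotElt Y.1)) -
    (bInl (toEnv 1 Y) ⊗ₜ 1 + mixed (rotElt Y.1)) *
      (bInl (toEnv 1 X) ⊗ₜ 1 + mixed (rotElt X.1)) := by
  have h : mixed (rotElt ⁅X, Y⁆.1) = _ := congrArg mixed (rotElt_lie X.2.1 Y.2.1)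
  rw [map_add, map_sub, map_sub, map_mul, map_mul] at h
  have h₃ : bInl (toEnv 1 ⁅X, Y⁆) ⊗ₜ[ℂ] (1 : Bicross) =
      (bInl (toEnv 1 X) ⊗ₜ 1) * (bInl (toEnv 1 Y) ⊗ₜ 1) -
      (bInl (toEnv 1 Y) ⊗ₜ 1) * (bInl (toEnv 1 X) ⊗ₜ 1) := by
    rw [toEnv_lie, map_sub, map_mul, map_mul, TensorProduct.sub_tmul,
      Algebra.TensorProduct.tmul_mul_tmul, Algebra.TensorProduct.tmul_mul_tmul, mul_one]
  rw [h₃, h]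
  exact (commutator_add_eq (mixed_mul (rotElt X.1) Y) (mixed_mul (rotElt Y.1) X)).symm

/-- The coproduct on `U(su₂)`. -/
def bComulInl : Env su2 →ₐ[ℂ] Bicross ⊗[ℂ] Bicross :=
  envLift (fun Y : su2 => bInl (toEnv 1 Y) ⊗ₜ 1 + mixed (rotElt Y.1))
    (fun X Y => by
      rw [toEnv_add, map_add, TensorProduct.add_tmul]
      refine (congrArg (_ + ·) ((congrArg mixed (rotElt_add X.1 Y.1)).trans
        (map_add mixed _ _))).trans ?_
      abel)
    (fun r X => by
      rw [toEnv_smul, map_smul, ← TensorProduct.smul_tmul', smul_add]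
      exact congrArg (_ + ·) ((congrArg mixed (rotElt_smul r X.1)).trans (map_smul mixed _ _)))
    mixed_rotElt_lie

theorem bComulInl_toEnv (Y : su2) : bComulInl (toEnv 1 Y) =
    bInl (toEnv 1 Y) ⊗ₜ 1 + mixed (rotElt Y.1) := by
  rw [bComulInl, envLift_toEnv_one]

/-- The coproduct on `ℂ[SU₂⋆]`. -/
def bComulInr : FunSU2Star →ₐ[ℂ] Bicross ⊗[ℂ] Bicross :=
  (Algebra.TensorProduct.map bInr bInr).comp comulHom

theorem bComulInr_apply (φ : FunSU2Star) :
    bComulInr φ = Algebra.TensorProduct.map bInr bInr (comulHom φ) := rfl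

theorem map_bInr_mul_bInl (v : FunSU2Star ⊗[ℂ] FunSU2Star) (Y : su2) :
    Algebra.TensorProduct.map bInr bInr v * (bInl (toEnv 1 Y) ⊗ₜ 1) =
      (bInl (toEnv 1 Y) ⊗ₜ 1) * Algebra.TensorProduct.map bInr bInr v +
      Algebra.TensorProduct.map bInr bInr
        (LinearMap.rTensor _ (dressing Y.1 : FunSU2Star →ₗ[ℂ] FunSU2Star) v) := by
  induction v with
  | zero => simp only [map_zero, zero_mul, mul_zero, add_zero]
  | add v w hv hw => simp only [map_add, add_mul, mul_add, hv, hw]; abel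
  | tmul φ ψ =>
    rw [LinearMap.rTensor_tmul, Algebra.TensorProduct.map_tmul, Algebra.TensorProduct.map_tmul,
      Algebra.TensorProduct.tmul_mul_tmul, Algebra.TensorProduct.tmul_mul_tmul, bInr_mul_bInl,
      mul_one, one_mul, TensorProduct.add_tmul]
    rfl

theorem map_bInr_mul_mixed (v : FunSU2Star ⊗[ℂ] FunSU2Star) (φ : FunSU2Star) (Y : su2) :
    Algebra.TensorProduct.map bInr bInr v * mixed (φ ⊗ₜ toEnv 1 Y) =
      mixed (φ ⊗ₜ toEnv 1 Y) * Algebra.TensorProduct.map bInr bInr v +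
      Algebra.TensorProduct.map bInr bInr ((φ ⊗ₜ 1) *
        LinearMap.lTensor _ (dressing Y.1 : FunSU2Star →ₗ[ℂ] FunSU2Star) v) := by
  induction v with
  | zero => simp only [map_zero, zero_mul, mul_zero, add_zero]
  | add v w hv hw => simp only [map_add, add_mul, mul_add, hv, hw]; abel
  | tmul ψ χ =>
    rw [LinearMap.lTensor_tmul, Algebra.TensorProduct.tmul_mul_tmul, mixed_tmul,
      Algebra.TensorProduct.map_tmul, Algebra.TensorProduct.map_tmul,
      Algebra.TensorProduct.tmul_mul_tmul, Algebra.TensorProduct.tmul_mul_tmul, bInr_mul_bInl,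
      TensorProduct.tmul_add, ← map_mul, ← map_mul, mul_comm ψ φ, one_mul]
    rfl

/-- The coproduct of the bicrossproduct. -/
def bComul : Bicross →ₐ[ℂ] Bicross ⊗[ℂ] Bicross :=
  dressingSU2.smashLift bComulInl bComulInr (fun φ Y => by
    have h : dressingSU2.D Y φ = dressing Y.1 φ := rfl
    -- The smash relation for the coproducts is the formula for `Δ` of a dressed function: `Y ⊗ 1`
    -- differentiates the first leg, and the terms of `rotElt Y` differentiate the second with
    -- coefficients in the first.
    rw [bComulInl_toEnv, h, bComulInr_apply, bComulInr_apply, comulHom_dressing, mul_add, add_mul,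
      map_bInr_mul_bInl, rotElt, map_sum, Finset.mul_sum, Finset.sum_mul, map_add, map_sum]
    simp only [map_bInr_mul_mixed, Finset.sum_add_distrib]
    abel)

theorem bComul_inl (a : Env su2) : bComul (bInl a) = bComulInl a :=
  dressingSU2.smashLift_inl _ _ _ a

theorem bComul_inr (φ : FunSU2Star) : bComul (bInr φ) = bComulInr φ :=
  dressingSU2.smashLift_inr _ _ _ φ

/-- The counit of the bicrossproduct. -/
def bCounit : Bicross →ₐ[ℂ] ℂ :=
  dressingSU2.smashLift (Bialgebra.counitAlgHom ℂ (Env su2)) (Bialgebra.counitAlgHom ℂ FunSU2Star)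
    (fun φ Y => by
      have h₁ : Bialgebra.counitAlgHom ℂ FunSU2Star (dressingSU2.D Y φ) = 0 :=
        counit_dressing_su2 Y φ
      rw [h₁, add_zero, mul_comm])

theorem bCounit_inl (a : Env su2) : bCounit (bInl a) = Coalgebra.counit (R := ℂ) a :=
  dressingSU2.smashLift_inl _ _ _ a

theorem bCounit_inr (φ : FunSU2Star) : bCounit (bInr φ) = Coalgebra.counit (R := ℂ) φ :=
  dressingSU2.smashLift_inr _ _ _ φ

theorem bComul_inl_toEnv (Y : su2) : bComul (bInl (toEnv 1 Y)) =
    bInl (toEnv 1 Y) ⊗ₜ[ℂ] (1 : Bicross) +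
    ∑ k, bInr (rotCoeff Y.1 k) ⊗ₜ[ℂ] bInl (toEnv 1 (rotBasis k)) := by
  rw [bComul_inl, bComulInl_toEnv, rotElt, map_sum]
  rfl

theorem sum_counit_rotCoeff (Y : su2) :
    ∑ k, Coalgebra.counit (R := ℂ) (rotCoeff Y.1 k) • toEnv 1 (rotBasis k) = toEnv 1 Y := by
  rw [← evalOne_rotElt, rotElt, map_sum]
  simp only [evalOne_tmul]

instance : Bialgebra ℂ Bicross :=
  Bialgebra.ofAlgHom bComul bCounit
    (by
      refine dressingSU2.smash_hom_ext (fun Y => ?_) fun φ => ?_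
      · have h := bComul_inl_toEnv
        -- Coassociativity on `Y` comes down to the coefficients forming a corepresentation; the two
        -- sides then differ by the order of a double sum.
        have h' : ∀ k, bComul (bInr (rotCoeff Y.1 k)) =
            ∑ l, bInr (rotCoeff Y.1 l) ⊗ₜ[ℂ] bInr (rotCoeff (rotBasis l).1 k) := by
          intro k
          rw [bComul_inr, bComulInr_apply, comulHom_rotCoeff, map_sum]
          rfl
        have h'' : ∀ u v w : Bicross, (Algebra.TensorProduct.assoc ℂ ℂ ℂ Bicross Bicross
            Bicross).toAlgHom ((u ⊗ₜ[ℂ] v) ⊗ₜ[ℂ] w) = u ⊗ₜ[ℂ] (v ⊗ₜ[ℂ] w) := fun _ _ _ => rfl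
        simp only [AlgHom.comp_apply]
        rw [h]
        simp only [map_add, map_sum, Algebra.TensorProduct.map_tmul, map_one, h, h', h'',
          AlgHom.id_apply, TensorProduct.add_tmul, TensorProduct.tmul_add, TensorProduct.sum_tmul,
          TensorProduct.tmul_sum, Finset.sum_add_distrib, Algebra.TensorProduct.one_def]
        rw [add_assoc]
        refine congrArg₂ _ rfl (congrArg₂ _ rfl ?_)
        exact Finset.sum_comm
      · have h := Coalgebra.coassoc_apply (R := ℂ) (A := FunSU2Star) φ
        simp only [AlgHom.comp_apply]
        rw [bComul_inr, bComulInr_apply]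
        have h₁ : ∀ v : FunSU2Star ⊗[ℂ] FunSU2Star,
            (Algebra.TensorProduct.assoc ℂ ℂ ℂ Bicross Bicross Bicross)
            (Algebra.TensorProduct.map bComul (.id ℂ Bicross)
              (Algebra.TensorProduct.map bInr bInr v)) =
            (Algebra.TensorProduct.map bInr (Algebra.TensorProduct.map bInr bInr) :
                FunSU2Star ⊗[ℂ] (FunSU2Star ⊗[ℂ] FunSU2Star) →ₐ[ℂ]
                  Bicross ⊗[ℂ] (Bicross ⊗[ℂ] Bicross))
              (TensorProduct.assoc ℂ FunSU2Star FunSU2Star FunSU2Star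
                (LinearMap.rTensor FunSU2Star (Coalgebra.comul (R := ℂ) (A := FunSU2Star)) v)) := by
          intro v
          induction v with
          | zero => simp only [map_zero]
          | add v w hv hw => simp only [map_add, hv, hw]
          | tmul φ ψ =>
            rw [Algebra.TensorProduct.map_tmul, Algebra.TensorProduct.map_tmul, bComul_inr,
              bComulInr_apply, LinearMap.rTensor_tmul, comul_fun_eq]
            generalize comulHom φ = w
            induction w with
            | zero => simp only [map_zero, TensorProduct.zero_tmul]
            | add v w hv hw => simp only [map_add, TensorProduct.add_tmul, hv, hw]
            | tmul φ χ => rfl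
        have h₂ : ∀ v : FunSU2Star ⊗[ℂ] FunSU2Star, Algebra.TensorProduct.map (.id ℂ Bicross) bComul
              (Algebra.TensorProduct.map bInr bInr v) =
            Algebra.TensorProduct.map bInr (Algebra.TensorProduct.map bInr bInr)
              (LinearMap.lTensor FunSU2Star (Coalgebra.comul (R := ℂ) (A := FunSU2Star)) v) := by
          intro v
          induction v with
          | zero => simp only [map_zero]
          | add v w hv hw => simp only [map_add, hv, hw]
          | tmul φ ψ =>
            rw [Algebra.TensorProduct.map_tmul, Algebra.TensorProduct.map_tmul, bComul_inr]
            rfl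
        refine (h₁ _).trans (Eq.trans ?_ (h₂ _).symm)
        rw [← comul_fun_eq, h])
    (by
      refine dressingSU2.smash_hom_ext (fun Y => ?_) fun φ => ?_
      · have h := bComul_inl_toEnv
        simp only [AlgHom.comp_apply]
        rw [h]
        simp only [map_add, map_sum, Algebra.TensorProduct.map_tmul, bCounit_inl, bCounit_inr,
          counit_toEnv, TensorProduct.zero_tmul, zero_add, AlgHom.id_apply]
        conv_rhs => rw [← sum_counit_rotCoeff Y]
        simp only [map_sum, map_smul]
        refine Finset.sum_congr rfl fun k _ => ?_
        exact (congrArg (· ⊗ₜ[ℂ] bInl (toEnv 1 (rotBasis k))) (mul_one _).symm).trans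
          (TensorProduct.smul_tmul' _ _ _).symm
      · have h := Coalgebra.rTensor_counit_comul (R := ℂ) φ
        simp only [AlgHom.comp_apply]
        rw [bComul_inr, bComulInr_apply]
        have h₁ : ∀ v, Algebra.TensorProduct.map bCounit (.id ℂ Bicross)
              (Algebra.TensorProduct.map bInr bInr v) =
            LinearMap.lTensor _ bInr.toLinearMap
              (LinearMap.rTensor _ (Coalgebra.counit (R := ℂ)) v) := by
          intro v
          induction v with
          | zero => simp only [map_zero]
          | add v w hv hw => simp only [map_add, hv, hw]
          | tmul φ ψ =>
            rw [Algebra.TensorProduct.map_tmul, Algebra.TensorProduct.map_tmul, bCounit_inr]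
            rfl
        rw [h₁, ← comul_fun_eq, h]
        rfl)
    (by
      refine dressingSU2.smash_hom_ext (fun Y => ?_) fun φ => ?_
      · have h := bComul_inl_toEnv
        simp only [AlgHom.comp_apply]
        rw [h]
        simp only [map_add, map_sum, Algebra.TensorProduct.map_tmul, bCounit_inl,
          counit_toEnv, TensorProduct.tmul_zero, Finset.sum_const_zero, add_zero, AlgHom.id_apply,
          map_one]
        rfl
      · have h := Coalgebra.lTensor_counit_comul (R := ℂ) φ
        simp only [AlgHom.comp_apply]
        rw [bComul_inr, bComulInr_apply]
        have h₁ : ∀ v, Algebra.TensorProduct.map (.id ℂ Bicross) bCounit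
              (Algebra.TensorProduct.map bInr bInr v) =
            LinearMap.rTensor _ bInr.toLinearMap
              (LinearMap.lTensor _ (Coalgebra.counit (R := ℂ)) v) := by
          intro v
          induction v with
          | zero => simp only [map_zero]
          | add v w hv hw => simp only [map_add, hv, hw]
          | tmul φ ψ =>
            rw [Algebra.TensorProduct.map_tmul, Algebra.TensorProduct.map_tmul, bCounit_inr]
            rfl
        rw [h₁, ← comul_fun_eq, h]
        rfl)

/-- The map `φ ⊗ a ↦ S(φ) a`. -/
def antipodeMul : FunSU2Star ⊗[ℂ] Env su2 →ₗ[ℂ] Bicross :=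
  LinearMap.mul' ℂ Bicross ∘ₗ
    TensorProduct.map (bInr.toLinearMap ∘ₗ antipodeHom.toLinearMap) bInl.toLinearMap

theorem antipodeMul_tmul (φ : FunSU2Star) (a : Env su2) :
    antipodeMul (φ ⊗ₜ a) = bInr (antipodeHom φ) * bInl a := rfl

theorem antipodeMul_rotElt (Y : su2) : antipodeMul (rotElt Y.1) =
    ∑ k, bInr (antipodeHom (rotCoeff Y.1 k)) * bInl (toEnv 1 (rotBasis k)) := by
  rw [rotElt, map_sum]
  rfl

/-- The formula for the inverse map on a dressed function is what lets `Y ↦ -antipodeMul (rotElt Y)`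
satisfy the smash relation in the opposite algebra. -/
theorem antipodeMul_rotElt_mul_bInr (Y : su2) (φ : FunSU2Star) :
    antipodeMul (rotElt Y.1) * bInr (antipodeHom φ) =
      bInr (antipodeHom φ) * antipodeMul (rotElt Y.1) - bInr (antipodeHom (dressing Y.1 φ)) := by
  rw [antipodeHom_dressing, antipodeMul_rotElt, Finset.sum_mul, Finset.mul_sum, map_sum,
    ← Finset.sum_sub_distrib]
  refine Finset.sum_congr rfl fun k _ => ?_
  rw [← mul_assoc (bInr (antipodeHom φ)), ← map_mul bInr, mul_comm (antipodeHom φ), map_mul bInr,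
    map_mul bInr, mul_assoc, mul_assoc, bInr_mul_bInl, mul_add]
  abel

/-- Applied to `v = rotElt X` and antisymmetrised, the derivative corrections combine with the
commutator into the cocycle identity, so the antipode respects brackets. -/
theorem antipodeMul_rotElt_mul (Y : su2) (v : FunSU2Star ⊗[ℂ] Env su2) :
    antipodeMul (rotElt Y.1) * antipodeMul v = antipodeMul (rotElt Y.1 * v) -
      antipodeMul (LinearMap.rTensor _ (dressing Y.1 : FunSU2Star →ₗ[ℂ] FunSU2Star) v) := by
  induction v with
  | zero => simp only [map_zero, mul_zero, sub_zero]
  | add v w hv hw => simp only [map_add, mul_add, hv, hw]; abel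
  | tmul φ a =>
    have h : antipodeMul (rotElt Y.1 * φ ⊗ₜ a) =
        bInr (antipodeHom φ) * antipodeMul (rotElt Y.1) * bInl a := by
      generalize rotElt Y.1 = w
      induction w with
      | zero => simp only [map_zero, mul_zero, zero_mul]
      | add v w hv hw => simp only [map_add, add_mul, mul_add, hv, hw]
      | tmul ψ b =>
        rw [Algebra.TensorProduct.tmul_mul_tmul, antipodeMul_tmul, antipodeMul_tmul, mul_comm ψ φ,
          map_mul, map_mul, map_mul]
        simp only [mul_assoc]
    rw [h, LinearMap.rTensor_tmul, antipodeMul_tmul, antipodeMul_tmul, ← mul_assoc,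
      antipodeMul_rotElt_mul_bInr, sub_mul]
    rfl

/-- The antipode on `U(su₂)`. -/
def bAntipodeInl : Env su2 →ₐ[ℂ] Bicrossᵐᵒᵖ :=
  envLift (fun Y : su2 => MulOpposite.op (-antipodeMul (rotElt Y.1)))
    (fun X Y => by
      rw [← MulOpposite.op_add, ← neg_add, ← map_add, ← rotElt_add]
      rfl)
    (fun r X => by
      rw [← MulOpposite.op_smul, smul_neg, ← map_smul, ← rotElt_smul]
      rfl)
    (fun X Y => by
      have h : antipodeMul (rotElt ⁅X, Y⁆.1) = _ :=
        congrArg antipodeMul (rotElt_lie X.2.1 Y.2.1)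
      rw [← MulOpposite.op_mul, ← MulOpposite.op_mul, ← MulOpposite.op_sub, neg_mul_neg,
        neg_mul_neg, antipodeMul_rotElt_mul, antipodeMul_rotElt_mul, h]
      congr 1
      simp only [map_add, map_sub]
      abel)

theorem bAntipodeInl_toEnv (Y : su2) : bAntipodeInl (toEnv 1 Y) =
    MulOpposite.op (-antipodeMul (rotElt Y.1)) := by
  rw [bAntipodeInl, envLift_toEnv_one]

/-- The antipode on `ℂ[SU₂⋆]`. -/
def bAntipodeInr : FunSU2Star →ₐ[ℂ] Bicrossᵐᵒᵖ :=
  (bInr.comp antipodeHom).toOpposite fun φ ψ => (Commute.all φ ψ).map (bInr.comp antipodeHom)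

theorem bAntipodeInr_apply (φ : FunSU2Star) :
    bAntipodeInr φ = MulOpposite.op (bInr (antipodeHom φ)) := rfl

/-- The antipode of the bicrossproduct. -/
def bAntipode : Bicross →ₐ[ℂ] Bicrossᵐᵒᵖ :=
  dressingSU2.smashLift bAntipodeInl bAntipodeInr (fun φ Y => by
    have h : bAntipodeInr (dressingSU2.D Y φ) =
      MulOpposite.op (bInr (antipodeHom (dressing Y.1 φ))) := rfl
    rw [bAntipodeInl_toEnv, bAntipodeInr_apply, h, ← MulOpposite.op_mul, ← MulOpposite.op_mul,
      ← MulOpposite.op_add, neg_mul, antipodeMul_rotElt_mul_bInr, mul_neg, neg_sub]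
    congr 1
    abel)

theorem bAntipode_inl (a : Env su2) : bAntipode (bInl a) = bAntipodeInl a :=
  dressingSU2.smashLift_inl _ _ _ a

theorem bAntipode_inr (φ : FunSU2Star) : bAntipode (bInr φ) =
    MulOpposite.op (bInr (antipodeHom φ)) :=
  dressingSU2.smashLift_inr _ _ _ φ

/-- The antipode axiom of `ℂ[SU₂⋆]` read on the corepresentation: the antipode inverts the matrix of
coefficients. It proves the right antipode law on `su₂`. -/
theorem sum_rotCoeff_mul_antipode (Y : su2) (l : Fin 3) :
    ∑ k, rotCoeff Y.1 k * antipodeHom (rotCoeff (rotBasis k).1 l) =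
      algebraMap ℂ _ (Coalgebra.counit (R := ℂ) (rotCoeff Y.1 l)) := by
  rw [← HopfAlgebra.mul_antipode_lTensor_comul_apply, comul_fun_eq, comulHom_rotCoeff, map_sum,
    map_sum]
  rfl

theorem bicross_mul_antipode_rTensor (b : Bicross)
    (hb : b ∈ Set.range (fun Y : su2 => bInl (toEnv 1 Y)) ∪ Set.range bInr) :
    LinearMap.mul' ℂ Bicross (LinearMap.rTensor Bicross
      ((MulOpposite.opLinearEquiv ℂ).symm.toLinearMap ∘ₗ bAntipode.toLinearMap)
        (Coalgebra.comul (R := ℂ) b)) = algebraMap ℂ _ (Coalgebra.counit (R := ℂ) b) := by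
  have hc : ∀ b : Bicross, Coalgebra.comul (R := ℂ) b = bComul b := fun _ => rfl
  have he : ∀ b : Bicross, Coalgebra.counit (R := ℂ) b = bCounit b := fun _ => rfl
  rw [hc, he]
  obtain ⟨Y, rfl⟩ | ⟨φ, rfl⟩ := hb
  · have h₁ := bComul_inl_toEnv Y
    have h₂ := bCounit_inl (toEnv 1 Y)
    simp only [h₁, h₂, map_add, map_sum, LinearMap.rTensor_tmul, LinearMap.mul'_apply,
      LinearMap.comp_apply, AlgHom.toLinearMap_apply, bAntipode_inr, bAntipode_inl,
      bAntipodeInl_toEnv, counit_toEnv, map_zero, mul_one]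
    change -antipodeMul (rotElt Y.1) + ∑ k, bInr (antipodeHom (rotCoeff Y.1 k)) *
      bInl (toEnv 1 (rotBasis k)) = 0
    rw [antipodeMul_rotElt, neg_add_cancel]
  · rw [bCounit_inr, bComul_inr, bComulInr_apply, ← bInr.commutes,
      ← HopfAlgebra.mul_antipode_rTensor_comul_apply, comul_fun_eq]
    generalize comulHom φ = v
    induction v with
    | zero => simp only [map_zero]
    | add v w hv hw => simp only [map_add, hv, hw]
    | tmul φ ψ =>
      simp only [Algebra.TensorProduct.map_tmul, LinearMap.rTensor_tmul, LinearMap.mul'_apply,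
        LinearMap.comp_apply, AlgHom.toLinearMap_apply, bAntipode_inr, map_mul]
      rfl

theorem bicross_mul_antipode_lTensor (b : Bicross)
    (hb : b ∈ Set.range (fun Y : su2 => bInl (toEnv 1 Y)) ∪ Set.range bInr) :
    LinearMap.mul' ℂ Bicross (LinearMap.lTensor Bicross
      ((MulOpposite.opLinearEquiv ℂ).symm.toLinearMap ∘ₗ bAntipode.toLinearMap)
        (Coalgebra.comul (R := ℂ) b)) = algebraMap ℂ _ (Coalgebra.counit (R := ℂ) b) := by
  have hc : ∀ b : Bicross, Coalgebra.comul (R := ℂ) b = bComul b := fun _ => rfl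
  have he : ∀ b : Bicross, Coalgebra.counit (R := ℂ) b = bCounit b := fun _ => rfl
  rw [hc, he]
  obtain ⟨Y, rfl⟩ | ⟨φ, rfl⟩ := hb
  · have h₁ := bComul_inl_toEnv Y
    have h₂ := bCounit_inl (toEnv 1 Y)
    simp only [h₁, h₂, map_add, map_sum, LinearMap.lTensor_tmul, LinearMap.mul'_apply,
      LinearMap.comp_apply, AlgHom.toLinearMap_apply, bAntipode_inl,
      bAntipodeInl_toEnv, counit_toEnv, map_zero, map_one]
    change bInl (toEnv 1 Y) * 1 +
      ∑ k, bInr (rotCoeff Y.1 k) * -antipodeMul (rotElt (rotBasis k).1) = 0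
    simp only [antipodeMul_rotElt, mul_neg, Finset.mul_sum, Finset.sum_neg_distrib]
    rw [Finset.sum_comm]
    simp only [← mul_assoc, ← map_mul, ← Finset.sum_mul, ← map_sum, sum_rotCoeff_mul_antipode]
    conv_lhs => enter [1]; rw [← sum_counit_rotCoeff Y]
    simp only [AlgHom.commutes, map_sum, map_mul, Algebra.smul_def, mul_one, add_neg_cancel]
  · rw [bCounit_inr, bComul_inr, bComulInr_apply, ← bInr.commutes,
      ← HopfAlgebra.mul_antipode_lTensor_comul_apply, comul_fun_eq]
    generalize comulHom φ = v
    induction v with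
    | zero => simp only [map_zero]
    | add v w hv hw => simp only [map_add, hv, hw]
    | tmul φ ψ =>
      simp only [Algebra.TensorProduct.map_tmul, LinearMap.lTensor_tmul, LinearMap.mul'_apply,
        LinearMap.comp_apply, AlgHom.toLinearMap_apply, bAntipode_inr, map_mul]
      rfl

instance : HopfAlgebra ℂ Bicross :=
  HopfAlgebra.ofGenerators bAntipode _ dressingSU2.adjoin_smash bicross_mul_antipode_rTensor
    bicross_mul_antipode_lTensor

end Iwasawa


/-! ### Primitive elements acting on products. -/

namespace Semidual

variable {k : Type*} [CommRing k] {H₁ H₂ H : Type*}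
  [Ring H₁] [HopfAlgebra k H₁] [Ring H₂] [HopfAlgebra k H₂] [Ring H] [HopfAlgebra k H]
  {i₁ : H₁ →ₐc[k] H} {i₂ : H₂ →ₐc[k] H} (hF : IsFactorisation i₁ i₂)

theorem proj₁_factorEquiv_mul (T : H₁ ⊗[k] H₂) (g : H₁) :
    proj₁ hF (factorEquiv hF T * i₁ g) =
      LinearMap.mul' k H₁ (LinearMap.lTensor H₁ ((lact hF).flip g) T) := by
  induction T with
  | zero => simp only [map_zero, zero_mul]
  | add S T hS hT => simp only [map_add, add_mul, hS, hT]
  | tmul u a =>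
    refine (congrArg (proj₁ hF) (mul_assoc (i₁ u) (i₂ a) (i₁ g))).trans ?_
    rw [proj₁_mul_left, ← lact_eq]
    rfl

theorem lact_one_right (a : H₂) : lact hF a 1 = Coalgebra.counit (R := k) a • 1 := by
  rw [lact_eq, map_one, mul_one]
  simpa using proj₁_mul hF 1 a

theorem ract_one_left (g : H₁) : ract hF 1 g = Coalgebra.counit (R := k) g • 1 := by
  rw [ract_eq, map_one, one_mul]
  simpa using proj₂_mul hF g 1

/-- In the matched pair formula one of the two legs of `y` is `1`; the actions by or on `1` are
trivial and a counit axiom removes the spare leg of `h`. -/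
theorem reorder_of_primitive {y : H₂} (hy : Coalgebra.comul (R := k) y = y ⊗ₜ 1 + 1 ⊗ₜ y)
    (h : H₁) : reorder hF y h = lact hF y h ⊗ₜ 1 +
      LinearMap.lTensor H₁ (ract hF y) (Coalgebra.comul (R := k) h) := by
  have h₄ := congrArg (TensorProduct.rid k H₁) (Coalgebra.lTensor_counit_comul (R := k) h)
  rw [TensorProduct.rid_tmul, one_smul] at h₄
  rw [(isMatched hF).reorder_eq, TensorProduct.comul_tmul, hy]
  conv_rhs => enter [1, 2]; rw [← h₄]
  generalize Coalgebra.comul (R := k) h = T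
  induction T with
  | zero => simp only [map_zero, TensorProduct.tmul_zero, TensorProduct.zero_tmul, add_zero]
  | add S T hS hT =>
    rw [TensorProduct.tmul_add, map_add, map_add, hS, hT]
    simp only [map_add, TensorProduct.add_tmul]
    abel
  | tmul u v =>
    simp only [TensorProduct.add_tmul, map_add,
      TensorProduct.AlgebraTensorModule.tensorTensorTensorComm_tmul, TensorProduct.map_tmul,
      TensorProduct.lift.tmul, LinearMap.lTensor_tmul, TensorProduct.rid_tmul,
      ract_one_left, (isMatched hF).one_lact, map_smul, TensorProduct.tmul_smul,
      TensorProduct.smul_tmul']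

/-- Move `y` past `h`, then what remains past `g`: the second term is `∑ h₍₁₎ ((y ◁ h₍₂₎) ▷ g)`, the
source of covariance. -/
theorem lact_mul_of_primitive {y : H₂} (hy : Coalgebra.comul (R := k) y = y ⊗ₜ 1 + 1 ⊗ₜ y)
    (h g : H₁) : lact hF y (h * g) = lact hF y h * g + LinearMap.mul' k H₁
      (LinearMap.lTensor H₁ ((lact hF).flip g ∘ₗ ract hF y) (Coalgebra.comul (R := k) h)) := by
  have h₁ : i₂ y * i₁ h = factorEquiv hF (reorder hF y h) :=
    ((factorEquiv hF).apply_symm_apply _).symm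
  rw [lact_eq, map_mul i₁, ← mul_assoc, h₁, proj₁_factorEquiv_mul, reorder_of_primitive hF hy,
    map_add, map_add, LinearMap.lTensor_comp, LinearMap.comp_apply, LinearMap.lTensor_tmul,
    LinearMap.mul'_apply, LinearMap.flip_apply, (isMatched hF).one_lact]

end Semidual

/-! ### The bicrossproduct coproduct and the canonical action. -/

namespace Iwasawa

open Matrix ComplexConjugate Semidual

/-- The map `a ⊗ v ↦ (a ⊗ 1) v` from `U(su₂) ⊗ (ℂ[SU₂⋆] ⊗ U(su₂))`. -/
def mulMixed : Env su2 ⊗[ℂ] (FunSU2Star ⊗[ℂ] Env su2) →ₗ[ℂ] Bicross ⊗[ℂ] Bicross :=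
  TensorProduct.lift ((LinearMap.mul ℂ (Bicross ⊗[ℂ] Bicross)).compl₁₂
    ((TensorProduct.mk ℂ Bicross Bicross).flip 1 ∘ₗ bInl.toLinearMap) mixed.toLinearMap)

theorem mulMixed_tmul (a : Env su2) (v : FunSU2Star ⊗[ℂ] Env su2) :
    mulMixed (a ⊗ₜ v) = bInl a ⊗ₜ 1 * mixed v := rfl

theorem mul_mul_add_eq {R : Type*} [Ring R] {u v y d q : R} (h : v * y = y * v + d) :
    u * v * (y + q) = u * y * v + u * (d + v * q) := by
  rw [mul_add, mul_assoc, h]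
  simp only [mul_add, mul_assoc]
  abel

theorem apply_lTensor_add {k A V W : Type*} [CommRing k] [AddCommGroup A] [Module k A]
    [AddCommGroup V] [Module k V] [AddCommGroup W] [Module k W] {A' : Type*} [AddCommGroup A']
    [Module k A'] (F : A' ⊗[k] V →ₗ[k] W) (δ : A →ₗ[k] V) (a c : A') (b d : A) :
    F (LinearMap.lTensor A' δ (a ⊗ₜ b + c ⊗ₜ d)) = F (a ⊗ₜ δ b) + F (c ⊗ₜ δ d) := by
  simp only [map_add, LinearMap.lTensor_tmul]

theorem mulMixed_mul_bComulInl (a b : Env su2) (Y : su2) :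
    mulMixed (a ⊗ₜ coaction b) * (bInl (toEnv 1 Y) ⊗ₜ 1 + mixed (rotElt Y.1)) =
      mulMixed ((a * toEnv 1 Y) ⊗ₜ coaction b) + mulMixed (a ⊗ₜ coaction (b * toEnv 1 Y)) := by
  have h : bInl (a * toEnv 1 Y) ⊗ₜ[ℂ] (1 : Bicross) = bInl a ⊗ₜ 1 * bInl (toEnv 1 Y) ⊗ₜ 1 := by
    rw [map_mul, Algebra.TensorProduct.tmul_mul_tmul, mul_one (1 : Bicross)]
  rw [coaction_mul_toEnv, mulMixed_tmul, mulMixed_tmul, mulMixed_tmul, map_add mixed,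
    map_mul mixed, h]
  exact mul_mul_add_eq (mixed_mul _ Y)

/-- The coproduct was defined on Lie algebra elements; multiplying by one more `Y` reproduces the
recursion of the coaction, which yields the closed formula `∑ a₍₁₎ ⊗ coaction a₍₂₎`. -/
theorem bComulInl_eq (a : Env su2) : bComulInl a =
    mulMixed (LinearMap.lTensor (Env su2) coaction (Coalgebra.comul (R := ℂ) a)) := by
  induction a using env_induction_right with
  | one =>
    have h : mulMixed (LinearMap.lTensor (Env su2) coaction (1 ⊗ₜ 1)) = 1 := by
      rw [LinearMap.lTensor_tmul, coaction_one, mulMixed_tmul, map_one bInl, map_one mixed, mul_one]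
      rfl
    rw [map_one, Bialgebra.comul_one]
    exact h.symm
  | add a b ha hb => simp only [map_add, ha, hb]
  | smul c a ha => simp only [map_smul, ha]
  | mul a Y ha =>
    rw [map_mul, ha, bComulInl_toEnv, Bialgebra.comul_mul, comul_toEnv 1 Y]
    generalize Coalgebra.comul (R := ℂ) a = T
    induction T with
    | zero => simp only [map_zero, zero_mul]
    | add S T hS hT => simp only [map_add, add_mul, hS, hT]
    | tmul b c =>
      have h : (b ⊗ₜ[ℂ] c) * (toEnv 1 Y ⊗ₜ[ℂ] (1 : Env su2) + (1 : Env su2) ⊗ₜ[ℂ] toEnv 1 Y) =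
          (b * toEnv 1 Y) ⊗ₜ c + b ⊗ₜ (c * toEnv 1 Y) :=
        (mul_add _ _ _).trans (congrArg₂ _
          ((Algebra.TensorProduct.tmul_mul_tmul _ _ _ _).trans (congrArg _ (mul_one c)))
          ((Algebra.TensorProduct.tmul_mul_tmul _ _ _ _).trans
            (congrArg (· ⊗ₜ[ℂ] (c * toEnv 1 Y)) (mul_one b))))
      refine Eq.trans ?_ (congrArg (fun T => mulMixed (LinearMap.lTensor (Env su2) coaction T))
        h).symm
      refine Eq.trans ?_ (apply_lTensor_add mulMixed coaction _ _ _ _).symm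
      exact mulMixed_mul_bComulInl b c Y

theorem tmul_one_mul_tmul_mul_tmul {k R : Type*} [CommRing k] [Ring R] [Algebra k R]
    (x y z u v : R) : (x ⊗ₜ[k] 1 : R ⊗[k] R) * (y ⊗ₜ z) * (u ⊗ₜ v) =
      (x * (y * u)) ⊗ₜ (z * v) := by
  simp only [Algebra.TensorProduct.tmul_mul_tmul, one_mul, mul_assoc]

theorem mulMixed_mul_map (a b : Env su2) (φ ψ : FunSU2Star) :
    mulMixed (a ⊗ₜ coaction b) * Algebra.TensorProduct.map bInr bInr (φ ⊗ₜ[ℂ] ψ) =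
      TensorProduct.map dressingSU2.smashEquiv.toLinearMap dressingSU2.smashEquiv.toLinearMap
        (TensorProduct.map (TensorProduct.mk ℂ (Env su2) FunSU2Star a ∘ₗ
            LinearMap.mulRight ℂ φ)
          ((TensorProduct.mk ℂ (Env su2) FunSU2Star).flip ψ) (coaction b)) := by
  rw [mulMixed_tmul, Algebra.TensorProduct.map_tmul]
  generalize coaction b = v
  induction v with
  | zero => simp only [map_zero, mul_zero, zero_mul]
  | add v w hv hw => simp only [map_add, mul_add, add_mul, hv, hw]
  | tmul χ b =>
    rw [TensorProduct.map_tmul, TensorProduct.map_tmul, mixed_tmul]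
    refine (tmul_one_mul_tmul_mul_tmul _ _ _ _ _).trans ?_
    rw [← map_mul bInr]
    exact congrArg₂ _ (DerAction.smashEquiv_tmul _ _ _).symm
      (DerAction.smashEquiv_tmul _ _ _).symm

theorem bComul_smashEquiv_eq_mul (a : Env su2) (φ : FunSU2Star) :
    bComul (dressingSU2.smashEquiv (a ⊗ₜ φ)) =
      mulMixed (LinearMap.lTensor (Env su2) coaction (Coalgebra.comul (R := ℂ) a)) *
        Algebra.TensorProduct.map bInr bInr (comulHom φ) := by
  rw [DerAction.smashEquiv_tmul, map_mul, bComul_inl, bComul_inr, bComulInl_eq, bComulInr_apply]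

theorem apply_lTensor_sum_mul_sum {k A' A V W R : Type*} [CommRing k] [AddCommGroup A] [Module k A]
    [AddCommGroup V] [Module k V] [AddCommGroup W] [Module k W] [AddCommGroup A']
    [Module k A'] [Ring R] [Algebra k R] (F : A' ⊗[k] V →ₗ[k] R) (δ : A →ₗ[k] V) (G : W →ₗ[k] R)
    {ι κ : Type} (s : Finset ι) (t : Finset κ) (a : ι → A') (b : ι → A) (w : κ → W) :
    F (LinearMap.lTensor A' δ (∑ m ∈ s, a m ⊗ₜ b m)) * G (∑ n ∈ t, w n) =
      ∑ m ∈ s, ∑ n ∈ t, F (a m ⊗ₜ δ (b m)) * G (w n) := by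
  simp only [map_sum, LinearMap.lTensor_tmul, Finset.sum_mul_sum]

theorem bComul_smashEquiv (a : Env su2) (φ : FunSU2Star) {ι κ : Type}
    (R : Coalgebra.Repr ℂ a ι) (S : Coalgebra.Repr ℂ φ κ) :
    bComul (dressingSU2.smashEquiv (a ⊗ₜ φ)) =
      TensorProduct.map dressingSU2.smashEquiv.toLinearMap dressingSU2.smashEquiv.toLinearMap
        (∑ m ∈ R.index, ∑ n ∈ S.index,
          TensorProduct.map (TensorProduct.mk ℂ (Env su2) FunSU2Star (R.left m) ∘ₗ
              LinearMap.mulRight ℂ (S.left n))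
            ((TensorProduct.mk ℂ (Env su2) FunSU2Star).flip (S.right n))
            (coaction (R.right m))) := by
  refine (bComul_smashEquiv_eq_mul a φ).trans ?_
  rw [← R.eq, ← comul_fun_eq, ← S.eq]
  refine (apply_lTensor_sum_mul_sum mulMixed coaction
    (Algebra.TensorProduct.map bInr bInr).toLinearMap _ _ _ _ _).trans ?_
  rw [map_sum]
  refine Finset.sum_congr rfl fun m _ => ?_
  rw [map_sum]
  exact Finset.sum_congr rfl fun n _ => mulMixed_mul_map _ _ _ _

theorem bCounit_smashEquiv (a : Env su2) (φ : FunSU2Star) :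
    bCounit (dressingSU2.smashEquiv (a ⊗ₜ φ)) =
      Coalgebra.counit (R := ℂ) a * Coalgebra.counit (R := ℂ) φ := by
  rw [DerAction.smashEquiv_tmul, map_mul, bCounit_inl, bCounit_inr]

theorem isBicrossproduct : IsBicrossproduct dressingSU2.act coaction dressingSU2.smashEquiv where
  one := rfl
  mul a b φ ψ := dressingSU2.smash_tmul_mul_tmul a b φ ψ
  counit a φ := bCounit_smashEquiv a φ
  comul a φ _ _ R S := bComul_smashEquiv a φ R S

/-- The canonical action of `U(su₂) ▷◂ ℂ[SU₂⋆]` on `U(su₂⋆)`. -/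
def bicrossAct : Bicross →ₗ[ℂ] Env su2Star →ₗ[ℂ] Env su2Star :=
  TensorProduct.lift ((LinearMap.mul ℂ (Module.End ℂ (Env su2Star))).compl₁₂
    (lact isFactorisation) (coregular pairing)) ∘ₗ dressingSU2.smashEquiv.symm.toLinearMap

theorem bicrossAct_tmul (a : Env su2) (φ : FunSU2Star) (h : Env su2Star) :
    bicrossAct (dressingSU2.smashEquiv (a ⊗ₜ φ)) h =
      lact isFactorisation a (coregular pairing φ h) := by
  simp only [bicrossAct, LinearMap.comp_apply, LinearEquiv.coe_coe, LinearEquiv.symm_apply_apply]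
  rfl

theorem bicrossAct_inl (a : Env su2) (h : Env su2Star) :
    bicrossAct (bInl a) h = lact isFactorisation a h :=
  (bicrossAct_tmul a 1 h).trans (congrArg _ (coregular_one_left h))

theorem bicrossAct_inr (φ : FunSU2Star) (h : Env su2Star) :
    bicrossAct (bInr φ) h = coregular pairing φ h :=
  (bicrossAct_tmul 1 φ h).trans ((isMatched isFactorisation).one_lact _)

theorem isCanonicalAction :
    IsCanonicalAction isFactorisation pairing dressingSU2.smashEquiv bicrossAct := by
  intro a φ h
  rw [bicrossAct_tmul, coregular_apply]
  generalize Coalgebra.comul (R := ℂ) h = T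
  induction T with
  | zero => simp only [map_zero]
  | add S T hS hT => simp only [map_add, hS, hT]
  | tmul h g => simp only [LinearMap.lTensor_tmul, TensorProduct.map_tmul, TensorProduct.rid_tmul,
      map_smul]

theorem env_ext {h g : Env su2Star} (H : ∀ φ, pairing φ h = pairing φ g) : h = g :=
  sub_eq_zero.1 (pairing_separatingRight _ fun φ => by rw [map_sub, H, sub_self])

theorem pairing_coregular_apply (φ ψ : FunSU2Star) (h : Env su2Star) :
    pairing φ (coregular pairing ψ h) = pairing (φ * ψ) h :=
  pairing_coregular isHopfPairing.mul_left φ ψ h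

theorem coregular_mul_left (φ ψ : FunSU2Star) (h : Env su2Star) :
    coregular pairing (φ * ψ) h = coregular pairing φ (coregular pairing ψ h) :=
  env_ext fun χ => by simp only [pairing_coregular_apply, mul_assoc]

/-- Tested against `χ`, the left side becomes `⟨(χ φ) ◁ a, h⟩`, and `(χ φ) ◁ a` expands over the
coproduct of `a`. Non-degeneracy turns this into the cross relation that makes the action
multiplicative. -/
theorem coregular_lact (φ : FunSU2Star) (a : Env su2) (h : Env su2Star) :
    coregular pairing φ (lact isFactorisation a h) =
      bicrossAct (dressingSU2.smashEquiv
        (LinearMap.lTensor (Env su2) (dressingSU2.act φ) (Coalgebra.comul (R := ℂ) a))) h := by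
  refine env_ext fun χ => ?_
  rw [pairing_coregular_apply, ← isDualAction, DerAction.mul_act]
  generalize Coalgebra.comul (R := ℂ) a = T
  induction T with
  | zero => simp only [map_zero, LinearMap.zero_apply]
  | add S T hS hT => simp only [map_add, LinearMap.add_apply, hS, hT]
  | tmul b c =>
    rw [LinearMap.lTensor_tmul, bicrossAct_tmul, ← isDualAction, pairing_coregular_apply]
    rfl

theorem bicrossAct_mul (b c : Bicross) (h : Env su2Star) :
    bicrossAct (b * c) h = bicrossAct b (bicrossAct c h) := by
  induction b using DerAction.smash_induction with
  | add b b' hb hb' => simp only [add_mul, map_add, LinearMap.add_apply, hb, hb']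
  | tmul a φ =>
    induction c using DerAction.smash_induction with
    | add b b' hb hb' => simp only [mul_add, map_add, LinearMap.add_apply, hb, hb']
    | tmul b ψ =>
      rw [bicrossAct_tmul, bicrossAct_tmul, coregular_lact, DerAction.smash_tmul_mul_tmul]
      generalize Coalgebra.comul (R := ℂ) b = T
      induction T with
      | zero => simp only [map_zero, LinearMap.zero_apply]
      | add S T hS hT => simp only [map_add, LinearMap.add_apply, hS, hT]
      | tmul b c =>
        refine (bicrossAct_tmul (a * b) (dressingSU2.act φ c * ψ) h).trans ?_
        rw [(isMatched isFactorisation).mul_lact, coregular_mul_left]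
        exact (congrArg _ (bicrossAct_tmul b (dressingSU2.act φ c) _)).symm

theorem coaction_toEnv (Y : su2) : coaction (toEnv 1 Y) = rotElt Y.1 := by
  have h : LinearMap.rTensor (Env su2) (dressing Y.1 : FunSU2Star →ₗ[ℂ] FunSU2Star)
      (1 ⊗ₜ[ℂ] 1) = 0 := by
    rw [LinearMap.rTensor_tmul]
    exact (congrArg (· ⊗ₜ[ℂ] (1 : Env su2)) (dressing Y.1).map_one_eq_zero).trans
      (TensorProduct.zero_tmul _ _)
  refine (congrArg coaction (one_mul _).symm).trans ((coaction_mul_toEnv 1 Y).trans ?_)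
  rw [coaction_one, one_mul (rotElt Y.1)]
  exact (congrArg (· + rotElt Y.1) h).trans (zero_add _)

theorem ract_toEnv (Y : su2) (h : Env su2Star) : ract isFactorisation (toEnv 1 Y) h =
    ∑ k, pairing (rotCoeff Y.1 k) h • toEnv 1 (rotBasis k) := by
  rw [isDualCoaction, coaction_toEnv, rotElt, map_sum, map_sum]
  rfl

theorem mul'_lTensor_ract (Y : su2) (g : Env su2Star) (T : Env su2Star ⊗[ℂ] Env su2Star) :
    LinearMap.mul' ℂ (Env su2Star) (LinearMap.lTensor (Env su2Star)
      ((lact isFactorisation).flip g ∘ₗ ract isFactorisation (toEnv 1 Y)) T) =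
    ∑ k, TensorProduct.rid ℂ (Env su2Star) (LinearMap.lTensor (Env su2Star)
      (pairing (rotCoeff Y.1 k)) T) * lact isFactorisation (toEnv 1 (rotBasis k)) g := by
  induction T with
  | zero => simp only [map_zero, zero_mul, Finset.sum_const_zero]
  | add S T hS hT => simp only [map_add, add_mul, hS, hT, Finset.sum_add_distrib]
  | tmul u v =>
    simp only [LinearMap.lTensor_tmul, LinearMap.mul'_apply, LinearMap.comp_apply, ract_toEnv,
      map_sum, map_smul, LinearMap.flip_apply, TensorProduct.rid_tmul, Finset.mul_sum,
      mul_smul_comm, smul_mul_assoc]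

/-- The coefficient `⟨rotCoeff, h₍₂₎⟩` of `Y ◁ h₍₂₎` recombines with `h₍₁₎` into the coregular
action. The result is term by term the coproduct of `Y` in the bicrossproduct. -/
theorem lact_toEnv_mul (Y : su2) (h g : Env su2Star) :
    lact isFactorisation (toEnv 1 Y) (h * g) = lact isFactorisation (toEnv 1 Y) h * g +
      ∑ k, coregular pairing (rotCoeff Y.1 k) h * lact isFactorisation (toEnv 1 (rotBasis k)) g :=
  (lact_mul_of_primitive isFactorisation (comul_toEnv 1 Y) h g).trans
    (congrArg _ (mul'_lTensor_ract Y g _))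

theorem bicrossAct_mul_right_inl (Y : su2) (h g : Env su2Star) :
    bicrossAct (bInl (toEnv 1 Y)) (h * g) =
      LinearMap.mul' ℂ (Env su2Star) (TensorProduct.map (bicrossAct.flip h) (bicrossAct.flip g)
        (bComul (bInl (toEnv 1 Y)))) := by
  have h₁ : bicrossAct 1 g = g := by
    rw [← map_one bInl, bicrossAct_inl, (isMatched isFactorisation).one_lact]
  rw [bComul_inl_toEnv, bicrossAct_inl, lact_toEnv_mul, map_add, map_add, map_sum, map_sum]
  simp only [TensorProduct.map_tmul, LinearMap.mul'_apply, LinearMap.flip_apply, bicrossAct_inr,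
    bicrossAct_inl, h₁]

theorem bicrossAct_mul_right_inr (φ : FunSU2Star) (h g : Env su2Star) :
    bicrossAct (bInr φ) (h * g) =
      LinearMap.mul' ℂ (Env su2Star) (TensorProduct.map (bicrossAct.flip h) (bicrossAct.flip g)
        (bComul (bInr φ))) := by
  rw [bComul_inr, bComulInr_apply, bicrossAct_inr, coregular_mul_right isHopfPairing.mul_right,
    comul_fun_eq]
  generalize comulHom φ = T
  induction T with
  | zero => simp only [map_zero]
  | add S T hS hT => simp only [map_add, hS, hT]
  | tmul φ ψ =>
    simp only [TensorProduct.map_tmul, Algebra.TensorProduct.map_tmul, LinearMap.flip_apply,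
      bicrossAct_inr, LinearMap.mul'_apply]

/-- As the action and the coproduct are both multiplicative, the law passes from generators to
products, provided it is assumed for all `h` and `g`. -/
theorem bicrossAct_mul_right (b : Bicross) (h g : Env su2Star) : bicrossAct b (h * g) =
    LinearMap.mul' ℂ (Env su2Star) (TensorProduct.map (bicrossAct.flip h) (bicrossAct.flip g)
      (bComul b)) := by
  have hb : b ∈ Algebra.adjoin ℂ
      (Set.range (fun Y : su2 => bInl (toEnv 1 Y)) ∪ Set.range bInr) := by
    rw [DerAction.adjoin_smash]; trivial
  induction hb using Algebra.adjoin_induction generalizing h g with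
  | mem b hb =>
    obtain ⟨Y, rfl⟩ | ⟨φ, rfl⟩ := hb
    · exact bicrossAct_mul_right_inl Y h g
    · exact bicrossAct_mul_right_inr φ h g
  | algebraMap c =>
    rw [← AlgHom.commutes bInr]
    exact bicrossAct_mul_right_inr _ h g
  | add b c _ _ hb hc => simp only [map_add, LinearMap.add_apply, hb, hc]
  | mul b c _ _ hb hc =>
    rw [bicrossAct_mul, hc, map_mul]
    generalize bComul c = T
    induction T with
    | zero => simp only [map_zero, mul_zero]
    | add S T hS hT => simp only [map_add, mul_add, hS, hT]
    | tmul u v =>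
      rw [TensorProduct.map_tmul, LinearMap.mul'_apply, hb]
      generalize bComul b = T
      induction T with
      | zero => simp only [map_zero, zero_mul]
      | add S T hS hT => simp only [map_add, add_mul, hS, hT]
      | tmul s t =>
        simp only [Algebra.TensorProduct.tmul_mul_tmul, TensorProduct.map_tmul,
          LinearMap.mul'_apply, LinearMap.flip_apply, bicrossAct_mul]

theorem isModuleAlgebra : IsModuleAlgebra bicrossAct where
  one_act h := by
    rw [← map_one bInl, bicrossAct_inl, (isMatched isFactorisation).one_lact]
  mul_act := bicrossAct_mul
  act_one b := by
    induction b using DerAction.smash_induction with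
    | add b c hb hc => simp only [map_add, LinearMap.add_apply, hb, hc]
    | tmul a φ =>
      rw [bicrossAct_tmul, coregular_one_right isHopfPairing.one_right, map_smul, lact_one_right,
        isBicrossproduct.counit, Algebra.algebraMap_eq_smul_one, smul_smul, mul_comm]
  act_mul := bicrossAct_mul_right

end Iwasawa


/-! ### Vector fields and coefficients in the momentum coordinates. -/

namespace Iwasawa

open Matrix ComplexConjugate Semidual

theorem toFun_P_zero (lam : ℝ) (g : SU2Star) : toFun (P lam 0) g =
    (lam : ℂ)⁻¹ * 2⁻¹ * ((g.1 1 0 + conj (g.1 1 0)) * g.1 1 1) := by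
  rw [P_zero, map_smul]; rfl

theorem toFun_P_one (lam : ℝ) (g : SU2Star) : toFun (P lam 1) g =
    (lam : ℂ)⁻¹ * (2 * Complex.I)⁻¹ * ((g.1 1 0 - conj (g.1 1 0)) * g.1 1 1) := by
  rw [P_one, map_smul]; rfl

theorem toFun_expP (lam : ℝ) (hl : lam ≠ 0) (g : SU2Star) :
    toFun (expP lam hl) g = g.1 1 1 * g.1 1 1 := by
  rw [expP_eq]; rfl

theorem toFun_dressing_P_zero (lam : ℝ) (M : Matrix (Fin 2) (Fin 2) ℂ) (g : SU2Star) :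
    toFun (dressing M (P lam 0)) g = (lam : ℂ)⁻¹ * 2⁻¹ *
      ((g.1 1 0 + conj (g.1 1 0)) * toFun (dgen M 1) g +
        g.1 1 1 * (toFun (dgen M 2) g + toFun (dgen M 3) g)) := by
  rw [P_zero, Derivation.map_smul, Derivation.leibniz, map_add (dressing M), dressing_gen,
    dressing_gen, dressing_gen, map_smul]
  rfl

theorem toFun_dressing_P_one (lam : ℝ) (M : Matrix (Fin 2) (Fin 2) ℂ) (g : SU2Star) :
    toFun (dressing M (P lam 1)) g = (lam : ℂ)⁻¹ * (2 * Complex.I)⁻¹ *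
      ((g.1 1 0 - conj (g.1 1 0)) * toFun (dgen M 1) g +
        g.1 1 1 * (toFun (dgen M 2) g - toFun (dgen M 3) g)) := by
  rw [P_one, Derivation.map_smul, Derivation.leibniz, map_sub (dressing M), dressing_gen,
    dressing_gen, dressing_gen, map_smul]
  rfl

theorem toFun_dressing_P_two (lam : ℝ) (M : Matrix (Fin 2) (Fin 2) ℂ) (g : SU2Star) :
    toFun (dressing M (P lam 2)) g = 2 / (lam : ℂ) * toFun (dgen M 4) g := by
  rw [P_two, Derivation.map_smul, dressing_gen, map_smul]
  rfl

theorem dressing_expP (lam : ℝ) (hl : lam ≠ 0) (M : Matrix (Fin 2) (Fin 2) ℂ) :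
    dressing M (expP lam hl) = -((lam : ℂ) • (expP lam hl * dressing M (P lam 2))) := by
  have hl' : (lam : ℂ) ≠ 0 := Complex.ofReal_ne_zero.2 hl
  rw [toFun_injective_iff]
  intro g
  rw [map_neg, map_smul, map_mul, Pi.neg_apply, Pi.smul_apply, Pi.mul_apply, toFun_dressing_P_two,
    toFun_expP, expP_eq, Derivation.leibniz, dressing_gen]
  have h : toFun (gen 1 • dgen M 1 + gen 1 • dgen M 1) g =
    g.1 1 1 * toFun (dgen M 1) g + g.1 1 1 * toFun (dgen M 1) g := rfl
  rw [h, toFun_dgen_one, smul_eq_mul]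
  field_simp
  ring

theorem dressing_rotBasis_two_P (lam : ℝ) (a : Fin 3) :
    dressing (rotBasis 2).1 (P lam a) = ∑ c, eps a 2 c • P lam c := by
  obtain ⟨-, -, a₀, a₁, a₂⟩ := rotBasis_entries
  rw [toFun_injective_iff]
  intro g
  have hw := entry_zero_zero_ne g
  obtain rfl | rfl | rfl : a = 0 ∨ a = 1 ∨ a = 2 := by fin_cases a <;> simp
  · simp [map_ofNat, Fin.sum_univ_three, eps, toFun_dressing_P_zero, toFun_dgen_one, toFun_dgen_two,
      toFun_dgen_three, toFun_dgen_four, a₀, a₁, a₂, toFun_P_one]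
    field_simp
    ring_nf
  · simp [map_ofNat, Fin.sum_univ_three, eps, toFun_dressing_P_one, toFun_dgen_one, toFun_dgen_two,
      toFun_dgen_three, toFun_dgen_four, a₀, a₁, a₂, toFun_P_zero]
    field_simp
    ring_nf
    simp only [Complex.I_sq]
    ring_nf
  · simp [map_ofNat, eps, toFun_dressing_P_two, toFun_dgen_four, a₀, a₁, neg_div]

theorem dressing_rotBasis_P_two (lam : ℝ) (a : Fin 3) :
    dressing (rotBasis a).1 (P lam 2) = ∑ b, eps 2 a b • P lam b := by
  obtain ⟨⟨a₀, a₁, a₂⟩, ⟨b₀, b₁, b₂⟩, c₀, c₁, c₂⟩ := rotBasis_entries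
  rw [toFun_injective_iff]
  intro g
  have hw := entry_zero_zero_ne g
  obtain rfl | rfl | rfl : a = 0 ∨ a = 1 ∨ a = 2 := by fin_cases a <;> simp
  · simp [map_ofNat, Fin.sum_univ_three, eps, toFun_dressing_P_two, toFun_dgen_four, a₀, a₁, toFun_P_one]
    field_simp
    ring_nf
  · simp [map_ofNat, Fin.sum_univ_three, eps, toFun_dressing_P_two, toFun_dgen_four, b₀, b₁, toFun_P_zero]
    field_simp
    ring_nf
  · simp [map_ofNat, eps, toFun_dressing_P_two, toFun_dgen_four, c₀, c₁, neg_div]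

/-- With `v = z/w = λ(P₁ + i P₂)` and `β` the upper right entry, the field is of Riccati type, `v' =
-β̄ (1 - w⁻⁴) - β v²`, and `w⁻⁴` is the square of `exp(-λ P₃)`. The formula is its real and
imaginary parts, with `v²` rewritten through `P₁² + P₂²` and the products `P_b P_c`. -/
theorem dressing_rotBasis_P (lam : ℝ) (hl : lam ≠ 0) (a b : Fin 3) (ha : a ≠ 2) (hb : b ≠ 2) :
    dressing (rotBasis b).1 (P lam a) = (2⁻¹ * eps a b 2) •
        ((lam : ℂ)⁻¹ • (1 - expP lam hl ^ 2) + (lam : ℂ) • (P lam 0 ^ 2 + P lam 1 ^ 2)) -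
      ∑ c, (lam * eps a c 2) • (P lam b * P lam c) := by
  obtain ⟨⟨a₀, a₁, a₂⟩, ⟨b₀, b₁, b₂⟩, -⟩ := rotBasis_entries
  have hl' : (lam : ℂ) ≠ 0 := Complex.ofReal_ne_zero.2 hl
  rw [toFun_injective_iff]
  intro g
  have hw := entry_zero_zero_ne g
  have h : toFun ((lam : ℂ)⁻¹ • (1 - expP lam hl ^ 2) + (lam : ℂ) • (P lam 0 ^ 2 + P lam 1 ^ 2)) g =
      (lam : ℂ)⁻¹ * (1 - toFun (expP lam hl) g ^ 2) +
        lam * (toFun (P lam 0) g ^ 2 + toFun (P lam 1) g ^ 2) := rfl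
  rw [map_sub, map_smul, Pi.sub_apply, Pi.smul_apply, h, toFun_expP, toFun_P_zero, toFun_P_one]
  obtain rfl | rfl : a = 0 ∨ a = 1 := by omega
  all_goals obtain rfl | rfl : b = 0 ∨ b = 1 := by omega
  all_goals simp [map_ofNat, Fin.sum_univ_three, eps, toFun_dressing_P_zero, toFun_dressing_P_one,
      toFun_dgen_one, toFun_dgen_two, toFun_dgen_three, toFun_dgen_four, a₀, a₁, a₂, b₀, b₁, b₂,
      toFun_P_zero, toFun_P_one, entry_one_one_eq]
  all_goals field_simp
  all_goals ring_nf
  all_goals try simp only [Complex.I_sq]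
  all_goals try ring_nf

/-- Conjugation by `g` scales the upper right entry by `w⁻²`, which is `exp(-λ P₃)`, and creates a
diagonal part proportional to `z/w`, which is `P`. These are the extra terms in the coproduct of
`J`. -/
theorem rotCoeff_rotBasis_zero (lam : ℝ) (hl : lam ≠ 0) :
    rotCoeff (rotBasis 0).1 = ![expP lam hl, 0, (lam : ℂ) • P lam 0] := by
  obtain ⟨⟨a₀, a₁, a₂⟩, -⟩ := rotBasis_entries
  have hl' : (lam : ℂ) ≠ 0 := Complex.ofReal_ne_zero.2 hl
  funext k
  rw [toFun_injective_iff]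
  intro g
  obtain rfl | rfl | rfl : k = 0 ∨ k = 1 ∨ k = 2 := by fin_cases k <;> simp
  · simp [map_ofNat, toFun_rotCoeff_zero, a₁, toFun_expP]
    ring_nf
    simp
  · simp [map_ofNat, toFun_rotCoeff_one, a₁, neg_div]
  · have h : toFun ((lam : ℂ) • P lam 0) g = lam * toFun (P lam 0) g := rfl
    simp only [Matrix.cons_val, h]
    simp [map_ofNat, toFun_rotCoeff_two, a₀, a₁, toFun_P_zero]
    field_simp
    ring_nf
    simp only [Complex.I_sq]
    ring_nf

theorem rotCoeff_rotBasis_one (lam : ℝ) (hl : lam ≠ 0) :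
    rotCoeff (rotBasis 1).1 = ![0, expP lam hl, (lam : ℂ) • P lam 1] := by
  obtain ⟨-, ⟨a₀, a₁, a₂⟩, -⟩ := rotBasis_entries
  have hl' : (lam : ℂ) ≠ 0 := Complex.ofReal_ne_zero.2 hl
  funext k
  rw [toFun_injective_iff]
  intro g
  obtain rfl | rfl | rfl : k = 0 ∨ k = 1 ∨ k = 2 := by fin_cases k <;> simp
  · simp [map_ofNat, toFun_rotCoeff_zero, a₁]
  · simp [map_ofNat, toFun_rotCoeff_one, a₁, toFun_expP]
    ring_nf
  · have h : toFun ((lam : ℂ) • P lam 1) g = lam * toFun (P lam 1) g := rfl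
    simp only [Matrix.cons_val, h]
    simp [map_ofNat, toFun_rotCoeff_two, a₀, a₁, toFun_P_one]
    field_simp
    ring_nf

theorem rotCoeff_rotBasis_two : rotCoeff (rotBasis 2).1 = ![0, 0, 1] := by
  obtain ⟨-, -, a₀, a₁, a₂⟩ := rotBasis_entries
  funext k
  rw [toFun_injective_iff]
  intro g
  obtain rfl | rfl | rfl : k = 0 ∨ k = 1 ∨ k = 2 := by fin_cases k <;> simp
  · simp [toFun_rotCoeff_zero, a₁]
  · simp [toFun_rotCoeff_one, a₁]
  · simp [map_ofNat, toFun_rotCoeff_two, a₀, a₁]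
    ring_nf
    simp

end Iwasawa


/-! ### Generators, coproducts and the action on the coordinates `x_a`. -/

namespace Iwasawa

open Matrix ComplexConjugate Semidual

/-- Reduces every relation between functions and rotations to a value of a vector field. -/
theorem bInr_mul_J_sub (φ : FunSU2Star) (a : Fin 3) :
    bInr φ * bInl (J a) - bInl (J a) * bInr φ =
      Complex.I • bInr (dressing (rotBasis a).1 φ) := by
  have h : bInl (J a) = Complex.I • bInl (toEnv 1 (rotBasis a)) := by
    rw [J, toEnv_eq_smul, map_smul]
  rw [h, mul_smul_comm, smul_mul_assoc, bInr_mul_bInl, ← smul_sub, add_sub_cancel_left]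

theorem J_mul_sub (a b : Fin 3) :
    J a * J b - J b * J a = ∑ c, (Complex.I * eps a b c) • J c := by
  have key : ∀ c, J c * J (c + 1) - J (c + 1) * J c = Complex.I • J (c + 2) := by
    intro c
    have h : toEnv 1 (rotBasis (c + 2)) = toEnv 1 (rotBasis c) * toEnv 1 (rotBasis (c + 1)) -
        toEnv 1 (rotBasis (c + 1)) * toEnv 1 (rotBasis c) := by rw [← rotBasis_lie, toEnv_lie]
    simp only [J]
    rw [toEnv_eq_smul _ (rotBasis c), toEnv_eq_smul _ (rotBasis (c + 1)),
      toEnv_eq_smul _ (rotBasis (c + 2)), h, smul_mul_smul_comm, smul_mul_smul_comm, ← smul_sub,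
      smul_smul]
  have k₀ : J 0 * J 1 - J 1 * J 0 = Complex.I • J 2 := key 0
  have k₁ : J 1 * J 2 - J 2 * J 1 = Complex.I • J 0 := key 1
  have k₂ : J 2 * J 0 - J 0 * J 2 = Complex.I • J 1 := key 2
  have l₀ : J 1 * J 0 - J 0 * J 1 = -(Complex.I • J 2) := by rw [← k₀, neg_sub]
  have l₁ : J 2 * J 1 - J 1 * J 2 = -(Complex.I • J 0) := by rw [← k₁, neg_sub]
  have l₂ : J 0 * J 2 - J 2 * J 0 = -(Complex.I • J 1) := by rw [← k₂, neg_sub]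
  obtain rfl | rfl | rfl : a = 0 ∨ a = 1 ∨ a = 2 := by fin_cases a <;> simp
  all_goals obtain rfl | rfl | rfl : b = 0 ∨ b = 1 ∨ b = 2 := by fin_cases b <;> simp
  all_goals simp only [k₀, k₁, k₂, l₀, l₁, l₂, sub_self, Fin.sum_univ_three]
  all_goals simp [eps]
  all_goals norm_num

/-- The coordinates are recovered from the momenta: `z = λ (P₁ + i P₂) w`, `z̄` with the opposite
sign, and `log w = (λ/2) P₃`. -/
theorem adjoin_generators (lam : ℝ) (hl : lam ≠ 0) :
    Algebra.adjoin ℂ (Set.range (fun a => bInl (J a)) ∪ Set.range (fun a => bInr (P lam a)) ∪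
      {bInr (gen 0), bInr (gen 1)}) = ⊤ := by
  have hl' : (lam : ℂ) ≠ 0 := Complex.ofReal_ne_zero.2 hl
  rw [eq_top_iff, ← DerAction.adjoin_smash, Algebra.adjoin_le_iff]
  set A := Algebra.adjoin ℂ (Set.range (fun a => bInl (J a)) ∪
    Set.range (fun a => bInr (P lam a)) ∪ {bInr (gen 0), bInr (gen 1)})
  have hJ : ∀ a, bInl (J a) ∈ A := fun a => Algebra.subset_adjoin (Or.inl (Or.inl ⟨a, rfl⟩))
  have hP : ∀ a, bInr (P lam a) ∈ A := fun a => Algebra.subset_adjoin (Or.inl (Or.inr ⟨a, rfl⟩))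
  have h₀ : bInr (gen 0) ∈ A := Algebra.subset_adjoin (Or.inr (Or.inl rfl))
  have h₁ : bInr (gen 1) ∈ A := Algebra.subset_adjoin (Or.inr (Or.inr rfl))
  have hsum : gen 2 = (lam : ℂ) • ((P lam 0 + Complex.I • P lam 1) * gen 0) := by
    rw [toFun_injective_iff]
    intro g
    have h : toFun ((lam : ℂ) • ((P lam 0 + Complex.I • P lam 1) * gen 0)) g =
      lam * ((toFun (P lam 0) g + Complex.I * toFun (P lam 1) g) * g.1 0 0) := rfl
    have h' : toFun (gen 2) g = g.1 1 0 := rfl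
    rw [h, h', toFun_P_zero, toFun_P_one, entry_one_one_eq]
    have := entry_zero_zero_ne g
    field_simp
    ring
  have hdiff : gen 3 = (lam : ℂ) • ((P lam 0 - Complex.I • P lam 1) * gen 0) := by
    rw [toFun_injective_iff]
    intro g
    have h : toFun ((lam : ℂ) • ((P lam 0 - Complex.I • P lam 1) * gen 0)) g =
      lam * ((toFun (P lam 0) g - Complex.I * toFun (P lam 1) g) * g.1 0 0) := rfl
    have h' : toFun (gen 3) g = conj (g.1 1 0) := rfl
    rw [h, h', toFun_P_zero, toFun_P_one, entry_one_one_eq]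
    have := entry_zero_zero_ne g
    field_simp
    ring
  have hlog : gen 4 = ((lam : ℂ) / 2) • P lam 2 := by
    rw [P_two, smul_smul, div_mul_div_cancel₀ two_ne_zero, div_self hl', one_smul]
  rintro _ (⟨Y, rfl⟩ | ⟨φ, rfl⟩)
  · have hY : toEnv 1 Y = ∑ k, (Coalgebra.counit (R := ℂ) (rotCoeff Y.1 k) * -Complex.I) • J k := by
      rw [← sum_counit_rotCoeff]
      refine Finset.sum_congr rfl fun k _ => ?_
      rw [J, toEnv_eq_smul Complex.I, smul_smul, mul_assoc, neg_mul, Complex.I_mul_I, neg_neg,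
        mul_one]
    change bInl (toEnv 1 Y) ∈ A
    rw [hY, map_sum]
    exact sum_mem fun k _ => by rw [map_smul]; exact A.smul_mem (hJ k) _
  · change bInr φ ∈ A
    induction φ using coordRing_induction with
    | hgen i =>
      obtain rfl | rfl | rfl | rfl | rfl : i = 0 ∨ i = 1 ∨ i = 2 ∨ i = 3 ∨ i = 4 := by
        fin_cases i <;> simp
      · exact h₀
      · exact h₁
      · rw [hsum, map_smul, map_mul, map_add, map_smul]
        exact A.smul_mem (mul_mem (add_mem (hP 0) (A.smul_mem (hP 1) _)) h₀) _
      · rw [hdiff, map_smul, map_mul, map_sub, map_smul]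
        exact A.smul_mem (mul_mem (sub_mem (hP 0) (A.smul_mem (hP 1) _)) h₀) _
      · rw [hlog, map_smul]
        exact A.smul_mem (hP 2) _
    | halg c => rw [AlgHom.commutes]; exact A.algebraMap_mem c
    | hadd f g hf hg => rw [map_add]; exact add_mem hf hg
    | hmul f g hf hg => rw [map_mul]; exact mul_mem hf hg

theorem bComul_J (a : Fin 3) : bComul (bInl (J a)) = bInl (J a) ⊗ₜ 1 +
    ∑ k, bInr (rotCoeff (rotBasis a).1 k) ⊗ₜ[ℂ] bInl (J k) := by
  have h : ∀ a, bInl (J a) = Complex.I • bInl (toEnv 1 (rotBasis a)) := fun a => by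
    rw [J, toEnv_eq_smul, map_smul]
  simp only [h]
  rw [map_smul, bComul_inl_toEnv, smul_add, Finset.smul_sum]
  simp only [TensorProduct.tmul_smul, TensorProduct.smul_tmul']

theorem bComul_J_of_ne (lam : ℝ) (hl : lam ≠ 0) (i : Fin 3) (hi : i ≠ 2) :
    bComul (bInl (J i)) = bInl (J i) ⊗ₜ[ℂ] 1 + bInr (expP lam hl) ⊗ₜ[ℂ] bInl (J i) +
      (lam : ℂ) • (bInr (P lam i) ⊗ₜ[ℂ] bInl (J 2)) := by
  rw [bComul_J]
  obtain rfl | rfl : i = 0 ∨ i = 1 := by omega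
  · simp only [rotCoeff_rotBasis_zero lam hl, Fin.sum_univ_three, Matrix.cons_val, map_zero,
      map_smul, TensorProduct.zero_tmul, add_zero, ← TensorProduct.smul_tmul', ← add_assoc]
  · simp only [rotCoeff_rotBasis_one lam hl, Fin.sum_univ_three, Matrix.cons_val, map_zero,
      map_smul, TensorProduct.zero_tmul, zero_add, ← TensorProduct.smul_tmul', ← add_assoc]

theorem bComul_J_two : bComul (bInl (J 2)) = bInl (J 2) ⊗ₜ[ℂ] 1 + 1 ⊗ₜ[ℂ] bInl (J 2) := by
  rw [bComul_J]
  simp only [rotCoeff_rotBasis_two, Fin.sum_univ_three, Matrix.cons_val, map_zero, map_one,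
      TensorProduct.zero_tmul, zero_add]

theorem bComul_P_of_ne (lam : ℝ) (hl : lam ≠ 0) (i : Fin 3) (hi : i ≠ 2) :
    bComul (bInr (P lam i)) = bInr (P lam i) ⊗ₜ[ℂ] 1 + bInr (expP lam hl) ⊗ₜ[ℂ] bInr (P lam i) := by
  rw [bComul_inr, bComulInr_apply]
  obtain rfl | rfl : i = 0 ∨ i = 1 := by omega
  · rw [comulHom_P_zero lam hl, map_add, Algebra.TensorProduct.map_tmul,
      Algebra.TensorProduct.map_tmul, map_one]
  · rw [comulHom_P_one lam hl, map_add, Algebra.TensorProduct.map_tmul,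
      Algebra.TensorProduct.map_tmul, map_one]

theorem bComul_P_two (lam : ℝ) :
    bComul (bInr (P lam 2)) = bInr (P lam 2) ⊗ₜ[ℂ] 1 + 1 ⊗ₜ[ℂ] bInr (P lam 2) := by
  rw [bComul_inr, bComulInr_apply, comulHom_P_two, map_add, Algebra.TensorProduct.map_tmul,
    Algebra.TensorProduct.map_tmul, map_one]

/-- In `Y X = X Y + [Y, X]` the first term and the `su₂`-part of the bracket have zero counit on the
second factor, leaving the `su₂⋆`-part. -/
theorem lact_toEnv_toEnv (Y : su2) (X X' : su2Star) (h : ⁅Y.1, X.1⁆ - X'.1 ∈ su2) :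
    lact isFactorisation (toEnv 1 Y) (toEnv 1 X) = toEnv 1 X' := by
  have h₁ : ⁅LieSubalgebra.inclusion su2_le Y, LieSubalgebra.inclusion su2Star_le X⁆ =
      LieSubalgebra.inclusion su2Star_le X' + LieSubalgebra.inclusion su2_le ⟨_, h⟩ :=
    Subtype.ext (add_sub_cancel X'.1 ⁅Y.1, X.1⁆).symm
  have h₂ : inclSU2 (toEnv 1 Y) * inclSU2Star (toEnv 1 X) =
      inclSU2Star (toEnv 1 X) * inclSU2 (toEnv 1 Y) +
        (inclSU2Star (toEnv 1 X') * inclSU2 1 + inclSU2Star 1 * inclSU2 (toEnv 1 ⟨_, h⟩)) := by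
    rw [map_one inclSU2, map_one inclSU2Star, mul_one, one_mul]
    simp only [inclSU2_toEnv, inclSU2Star_toEnv]
    rw [← toEnv_add, ← h₁, toEnv_lie]
    abel
  rw [lact_eq, h₂, map_add, map_add, proj₁_mul, proj₁_mul, proj₁_mul, counit_toEnv, counit_toEnv,
    Bialgebra.counit_one]
  simp

theorem lie_rotBasis_transBasis (lam : ℝ) (a b : Fin 3) :
    ⁅(rotBasis a).1, (transBasis lam b).1⁆ -
      (∑ c, (eps a b c).re • transBasis lam c : su2Star).1 ∈ su2 := by
  have h : (∑ c, (eps a b c).re • transBasis lam c : su2Star).1 =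
      ∑ c, (eps a b c).re • (transBasis lam c).1 := by
    simp only [Fin.sum_univ_three]
    rfl
  rw [h, LieRing.of_associative_ring_bracket, Fin.sum_univ_three]
  fin_cases a <;> fin_cases b
  all_goals
    refine ⟨?_, ?_⟩
    · simp [Matrix.trace_fin_two, rotBasis, transBasis, eps]
      try ring_nf
    · ext r s
      fin_cases r <;> fin_cases s <;> simp [rotBasis, transBasis, eps]
      all_goals try ring_nf
      all_goals try simp only [Complex.I_sq]
      all_goals try ring_nf

theorem lact_J_x (lam : ℝ) (a b : Fin 3) : lact isFactorisation (J a) (x lam b) =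
    ∑ c, (Complex.I * eps a b c) • x lam c := by
  -- The bracket is computed in a real Lie algebra, where only real coefficients are available.
  have hre : ∀ c, ((eps a b c).re : ℂ) = eps a b c := by
    intro c
    refine Complex.conj_eq_iff_re.1 ?_
    simp [eps, map_ofNat]
  rw [J, x, toEnv_eq_smul, toEnv_eq_smul Complex.I (transBasis lam b), map_smul, map_smul,
    LinearMap.smul_apply, smul_smul, Complex.I_mul_I,
    lact_toEnv_toEnv _ _ _ (lie_rotBasis_transBasis lam a b)]
  simp only [Fin.sum_univ_three, toEnv_add, toEnv_smul, hre, x]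
  rw [toEnv_eq_smul Complex.I (transBasis lam 0), toEnv_eq_smul Complex.I (transBasis lam 1),
    toEnv_eq_smul Complex.I (transBasis lam 2)]
  simp only [smul_add, smul_smul, mul_right_comm Complex.I, Complex.I_mul_I]

end Iwasawa


/-! ### The commutation relations inside the bicrossproduct. -/

namespace Iwasawa

open Matrix ComplexConjugate Semidual

theorem bInl_J_mul_sub (a b : Fin 3) : bInl (J a) * bInl (J b) - bInl (J b) * bInl (J a) =
    ∑ c, (Complex.I * eps a b c) • bInl (J c) := by
  rw [← map_mul, ← map_mul, ← map_sub, J_mul_sub, map_sum]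
  simp only [map_smul]

theorem bInr_mul_comm (φ ψ : FunSU2Star) : bInr φ * bInr ψ = bInr ψ * bInr φ := by
  rw [← map_mul, ← map_mul, mul_comm]

theorem expP_mul_J_sub (lam : ℝ) (hl : lam ≠ 0) (a : Fin 3) :
    bInr (expP lam hl) * bInl (J a) - bInl (J a) * bInr (expP lam hl) =
      -((lam : ℂ) • (bInr (expP lam hl) *
        (bInr (P lam 2) * bInl (J a) - bInl (J a) * bInr (P lam 2)))) := by
  rw [bInr_mul_J_sub, bInr_mul_J_sub, dressing_expP, map_neg, map_smul, map_mul, mul_smul_comm,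
    smul_neg, smul_comm]

theorem P_mul_J_two_sub (lam : ℝ) (a : Fin 3) :
    bInr (P lam a) * bInl (J 2) - bInl (J 2) * bInr (P lam a) =
      ∑ c, (Complex.I * eps a 2 c) • bInr (P lam c) := by
  rw [bInr_mul_J_sub, dressing_rotBasis_two_P, map_sum, Finset.smul_sum]
  simp only [map_smul, smul_smul]

theorem P_two_mul_J_sub (lam : ℝ) (a : Fin 3) :
    bInr (P lam 2) * bInl (J a) - bInl (J a) * bInr (P lam 2) =
      ∑ b, (Complex.I * eps 2 a b) • bInr (P lam b) := by
  rw [bInr_mul_J_sub, dressing_rotBasis_P_two, map_sum, Finset.smul_sum]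
  simp only [map_smul, smul_smul]

theorem P_mul_J_sub (lam : ℝ) (hl : lam ≠ 0) (a b : Fin 3) (ha : a ≠ 2) (hb : b ≠ 2) :
    bInr (P lam a) * bInl (J b) - bInl (J b) * bInr (P lam a) =
      (Complex.I / 2 * eps a b 2) • ((lam : ℂ)⁻¹ • (1 - bInr (expP lam hl) ^ 2) +
        (lam : ℂ) • (bInr (P lam 0) ^ 2 + bInr (P lam 1) ^ 2)) -
      ∑ c, (Complex.I * lam * eps a c 2) • (bInr (P lam b) * bInr (P lam c)) := by
  rw [bInr_mul_J_sub, dressing_rotBasis_P lam hl a b ha hb]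
  simp only [map_sub, map_add, map_smul, map_pow, map_sum, map_mul, map_one, smul_sub,
    Finset.smul_sum, smul_smul, smul_add, div_eq_mul_inv, mul_assoc]

end Iwasawa

end

theorem mainTheorem4 (lam : ℝ) (hl : lam ≠ 0) :
    -- the Iwasawa factorisation of the group, with its explicit formulas
    (∀ g : Matrix.SpecialLinearGroup (Fin 2) ℂ,
      ∃! q : Iwasawa.SU2Star × Iwasawa.SU2, g = q.1.1 * q.2.1) ∧
    (∀ (g : Matrix.SpecialLinearGroup (Fin 2) ℂ) (q : Iwasawa.SU2Star × Iwasawa.SU2),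
      g = q.1.1 * q.2.1 →
        q.1 = Iwasawa.solvablePart g ∧
        q.2.1 0 0 = ((√(‖g 0 0‖ ^ 2 + ‖g 0 1‖ ^ 2) : ℝ) : ℂ)⁻¹ * g 0 0 ∧
        q.2.1 0 1 = ((√(‖g 0 0‖ ^ 2 + ‖g 0 1‖ ^ 2) : ℝ) : ℂ)⁻¹ * g 0 1) ∧
    -- the noncommutative spacetime `U(su₂⋆)`
    (∀ i : Fin 3, i ≠ 2 →
      Iwasawa.x lam i * Iwasawa.x lam 2 - Iwasawa.x lam 2 * Iwasawa.x lam i =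
        (Complex.I * lam) • Iwasawa.x lam i) ∧
    Iwasawa.x lam 0 * Iwasawa.x lam 1 = Iwasawa.x lam 1 * Iwasawa.x lam 0 ∧
    Function.Bijective (Iwasawa.normalOrder lam) ∧
    -- the Hopf algebra factorisation `U(sl₂) = U(su₂⋆) ⋈ U(su₂)`
    ∃ hF : Semidual.IsFactorisation Iwasawa.inclSU2Star Iwasawa.inclSU2,
      Semidual.IsMatched hF ∧
      -- the dual pairing of `ℂ[SU₂⋆]` with `U(su₂⋆)`, the dualised action and coaction
      ∃ (p : Iwasawa.FunSU2Star →ₗ[ℂ] Iwasawa.Env Iwasawa.su2Star →ₗ[ℂ] ℂ)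
        (r : Iwasawa.FunSU2Star →ₗ[ℂ] Iwasawa.Env Iwasawa.su2 →ₗ[ℂ] Iwasawa.FunSU2Star)
        (δ : Iwasawa.Env Iwasawa.su2 →ₗ[ℂ] Iwasawa.FunSU2Star ⊗[ℂ] Iwasawa.Env Iwasawa.su2),
        Semidual.IsHopfPairing p ∧ Iwasawa.IsDerivativePairing p ∧
        Semidual.IsDualAction hF p r ∧ Iwasawa.IsDressingAction r ∧
        Semidual.IsDualCoaction hF p δ ∧
        -- the semidual `U(su₂) ▷◂ ℂ[SU₂⋆]` and its action on `U(su₂⋆)`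
        ∃ (B : Type) (_ : Ring B) (_ : HopfAlgebra ℂ B)
          (e : Iwasawa.Env Iwasawa.su2 ⊗[ℂ] Iwasawa.FunSU2Star ≃ₗ[ℂ] B)
          (act : B →ₗ[ℂ] Iwasawa.Env Iwasawa.su2Star →ₗ[ℂ] Iwasawa.Env Iwasawa.su2Star),
          Semidual.IsBicrossproduct r δ e ∧
          Semidual.IsCanonicalAction hF p e act ∧
          Semidual.IsModuleAlgebra act ∧
          let J : Fin 3 → B := fun a => e (Iwasawa.J a ⊗ₜ[ℂ] 1)
          let P : Fin 3 → B := fun a => e (1 ⊗ₜ[ℂ] Iwasawa.P lam a)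
          let E : B := e (1 ⊗ₜ[ℂ] Iwasawa.expP lam hl)
          -- generators
          Algebra.adjoin ℂ (Set.range J ∪ Set.range P ∪
            {e (1 ⊗ₜ[ℂ] Iwasawa.gen 0), e (1 ⊗ₜ[ℂ] Iwasawa.gen 1)}) = ⊤ ∧
          -- relations
          (∀ a b, J a * J b - J b * J a = ∑ c, (Complex.I * Iwasawa.eps a b c) • J c) ∧
          (∀ a b, P a * P b = P b * P a) ∧
          (∀ a, P a * E = E * P a) ∧
          (∀ a, E * J a - J a * E = -((lam : ℂ) • (E * (P 2 * J a - J a * P 2)))) ∧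
          (∀ a, P a * J 2 - J 2 * P a = ∑ c, (Complex.I * Iwasawa.eps a 2 c) • P c) ∧
          (∀ a, P 2 * J a - J a * P 2 = ∑ b, (Complex.I * Iwasawa.eps 2 a b) • P b) ∧
          (∀ a b, a ≠ 2 → b ≠ 2 → P a * J b - J b * P a =
            (Complex.I / 2 * Iwasawa.eps a b 2) •
              ((lam : ℂ)⁻¹ • (1 - E ^ 2) + (lam : ℂ) • (P 0 ^ 2 + P 1 ^ 2)) -
            ∑ c, (Complex.I * lam * Iwasawa.eps a c 2) • (P b * P c)) ∧
          -- coproducts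
          (∀ i, i ≠ 2 → Coalgebra.comul (R := ℂ) (J i) =
            J i ⊗ₜ[ℂ] 1 + E ⊗ₜ[ℂ] J i + (lam : ℂ) • (P i ⊗ₜ[ℂ] J 2)) ∧
          (∀ i, i ≠ 2 → Coalgebra.comul (R := ℂ) (P i) = P i ⊗ₜ[ℂ] 1 + E ⊗ₜ[ℂ] P i) ∧
          Coalgebra.comul (R := ℂ) (J 2) = J 2 ⊗ₜ[ℂ] 1 + 1 ⊗ₜ[ℂ] J 2 ∧
          Coalgebra.comul (R := ℂ) (P 2) = P 2 ⊗ₜ[ℂ] 1 + 1 ⊗ₜ[ℂ] P 2 ∧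
          -- the action on the noncommutative spacetime
          (∀ a b, act (J a) (Iwasawa.x lam b) =
            ∑ c, (Complex.I * Iwasawa.eps a b c) • Iwasawa.x lam c) ∧
          (∀ (a : Fin 3) (f : MvPolynomial (Fin 3) ℂ),
            act (P a) (Iwasawa.normalOrder lam f) =
              Complex.I • Iwasawa.normalOrder lam (MvPolynomial.pderiv a f)) := by
  refine ⟨Iwasawa.iwasawa, fun g q h => Iwasawa.iwasawa_formulas h, Iwasawa.x_lie_two lam,
    Iwasawa.x_zero_mul_x_one lam, Iwasawa.normalOrder_bijective lam hl, Iwasawa.isFactorisation,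
    Semidual.isMatched _, Iwasawa.pairing, Iwasawa.dressingSU2.act, Iwasawa.coaction,
    Iwasawa.isHopfPairing, Iwasawa.isDerivativePairing, Iwasawa.isDualAction,
    Iwasawa.isDressingAction, Iwasawa.isDualCoaction, Iwasawa.Bicross, inferInstance,
    inferInstance, Iwasawa.dressingSU2.smashEquiv, Iwasawa.bicrossAct, Iwasawa.isBicrossproduct,
    Iwasawa.isCanonicalAction, Iwasawa.isModuleAlgebra, ?_⟩
  exact ⟨Iwasawa.adjoin_generators lam hl, Iwasawa.bInl_J_mul_sub, fun a b => Iwasawa.bInr_mul_comm _ _,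
    fun a => Iwasawa.bInr_mul_comm _ _, Iwasawa.expP_mul_J_sub lam hl, Iwasawa.P_mul_J_two_sub lam,
    Iwasawa.P_two_mul_J_sub lam, Iwasawa.P_mul_J_sub lam hl, Iwasawa.bComul_J_of_ne lam hl,
    Iwasawa.bComul_P_of_ne lam hl, Iwasawa.bComul_J_two, Iwasawa.bComul_P_two lam,
    fun a b => (Iwasawa.bicrossAct_inl _ _).trans (Iwasawa.lact_J_x lam a b),
    fun a f => (Iwasawa.bicrossAct_inr _ _).trans (Iwasawa.coregular_P_normalOrder lam hl a f)⟩
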